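/- Conventions. All alphabets are finite. For a language $L\subseteq\Sigma^*$ and $w\in\Sigma^*$ let $w^{-1}L=\{x\mid wx\in L\}$; the complexity $\kappa(L)$ of $L$ over $\Sigma$ is the number of distinct quotients $w^{-1}L$, $w\in\Sigma^*$. $L$ is a left ideal over $\Sigma$ if $L=\Sigma^*L$. The syntactic semigroup of $L$ is $\Sigma^+/{\approx_L}$, where $x\approx_L y$ iff $wxz\in L\Leftrightarrow wyz\in L$ for all $w,z\in\Sigma^*$. If $K$ is the set of quotients of $L$, an atom of $L$ is a non-empty language $A_S=\bigcap_{M\in S}M\cap\bigcap_{M\in K\setminus S}(\Sigma^*\setminus M)$ with $S\subseteq K$. For a partial map $\pi$ of letters, the dialect of $L$ given by $\pi$ is obtained by replacing each letter $x$ by $\pi(x)$ in every word of $L$, deleting the words with a letter at which $\pi$ is undefined; its alphabet is the range of $\pi$. For operands over $\Sigma'$ and $\Sigma$, the complexity of product, union and symmetric difference is taken over $\Sigma'\cup\Sigma$, that of the difference over $\Sigma'$, and that of the intersection over $\Sigma'\cap\Sigma$; the restricted case is $\Sigma'=\Sigma$. A binary boolean operation is proper if it depends on both arguments. For $n\ge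 4$ let $\mathcal D_n$ be the DFA with states $Q_n=\{0,\dots,n-1\}$, alphabet $\{a,b,c,d,e\}$, initial state $0$, only final state $n-1$, and transitions $a\colon(1,\dots,n-1)$ (a cycle), $b\colon(1,2)$ (a transposition), $c\colon(n-1\to1)$, $d\colon(n-1\to0)$ (each of these four fixes the states it does not mention), and $e$ sending every state to $1$. Let $L_n$ be its language. Theorem (Most Complex Left Ideals). For each $n\ge4$ the DFA $\mathcal D_n$ is minimal and $L_n$ is a regular left ideal of complexity $n$. The stream $(L_n\mid n\ge4)$, with some dialect streams, is most complex in the class of regular left ideals: for all $m,n\ge4$, the following values are upper bounds for all regular left ideals of complexity $n$ (respectively, for all pairs of regular left ideals of complexities $m$ and $n$), and they are met by $L_n$ in 1–5, by $L_mL_n$ in 6(a), and in 6(b), 7(a) and 7(b) by dialects of $L_m$ and $L_n$ that are regular left ideals of complexities $m$ and $n$ and are given by partial maps not depending on $m$ and $n$. 1. Size of the syntactic semigroup: $n^{n-1}+n-1$. 2. Complexity of each quotient: $n$. 3. Complexity of the reverse, and number of atoms: $2^{n-1}+1$. 4. Complexity of each atom $A_S$: $n$ if $S$ is the set of all quotients;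 $2^{n-1}$ if $S=\emptyset$; and $1+\sum_{x=1}^{|S|}\sum_{y=1}^{n-|S|}\binom{n-1}{x}\binom{n-x-1}{y-1}$ otherwise. 5. Complexity of the star: $n+1$. 6. Complexity of the product: (a) restricted: $m+n-1$; (b) unrestricted: $mn+m+n$. 7. Boolean operations: (a) restricted: $mn$ for every proper binary boolean operation; (b) unrestricted: $(m+1)(n+1)$ for union and symmetric difference, $mn+m$ for difference, $mn$ for intersection. Moreover, at least five letters are required: for $n\ge4$, every regular left ideal of complexity $n$ that meets the bound in 1 has an alphabet of at least five letters. -/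

import Mathlib

namespace StateComplexity

universe u

/-! Words, quotients and complexity over an alphabet `A`, a set of letters of the type `α`. -/

section General

variable {α : Type u}

/-- `A*`, the set of all words over the alphabet `A`. -/
def words (A : Set α) : Language α := {w | ∀ x ∈ w, x ∈ A}

/-- The set of the (left) quotients `w⁻¹L`, `w ∈ A*`, of a language `L` over `A`. -/
def quotients (A : Set α) (L : Language α) : Set (Language α) :=
  {K | ∃ w ∈ words A, K = L.leftQuotient w}

/-- The (quotient/state) complexity of a language `L` over the alphabet `A`: the number of its
distinct quotients (`⊤` if there are infinitely many). -/
noncomputable def complexity (A : Set α) (L : Language α) : ℕ∞ := (quotients A L).encard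

/-- `L` is a regular left ideal over the finite alphabet `A`: a regular language `L ⊆ A*` that
satisfies `L = A* L`. -/
structure IsRegularLeftIdeal (A : Set α) (L : Language α) : Prop where
  finite_alphabet : A.Finite
  subset_words : L ≤ words A
  isRegular : L.IsRegular
  eq_words_mul : L = words A * L

/-- The set `A⁺` of nonempty words over `A`. -/
def NonemptyWord (A : Set α) : Type u := {w : List α // w ∈ words A ∧ w ≠ []}

/-- The syntactic (Myhill) congruence of `L` on `A⁺`:
`x ≈ y` iff `w x z ∈ L ↔ w y z ∈ L` for all `w, z ∈ A*`. -/
def syntacticCongruence (A : Set α) (L : Language α) : Setoid (NonemptyWord A) where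
  r x y := ∀ w ∈ words A, ∀ z ∈ words A, w ++ x.1 ++ z ∈ L ↔ w ++ y.1 ++ z ∈ L
  iseqv :=
    { refl := fun _ _ _ _ _ => Iff.rfl
      symm := fun h w hw z hz => (h w hw z hz).symm
      trans := fun h k w hw z hz => (h w hw z hz).trans (k w hw z hz) }

/-- The cardinality of the syntactic semigroup `A⁺/≈` of `L`. -/
noncomputable def syntacticSemigroupCard (A : Set α) (L : Language α) : ℕ∞ :=
  ENat.card (Quotient (syntacticCongruence A L))

/-- The atomic intersection `A_S` for a set `S` of quotients of `L`: the intersection of all the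
quotients in `S` and of the complements (in `A*`) of all the quotients not in `S`. -/
def atomicIntersection (A : Set α) (L : Language α) (S : Set (Language α)) : Language α :=
  {x | x ∈ words A ∧ (∀ K ∈ S, x ∈ K) ∧ ∀ K ∈ quotients A L \ S, x ∉ K}

/-- `S` is a set of quotients of `L` whose atomic intersection is nonempty, that is, is an atom. -/
def IndexesAtom (A : Set α) (L : Language α) (S : Set (Language α)) : Prop :=
  S ⊆ quotients A L ∧ ∃ x, x ∈ atomicIntersection A L S

/-- The set of the atoms of `L`. -/
def atoms (A : Set α) (L : Language α) : Set (Language α) :=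
  {X | ∃ S, IndexesAtom A L S ∧ X = atomicIntersection A L S}

/-- A binary boolean function is proper if it depends on both of its arguments. -/
def IsProper (f : Bool → Bool → Bool) : Prop :=
  (∃ y, f false y ≠ f true y) ∧ (∃ x, f x false ≠ f x true)

open Classical in
/-- The language `K ∘ L` over `A` for the binary boolean operation `∘` given by `f`. -/
def boolOp (f : Bool → Bool → Bool) (A : Set α) (K L : Language α) : Language α :=
  {w | w ∈ words A ∧ f (decide (w ∈ K)) (decide (w ∈ L)) = true}

/-- All states are reachable and no two states are equivalent. -/
def IsMinimalDFA {σ : Type} (M : DFA α σ) : Prop :=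
  (∀ q, ∃ w, M.eval w = q) ∧ ∀ p q, M.acceptsFrom p = M.acceptsFrom q → p = q

/-- The alphabet of the dialect given by the partial map `π`. -/
def dialectAlphabet {β : Type u} (π : α → Option β) : Set β := {y | ∃ x, π x = some y}

/-- The dialect of `L` given by the partial map `π`: in each word of `L` every letter `x` is
replaced by `π x`, and the word is deleted if `π x` is undefined for one of its letters. -/
def dialect {β : Type u} (π : α → Option β) (L : Language α) : Language β :=
  {v | ∃ w ∈ L, w.map π = v.map some}

end General

/-- For the complexity of the atom `A_S` of a left ideal with `n` quotients, where `s = |S|`: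
the maximal value. -/
def atomBound (n s : ℕ) : ℕ :=
  if s = n then n
  else if s = 0 then 2 ^ (n - 1)
  else 1 + ∑ x ∈ Finset.Icc 1 s, ∑ y ∈ Finset.Icc 1 (n - s),
    (n - 1).choose x * (n - x - 1).choose (y - 1)

/-- The five letters. -/
inductive Letter : Type
  | a | b | c | d | e

/-- The action of the letters on the states `0, …, n-1`:
`a : (1, …, n-1)`, `b : (1, 2)`, `c : (n-1 → 1)`, `d : (n-1 → 0)`, `e : (Q_n → 1)`. -/
def witnessStep (n : ℕ) (hn : 4 ≤ n) (q : Fin n) : Letter → Fin n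
  | Letter.a =>
      if q.val = 0 then q
      else if h : q.val + 1 < n then ⟨q.val + 1, h⟩
      else ⟨1, by omega⟩
  | Letter.b =>
      if q.val = 1 then ⟨2, by omega⟩
      else if q.val = 2 then ⟨1, by omega⟩
      else q
  | Letter.c => if q.val = n - 1 then ⟨1, by omega⟩ else q
  | Letter.d => if q.val = n - 1 then ⟨0, by omega⟩ else q
  | Letter.e => ⟨1, by omega⟩

/-- The DFA `D_n(a,b,c,d,e)` with initial state `0` and set of final states `{n-1}`. -/
def witnessDFA (n : ℕ) (hn : 4 ≤ n) : DFA Letter (Fin n) where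
  step := witnessStep n hn
  start := ⟨0, by omega⟩
  accept := {⟨n - 1, by omega⟩}

/-- The language `L_n(a,b,c,d,e)` of `D_n(a,b,c,d,e)`. -/
def witness (n : ℕ) (hn : 4 ≤ n) : Language Letter := (witnessDFA n hn).accepts

end StateComplexity

/-! A left ideal `L` is contained in each of its quotients, because `x ∈ L` gives `u ++ x ∈ L`. So
the quotients form a poset with least element `L`, on which words act monotonically, and the upper
bounds rest on this bottom element.

The syntactic semigroup embeds in the monotone self-maps of the poset. If no two elements other than
the bottom are strictly comparable, these are at most the `n ^ (n - 1)` maps fixing the bottom and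
the `n - 1` constants to other elements; any further comparability makes the count strictly smaller
(`card_orderHom_lt`). Equality therefore forces every map fixing the bottom to come from a word, and
`five_le_encard_of_generates` then finds five letters: two permutations, a singular letter under
which only the bottom goes to the bottom, a singular letter that also sends another element there,
and a letter moving the bottom.

The complexity of the reverse is the number of atoms. A set of quotients that indexes an atom and
contains `L` contains all quotients, whence `2 ^ (n - 1) + 1`. The quotients of an atom are coded by
pairs of disjoint sets of quotients other than `L` (`complexity_atom_le_of_notMem`). For products,
`X * L = L` as soon as `[] ∈ X`; for the star, only the empty word is added. With unequal alphabets
the empty language may occur as an additional quotient of an operand, which turns `m` and `n` into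
`m + 1` and `n + 1`.

The bounds are met by the unary measures because words induce all transformations fixing `0`
(`realizable_of_fix_zero`) and all constants (`realizable_const`); in particular every set of
nonzero states is the exact set of states accepting some word. For boolean operations the dialects
contain letters that reset one automaton while permuting the states of the other (`ActCrosswise`),
so the two runs can be steered independently. For the unrestricted product, `productDFA` needs only
one state of the second automaton at a time, since the language accepted from its initial state is
contained in that of every other state; all its admissible pairs are reachable and pairwise
separable. -/

namespace StateComplexity

/-! ### Quotients, left ideals and upper bounds for star, product, reversal -/

section Basic

variable {α : Type*} {A B : Set α} {K L : Language α} {u v w : List α} {m n : ℕ}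

theorem nil_mem_words : [] ∈ words A := fun _ hx => by simp at hx

theorem mem_words : w ∈ words A ↔ ∀ x ∈ w, x ∈ A := Iff.rfl

theorem append_mem_words : u ++ v ∈ words A ↔ u ∈ words A ∧ v ∈ words A := by
  simp only [mem_words, List.mem_append]
  grind

theorem cons_mem_words {x : α} : x :: v ∈ words A ↔ x ∈ A ∧ v ∈ words A := by
  simp [mem_words]

theorem reverse_mem_words : w.reverse ∈ words A ↔ w ∈ words A := by
  simp [mem_words]

theorem words_mono (h : A ⊆ B) (hw : w ∈ words A) : w ∈ words B :=
  fun x hx => h (hw x hx)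

theorem self_mem_quotients : L ∈ quotients A L := ⟨[], nil_mem_words, rfl⟩

theorem leftQuotient_mem_quotients (hK : K ∈ quotients A L) (hw : w ∈ words A) :
    K.leftQuotient w ∈ quotients A L := by
  obtain ⟨u, hu, rfl⟩ := hK
  exact ⟨u ++ w, append_mem_words.2 ⟨hu, hw⟩, by rw [Language.leftQuotient_append]⟩

theorem quotients_subset_of_mem (hK : K ∈ quotients A L) : quotients A K ⊆ quotients A L := by
  rintro _ ⟨w, hw, rfl⟩
  exact leftQuotient_mem_quotients hK hw

theorem leftQuotient_mono (h : K ≤ L) (w : List α) : K.leftQuotient w ≤ L.leftQuotient w :=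
  fun _ hx => h hx

theorem le_words_of_mem_quotients (hL : L ≤ words A) (hK : K ∈ quotients A L) : K ≤ words A := by
  obtain ⟨u, hu, rfl⟩ := hK
  exact fun x hx => (append_mem_words.1 (hL hx)).2

theorem leftQuotient_eq_zero (hL : L ≤ words A) (hw : w ∉ words A) : L.leftQuotient w = 0 := by
  ext x
  simp only [Language.mem_leftQuotient, Language.notMem_zero, iff_false]
  exact fun hx => hw (append_mem_words.1 (hL hx)).1

theorem quotients_subset_insert_zero (hL : L ≤ words A) :
    quotients B L ⊆ insert 0 (quotients A L) := by
  rintro _ ⟨w, hw, rfl⟩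
  by_cases h : w ∈ words A
  · exact Or.inr ⟨w, h, rfl⟩
  · exact Or.inl (leftQuotient_eq_zero hL h)

theorem leftQuotient_mem_insert_zero (hL : L ≤ words A) (hK : K ∈ insert 0 (quotients A L))
    (w : List α) : K.leftQuotient w ∈ insert 0 (quotients A L) := by
  rcases hK with rfl | hK
  · exact Or.inl rfl
  · by_cases h : w ∈ words A
    · exact Or.inr (leftQuotient_mem_quotients hK h)
    · exact Or.inl (leftQuotient_eq_zero (le_words_of_mem_quotients hL hK) h)

theorem complexity_le_encard {T : Set (Language α)}
    (h : ∀ w ∈ words A, L.leftQuotient w ∈ T) : complexity A L ≤ T.encard := by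
  refine Set.encard_le_encard ?_
  rintro _ ⟨w, hw, rfl⟩
  exact h w hw

theorem encard_le_complexity {ι : Type*} {S : Set ι} {F : ι → Language α} (hF : Set.InjOn F S)
    (h : ∀ i ∈ S, F i ∈ quotients A L) : S.encard ≤ complexity A L := by
  rw [← hF.encard_image]
  refine Set.encard_le_encard ?_
  rintro _ ⟨i, hi, rfl⟩
  exact h i hi

theorem natCard_le_complexity {ι : Type*} [Finite ι] {F : ι → Language α}
    (hF : Function.Injective F) (h : ∀ i, F i ∈ quotients A L) :
    (Nat.card ι : ℕ∞) ≤ complexity A L := by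
  have := encard_le_complexity (S := Set.univ) hF.injOn (fun i _ => h i)
  rwa [Set.encard_univ, ENat.card_eq_coe_natCard] at this

theorem ne_zero_of_complexity (h : complexity A L = n) (hn : 2 ≤ n) : L ≠ 0 := by
  rintro rfl
  have : complexity A (0 : Language α) ≤ 1 := by
    rw [← Set.encard_singleton (0 : Language α)]
    exact complexity_le_encard fun w _ => rfl
  rw [h] at this
  have := Nat.cast_le (α := ℕ∞).1 (this.trans_eq Nat.cast_one.symm)
  omega

namespace IsRegularLeftIdeal

theorem append_mem (h : IsRegularLeftIdeal A L) (hu : u ∈ words A) (hv : v ∈ L) :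
    u ++ v ∈ L := by
  rw [h.eq_words_mul]
  exact Language.append_mem_mul hu hv

theorem le_leftQuotient (h : IsRegularLeftIdeal A L) (hu : u ∈ words A) :
    L ≤ L.leftQuotient u :=
  fun _ hx => h.append_mem hu hx

theorem le_of_mem_quotients (h : IsRegularLeftIdeal A L) (hK : K ∈ quotients A L) : L ≤ K := by
  obtain ⟨u, hu, rfl⟩ := hK
  exact h.le_leftQuotient hu

theorem mul_le (h : IsRegularLeftIdeal A L) (hK : K ≤ words A) : K * L ≤ L := by
  rintro x ⟨u, hu, v, hv, rfl⟩
  exact h.append_mem (hK hu) hv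

theorem zero_notMem_quotients (h : IsRegularLeftIdeal A L) (hL : L ≠ 0) :
    0 ∉ quotients A L := fun h0 =>
  hL (le_antisymm (h.le_of_mem_quotients h0) (fun _ hx => hx.elim))

theorem exists_nil_mem_quotients (h : IsRegularLeftIdeal A L) (hL : L ≠ 0) :
    ∃ K ∈ quotients A L, [] ∈ K := by
  obtain ⟨w, hw⟩ : ∃ w, w ∈ L := by
    by_contra! h'
    exact hL (by ext x; simpa using h' x)
  exact ⟨L.leftQuotient w, ⟨w, h.subset_words hw, rfl⟩, by simpa using hw⟩

end IsRegularLeftIdeal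

theorem mem_mul_leftQuotient_singleton {x : α} :
    v ∈ (K * L).leftQuotient [x] ↔
      v ∈ K.leftQuotient [x] * L ∨ [] ∈ K ∧ v ∈ L.leftQuotient [x] := by
  simp only [Language.mem_leftQuotient, Language.mem_mul, List.singleton_append]
  constructor
  · rintro ⟨a, ha, b, hb, hab⟩
    cases a with
    | nil => exact Or.inr ⟨ha, by simpa [← hab] using hb⟩
    | cons y a =>
      simp only [List.cons_append, List.cons.injEq] at hab
      obtain ⟨rfl, rfl⟩ := hab
      exact Or.inl ⟨a, ha, b, hb, rfl⟩
  · rintro (⟨a, ha, b, hb, rfl⟩ | ⟨h1, h2⟩)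
    · exact ⟨x :: a, ha, b, hb, rfl⟩
    · exact ⟨[], h1, _, h2, rfl⟩

/-! Star -/

/-- A nonempty concatenation of words of `L` ends in a word of `L`, so it lies in the left ideal `L`
itself. -/
theorem kstar_eq (h : IsRegularLeftIdeal A L) : KStar.kstar L = L ⊔ 1 := by
  ext x
  change x ∈ KStar.kstar L ↔ x ∈ L ∨ x ∈ (1 : Language α)
  rw [Language.mem_kstar, Language.mem_one]
  constructor
  · rintro ⟨S, rfl, hS⟩
    induction S with
    | nil => simp
    | cons y S ih =>
      have hy := hS y (by simp)
      left
      rcases ih (fun z hz => hS z (by simp [hz])) with h1 | h1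
      · exact h.append_mem (h.subset_words hy) h1
      · simpa [h1] using hy
  · rintro (hx | rfl)
    · exact ⟨[x], by simp, by simpa using hx⟩
    · exact ⟨[], by simp⟩

theorem kstar_leftQuotient (h : IsRegularLeftIdeal A L) (hw : w ≠ []) :
    (KStar.kstar L).leftQuotient w = L.leftQuotient w := by
  rw [kstar_eq h]
  ext x
  change w ++ x ∈ L ∨ w ++ x ∈ (1 : Language α) ↔ w ++ x ∈ L
  simp [Language.mem_one, hw]

theorem complexity_kstar_le (h : IsRegularLeftIdeal A L) (hc : complexity A L = n) :
    complexity A (KStar.kstar L) ≤ (n + 1 : ℕ) := by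
  refine (complexity_le_encard (T := insert (KStar.kstar L) (quotients A L)) ?_).trans ?_
  · intro w hw
    by_cases h' : w = []
    · exact Or.inl (by rw [h', Language.leftQuotient_nil])
    · exact Or.inr ⟨w, hw, kstar_leftQuotient h h'⟩
  · refine (Set.encard_insert_le _ _).trans ?_
    change complexity A L + 1 ≤ _
    rw [hc]
    push_cast
    exact le_rfl

/-! Products -/

/-- A quotient `X` of `K` with `[] ∈ X` gives `X * L = L` by the ideal property. The remaining `X`
number at most `m - 1`, because some quotient of a nonempty `K` contains the empty word; once `L` is
reached only quotients of `L` follow. -/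
theorem complexity_mul_le (hK : IsRegularLeftIdeal A K) (hL : IsRegularLeftIdeal A L)
    (hm : complexity A K = m) (hn : complexity A L = n) (hm4 : 2 ≤ m) :
    complexity A (K * L) ≤ (m + n - 1 : ℕ) := by
  have hK0 := ne_zero_of_complexity hm hm4
  set S : Set (Language α) := {K' ∈ quotients A K | [] ∉ K'} with hS
  have key : ∀ K' ∈ quotients A K, K' * L ∈ (fun X => X * L) '' S ∪ quotients A L := by
    intro K' hK'
    by_cases h : [] ∈ K'
    · right
      have : K' * L = L := by
        refine le_antisymm (hL.mul_le (le_words_of_mem_quotients hK.subset_words hK')) ?_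
        intro x hx
        exact ⟨[], h, x, hx, rfl⟩
      rw [this]
      exact self_mem_quotients
    · exact Or.inl ⟨K', ⟨hK', h⟩, rfl⟩
  refine (complexity_le_encard (T := (fun X => X * L) '' S ∪ quotients A L) ?_).trans ?_
  · intro w
    induction w using List.reverseRecOn with
    | nil => exact fun _ => key K self_mem_quotients
    | append_singleton w x ih =>
      intro hw
      obtain ⟨hw, hx⟩ := append_mem_words.1 hw
      rw [Language.leftQuotient_append]
      rcases ih hw with ⟨K', ⟨hK', hn'⟩, hKL⟩ | hKL
      · have : (K' * L).leftQuotient [x] = K'.leftQuotient [x] * L := by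
          ext v
          rw [mem_mul_leftQuotient_singleton]
          simp [hn']
        rw [← hKL]
        simp only
        rw [this]
        exact key _ (leftQuotient_mem_quotients hK' hx)
      · exact Or.inr (leftQuotient_mem_quotients hKL hx)
  · obtain ⟨K', hK', hnil⟩ := hK.exists_nil_mem_quotients hK0
    have h1 : S.encard + 1 ≤ m := by
      rw [← hm, complexity, ← Set.encard_insert_of_notMem (a := K') (by simp [hS, hnil])]
      refine Set.encard_le_encard ?_
      rintro _ (rfl | h)
      · exact hK'
      · exact h.1
    have h2 : S.encard ≤ (m - 1 : ℕ) := by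
      rw [← ENat.add_le_add_iff_right (k := 1) (by simp)]
      refine h1.trans ?_
      norm_cast
      omega
    refine (Set.encard_union_le _ _).trans ?_
    refine (add_le_add ((Set.encard_image_le _ _).trans h2) hn.le).trans ?_
    norm_cast
    omega

theorem encard_insert_zero_quotients (hK : IsRegularLeftIdeal A K) (hm : complexity A K = m)
    (h2 : 2 ≤ m) : (insert 0 (quotients A K)).encard = (m + 1 : ℕ) := by
  rw [Set.encard_insert_of_notMem (hK.zero_notMem_quotients (ne_zero_of_complexity hm h2))]
  change complexity A K + 1 = _
  rw [hm]
  push_cast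
  rfl

/-- Each quotient of the product has the form `X * L ⊔ Y`, where `X` and `Y` are quotients of the
factors or empty. Since `[] ∈ X` puts `L` into `X * L`, the pair can be chosen with `Y ≠ 0` in that
case, and this excludes at least one of the `(m + 1) * (n + 1)` pairs. -/
theorem complexity_mul_le_of_union (hK : IsRegularLeftIdeal A K) (hL : IsRegularLeftIdeal B L)
    (hm : complexity A K = m) (hn : complexity B L = n) (hm4 : 2 ≤ m) (hn4 : 2 ≤ n) :
    complexity (A ∪ B) (K * L) ≤ (m * n + m + n : ℕ) := by
  have hK0 := ne_zero_of_complexity hm hm4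
  have hL0 := ne_zero_of_complexity hn hn4
  obtain ⟨K₁, hK₁, hnil⟩ := hK.exists_nil_mem_quotients hK0
  set S := insert 0 (quotients A K) ×ˢ insert 0 (quotients B L) with hS
  refine (complexity_le_encard (T := (fun p => p.1 * L ⊔ p.2) '' (S \ {(K₁, 0)})) ?_).trans ?_
  · suffices H : ∀ w, ∃ p ∈ S, (K * L).leftQuotient w = p.1 * L ⊔ p.2 ∧ ([] ∈ p.1 → p.2 ≠ 0) by
      intro w _
      obtain ⟨p, hp, h1, h2⟩ := H w
      refine ⟨p, ⟨hp, ?_⟩, h1.symm⟩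
      rintro rfl
      exact h2 hnil rfl
    -- Replacing `(X, 0)` by `(X, L)` when `[] ∈ X` leaves the language unchanged and restores the
    -- condition.
    have fix : ∀ X ∈ insert 0 (quotients A K), ∀ Y ∈ insert 0 (quotients B L),
        ∃ p ∈ S, X * L ⊔ Y = p.1 * L ⊔ p.2 ∧ ([] ∈ p.1 → p.2 ≠ 0) := by
      intro X hX Y hY
      by_cases h : [] ∈ X ∧ Y = 0
      · refine ⟨(X, L), ⟨hX, Or.inr self_mem_quotients⟩, ?_, fun _ => hL0⟩
        rw [h.2]
        have : L ≤ X * L := fun x hx => ⟨[], h.1, x, hx, rfl⟩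
        simp only [sup_eq_left.2 this]
        exact sup_eq_left.2 (fun x hx => hx.elim)
      · exact ⟨(X, Y), ⟨hX, hY⟩, rfl, fun h1 h2 => h ⟨h1, h2⟩⟩
    intro w
    induction w using List.reverseRecOn with
    | nil =>
      obtain ⟨p, hp, h1, h2⟩ := fix K (Or.inr self_mem_quotients) 0 (Or.inl rfl)
      refine ⟨p, hp, ?_, h2⟩
      rw [← h1, Language.leftQuotient_nil]
      exact (sup_eq_left.2 (fun x hx => hx.elim)).symm
    | append_singleton w x ih =>
      obtain ⟨⟨X, Y⟩, ⟨hX, hY⟩, h1, h2⟩ := ih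
      simp only at hX hY h1 h2
      have : (K * L).leftQuotient (w ++ [x]) = X.leftQuotient [x] * L ⊔ Y.leftQuotient [x] := by
        rw [Language.leftQuotient_append, h1]
        ext v
        change v ∈ (X * L).leftQuotient [x] ∨ v ∈ Y.leftQuotient [x] ↔
          v ∈ X.leftQuotient [x] * L ∨ v ∈ Y.leftQuotient [x]
        rw [mem_mul_leftQuotient_singleton]
        -- If `[] ∈ X`, then `Y` is a quotient of `L`, so `L ≤ Y` and the new term `L.leftQuotient
        -- [x]` is absorbed.
        have : [] ∈ X → v ∈ L.leftQuotient [x] → v ∈ Y.leftQuotient [x] := fun h hv =>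
          hL.le_of_mem_quotients (hY.resolve_left (h2 h)) hv
        tauto
      rw [this]
      exact fix _ (leftQuotient_mem_insert_zero hK.subset_words hX _) _
        (leftQuotient_mem_insert_zero hL.subset_words hY _)
  · refine (Set.encard_image_le _ _).trans ?_
    rw [← ENat.add_le_add_iff_right (k := 1) (by simp),
      Set.encard_sdiff_singleton_add_one (hS ▸ Set.mk_mem_prod (Or.inr hK₁) (Or.inl rfl)), hS, Set.encard_prod,
      encard_insert_zero_quotients hK hm hm4, encard_insert_zero_quotients hL hn hn4]
    norm_cast
    exact le_of_eq (by ring)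

/-! Boolean operations -/

theorem complexity_le_mul {X : Language α} {C : Set α} {S T : Set (Language α)}
    (op : Language α → Language α → Language α)
    (hop : ∀ w ∈ words C, X.leftQuotient w = op (K.leftQuotient w) (L.leftQuotient w))
    (hS : quotients C K ⊆ S) (hT : quotients C L ⊆ T) (hm : S.encard = m) (hn : T.encard = n) :
    complexity C X ≤ (m * n : ℕ) := by
  refine (complexity_le_encard (T := (fun p => op p.1 p.2) '' (S ×ˢ T)) ?_).trans ?_
  · intro w hw
    exact ⟨(K.leftQuotient w, L.leftQuotient w), ⟨hS ⟨w, hw, rfl⟩, hT ⟨w, hw, rfl⟩⟩,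
      (hop w hw).symm⟩
  · refine (Set.encard_image_le _ _).trans ?_
    rw [Set.encard_prod, hm, hn]
    push_cast
    exact le_rfl

theorem boolOp_leftQuotient (f : Bool → Bool → Bool) (hw : w ∈ words A) :
    (boolOp f A K L).leftQuotient w = boolOp f A (K.leftQuotient w) (L.leftQuotient w) := by
  ext x
  change (w ++ x ∈ words A ∧ _) ↔ (x ∈ words A ∧ _)
  rw [append_mem_words]
  exact and_congr_left fun _ => by simp [hw]

theorem quotients_subset_of_subset (h : A ⊆ B) : quotients A L ⊆ quotients B L := by
  rintro _ ⟨w, hw, rfl⟩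
  exact ⟨w, words_mono h hw, rfl⟩

/-! Reversal and the number of atoms -/

/-- The set of the quotients of `L` that contain the word `w`. -/
def quotientsContaining (A : Set α) (L : Language α) (w : List α) : Set (Language α) :=
  {K ∈ quotients A L | w ∈ K}

theorem mem_atomicIntersection_iff {S : Set (Language α)} (hS : S ⊆ quotients A L) :
    w ∈ atomicIntersection A L S ↔ w ∈ words A ∧ S = quotientsContaining A L w := by
  constructor
  · rintro ⟨hw, h1, h2⟩
    refine ⟨hw, Set.Subset.antisymm (fun K hK => ⟨hS hK, h1 K hK⟩) fun K hK => ?_⟩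
    by_contra h
    exact h2 K ⟨hK.1, h⟩ hK.2
  · rintro ⟨hw, rfl⟩
    exact ⟨hw, fun K hK => hK.2, fun K hK h => hK.2 ⟨hK.1, h⟩⟩

theorem indexesAtom_iff {S : Set (Language α)} :
    IndexesAtom A L S ↔ ∃ w ∈ words A, S = quotientsContaining A L w := by
  constructor
  · rintro ⟨hS, w, hw⟩
    exact ⟨w, (mem_atomicIntersection_iff hS).1 hw⟩
  · rintro ⟨w, hw, rfl⟩
    have hS : quotientsContaining A L w ⊆ quotients A L := fun K hK => hK.1
    exact ⟨hS, w, (mem_atomicIntersection_iff hS).2 ⟨hw, rfl⟩⟩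

/-- The quotient of the reverse by a reversed word `w` depends only on which quotients of `L`
contain `w`: it is `G` of that set. `G` loses nothing, because every quotient in an index is reached
by some word. -/
theorem complexity_reverse_eq (hL : L ≤ words A) :
    complexity A L.reverse = {S | IndexesAtom A L S}.encard := by
  set G : Set (Language α) → Language α :=
    fun S => {z | z ∈ words A ∧ L.leftQuotient z.reverse ∈ S} with hG
  have mem_G : ∀ S z, z ∈ G S ↔ z ∈ words A ∧ L.leftQuotient z.reverse ∈ S :=
    fun _ _ => Iff.rfl
  have hinj : Set.InjOn G {S | IndexesAtom A L S} := by
    intro S hS T hT h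
    have key : ∀ S T : Set (Language α), IndexesAtom A L S → G S = G T → S ⊆ T := by
      intro S T hS h K hK
      obtain ⟨w, hw, rfl⟩ := hS.1 hK
      have h1 : w.reverse ∈ G S := by
        rw [mem_G, List.reverse_reverse, reverse_mem_words]
        exact ⟨hw, hK⟩
      rw [h, mem_G, List.reverse_reverse] at h1
      exact h1.2
    exact (key S T hS h).antisymm (key T S hT h.symm)
  rw [← hinj.encard_image, complexity]
  congr 1
  have key : ∀ w, L.reverse.leftQuotient w.reverse = G (quotientsContaining A L w) := by
    intro w
    ext z
    rw [mem_G, Language.mem_leftQuotient, Language.mem_reverse]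
    simp only [List.reverse_append, List.reverse_reverse]
    constructor
    · intro h
      have hz := reverse_mem_words.1 (append_mem_words.1 (hL h)).1
      exact ⟨hz, ⟨_, reverse_mem_words.2 hz, rfl⟩, h⟩
    · exact fun h => h.2.2
  ext X
  constructor
  · rintro ⟨w, hw, rfl⟩
    refine ⟨_, indexesAtom_iff.2 ⟨w.reverse, reverse_mem_words.2 hw, rfl⟩, ?_⟩
    rw [← key, List.reverse_reverse]
  · rintro ⟨S, hS, rfl⟩
    obtain ⟨w, hw, rfl⟩ := indexesAtom_iff.1 hS
    exact ⟨w.reverse, reverse_mem_words.2 hw, (key w).symm⟩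

theorem encard_atoms_eq : (atoms A L).encard = {S | IndexesAtom A L S}.encard := by
  have hinj : Set.InjOn (atomicIntersection A L) {S | IndexesAtom A L S} := by
    intro S hS T hT h
    obtain ⟨w, hw⟩ := hS.2
    have hw' := hw
    rw [h] at hw'
    exact ((mem_atomicIntersection_iff hS.1).1 hw).2.trans
      ((mem_atomicIntersection_iff hT.1).1 hw').2.symm
  rw [← hinj.encard_image]
  congr 1
  ext X
  exact exists_congr fun S => and_congr_right fun _ => eq_comm

/-- A word in the least quotient lies in all of them. -/
theorem IsRegularLeftIdeal.eq_quotients_of_self_mem (h : IsRegularLeftIdeal A L)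
    {S : Set (Language α)} (hS : IndexesAtom A L S) (hLS : L ∈ S) : S = quotients A L := by
  obtain ⟨w, hw, rfl⟩ := indexesAtom_iff.1 hS
  exact Set.Subset.antisymm (fun K hK => hK.1)
    fun K hK => ⟨hK, h.le_of_mem_quotients hK hLS.2⟩

theorem encard_indexesAtom_le (h : IsRegularLeftIdeal A L) (hn : complexity A L = n) :
    {S | IndexesAtom A L S}.encard ≤ (2 ^ (n - 1) + 1 : ℕ) := by
  have hfin : (quotients A L).Finite := Set.finite_of_encard_eq_coe hn
  have hsub : {S | IndexesAtom A L S} ⊆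
      insert (quotients A L) (𝒫 (quotients A L \ {L})) := by
    intro S hS
    by_cases hLS : L ∈ S
    · exact Or.inl (h.eq_quotients_of_self_mem hS hLS)
    · exact Or.inr fun K hK => ⟨hS.1 hK, fun hKL => hLS (hKL ▸ hK)⟩
  refine (Set.encard_le_encard hsub).trans ((Set.encard_insert_le _ _).trans ?_)
  have hd : (quotients A L \ {L}).ncard = n - 1 := by
    rw [Set.ncard_sdiff_singleton_of_mem self_mem_quotients, Set.ncard, ← complexity, hn]
    simp
  have hpow : (𝒫 (quotients A L \ {L})).Finite := (hfin.subset Set.sdiff_subset).finite_subsets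
  rw [← hpow.cast_ncard_eq, Set.ncard_powerset _ (hfin.subset Set.sdiff_subset), hd]
  push_cast
  exact le_rfl

end Basic

/-! ### Upper bounds for the complexity of atoms -/

section Atoms

/-- Codes of the pairs of disjoint subsets `X`, `Z` of `P` with `1 ≤ |X| ≤ s` and `|Z| < t`,
together with `|X|` and `|Z| + 1`. -/
def splitPairs {β : Type*} [DecidableEq β] (P : Finset β) (s t : ℕ) :
    Finset (Σ _ : ℕ, Σ _ : Finset β, Σ _ : ℕ, Finset β) :=
  (Finset.Icc 1 s).sigma fun x => (P.powersetCard x).sigma fun X =>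
    (Finset.Icc 1 t).sigma fun y => (P \ X).powersetCard (y - 1)

theorem card_splitPairs {β : Type*} [DecidableEq β] (P : Finset β) (s t : ℕ) :
    (splitPairs P s t).card = ∑ x ∈ Finset.Icc 1 s, ∑ y ∈ Finset.Icc 1 t,
      P.card.choose x * (P.card - x).choose (y - 1) := by
  rw [splitPairs, Finset.card_sigma]
  refine Finset.sum_congr rfl fun x _ => ?_
  rw [Finset.card_sigma, Finset.sum_congr rfl (g := fun _ => ∑ y ∈ Finset.Icc 1 t,
    (P.card - x).choose (y - 1))]
  · rw [Finset.sum_const, Finset.card_powersetCard, smul_eq_mul, Finset.mul_sum]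
  · intro X hX
    obtain ⟨h1, h2⟩ := Finset.mem_powersetCard.1 hX
    rw [Finset.card_sigma]
    refine Finset.sum_congr rfl fun y _ => ?_
    rw [Finset.card_powersetCard, Finset.card_sdiff_of_subset h1, h2]

theorem mem_splitPairs {β : Type*} [DecidableEq β] {P : Finset β} {s t x y : ℕ}
    {X Z : Finset β} :
    (⟨x, X, y, Z⟩ : Σ _ : ℕ, Σ _ : Finset β, Σ _ : ℕ, Finset β) ∈ splitPairs P s t ↔
      (1 ≤ X.card ∧ X.card ≤ s ∧ X ⊆ P ∧ Z ⊆ P \ X ∧ Z.card + 1 ≤ t) ∧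
        x = X.card ∧ y = Z.card + 1 := by
  simp only [splitPairs, Finset.mem_sigma, Finset.mem_Icc, Finset.mem_powersetCard]
  constructor
  · rintro ⟨⟨h1, h2⟩, ⟨h3, rfl⟩, ⟨h4, h5⟩, h6, h7⟩
    refine ⟨⟨h1, h2, h3, h6, ?_⟩, rfl, ?_⟩ <;> omega
  · rintro ⟨⟨h1, h2, h3, h4, h5⟩, rfl, rfl⟩
    exact ⟨⟨h1, h2⟩, ⟨h3, rfl⟩, ⟨by omega, h5⟩, h4, rfl⟩

variable {α : Type*} {A : Set α} {L : Language α} {w : List α} {n : ℕ}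

/-- The words over `A` that belong to all the languages in `X` and to none of those in `Y`. -/
def cell (A : Set α) (X Y : Set (Language α)) : Language α :=
  {x | x ∈ words A ∧ (∀ K ∈ X, x ∈ K) ∧ ∀ K ∈ Y, x ∉ K}

theorem mem_cell {X Y : Set (Language α)} :
    w ∈ cell A X Y ↔ w ∈ words A ∧ (∀ K ∈ X, w ∈ K) ∧ ∀ K ∈ Y, w ∉ K := Iff.rfl

theorem atomicIntersection_leftQuotient (S : Set (Language α)) (hw : w ∈ words A) :
    (atomicIntersection A L S).leftQuotient w =
      cell A ((fun K => K.leftQuotient w) '' S)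
        ((fun K => K.leftQuotient w) '' (quotients A L \ S)) := by
  ext x
  rw [mem_cell, Set.forall_mem_image, Set.forall_mem_image]
  change w ++ x ∈ words A ∧ _ ↔ _
  rw [append_mem_words]
  exact and_congr_left fun _ => by simp [hw]

/-- The summand `1` is the empty quotient; every other quotient is charged to a pair `(U, Z)`. -/
theorem complexity_atom_le_of_codes (P : Finset (Language α)) [DecidableEq (Language α)]
    {X : Language α} (s t : ℕ) (hP : P.card = n - 1)
    (G : Finset (Language α) → Finset (Language α) → Language α)
    (h : ∀ w ∈ words A, X.leftQuotient w = 0 ∨ ∃ U Z, U.Nonempty ∧ U.card ≤ s ∧ U ⊆ P ∧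
      Z ⊆ P \ U ∧ Z.card + 1 ≤ t ∧ X.leftQuotient w = G U Z) :
    complexity A X ≤ (1 + ∑ x ∈ Finset.Icc 1 s, ∑ y ∈ Finset.Icc 1 t,
      (n - 1).choose x * (n - x - 1).choose (y - 1) : ℕ) := by
  have hc := card_splitPairs P s t
  rw [hP] at hc
  simp only [Nat.sub_right_comm n _ 1]
  rw [← hc]
  refine (complexity_le_encard
    (T := insert 0 ((fun c : Σ _ : ℕ, Σ _ : Finset (Language α), Σ _ : ℕ, Finset (Language α) =>
      G c.2.1 c.2.2.2) '' (splitPairs P s t))) ?_).trans ?_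
  · intro w hw
    rcases h w hw with h | ⟨U, Z, h1, h2, h3, h4, h5, h6⟩
    · exact Or.inl h
    · exact Or.inr ⟨⟨U.card, U, Z.card + 1, Z⟩,
        mem_splitPairs.2 ⟨⟨h1.card_pos, h2, h3, h4, h5⟩, rfl, rfl⟩, h6.symm⟩
  · refine (Set.encard_insert_le _ _).trans ?_
    rw [add_comm]
    push_cast
    refine add_le_add_right ((Set.encard_image_le _ _).trans ?_) _
    rw [Set.encard_coe_eq_coe_finsetCard]

/-- The intersection of all quotients is the least one, so this atom has the same quotients as `L`.
-/
theorem complexity_atom_quotients_le (h : IsRegularLeftIdeal A L) (hn : complexity A L = n) :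
    complexity A (atomicIntersection A L (quotients A L)) ≤ n := by
  rw [← hn]
  refine complexity_le_encard fun w hw => ⟨w, hw, ?_⟩
  rw [atomicIntersection_leftQuotient _ hw]
  ext x
  rw [mem_cell, Set.forall_mem_image, Set.forall_mem_image]
  constructor
  · exact fun hx => hx.2.1 self_mem_quotients
  · intro hx
    refine ⟨(append_mem_words.1 (h.subset_words hx)).2, fun K hK => ?_, fun K hK => ?_⟩
    · exact leftQuotient_mono (h.le_of_mem_quotients hK) w hx
    · exact absurd hK.1 hK.2

/-- A quotient of this atom is the complement of the union of some nonempty family of quotients.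
Each member contains `L`, so adding `L` to the family or removing it matters only for bookkeeping,
and a subset of the other `n - 1` quotients suffices as code. -/
theorem complexity_atom_empty_le (h : IsRegularLeftIdeal A L) (hn : complexity A L = n) :
    complexity A (atomicIntersection A L ∅) ≤ (2 ^ (n - 1) : ℕ) := by
  have hfin : (quotients A L).Finite := Set.finite_of_encard_eq_coe hn
  have hd : (quotients A L \ {L}).ncard = n - 1 := by
    rw [Set.ncard_sdiff_singleton_of_mem self_mem_quotients, Set.ncard, ← complexity, hn]
    simp
  have hpow : (𝒫 (quotients A L \ {L})).Finite := (hfin.subset Set.sdiff_subset).finite_subsets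
  refine (complexity_le_encard
    (T := (fun Y => cell A ∅ (insert L Y)) '' 𝒫 (quotients A L \ {L})) ?_).trans ?_
  · intro w hw
    refine ⟨((fun K => K.leftQuotient w) '' quotients A L) \ {L}, ?_, ?_⟩
    · rintro _ ⟨⟨K, hK, rfl⟩, h'⟩
      exact ⟨leftQuotient_mem_quotients hK hw, h'⟩
    · rw [atomicIntersection_leftQuotient _ hw, Set.sdiff_empty, Set.image_empty]
      ext x
      simp only [mem_cell]
      refine and_congr_right fun _ => and_congr_right fun _ => ?_
      constructor
      · intro h' K hK
        by_cases hKL : K = L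
        · exact h' _ (Or.inl hKL)
        · exact h' K (Or.inr ⟨hK, hKL⟩)
      · rintro h' K (rfl | hK)
        · exact fun hx => h' _ ⟨K, self_mem_quotients, rfl⟩ (h.le_leftQuotient hw hx)
        · exact h' K hK.1
  · refine (Set.encard_image_le _ _).trans ?_
    rw [← hpow.cast_ncard_eq, Set.ncard_powerset _ (hfin.subset Set.sdiff_subset), hd]

-- The quotient of the atom by `w` is the cell of the images `X` of `S` and `Y` of its complement,
-- where `Y` contains the least image `p = L.leftQuotient w`. It is empty if `L ∈ X` or if `X` meets
-- `Y`. Otherwise one element of `Y` is redundant: excluding a larger quotient also excludes `p` and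
-- `L`, so `L` may be added free of charge and `p` dropped. If `S` omits only `L`, then `Y = {p}`
-- and `Z` must be empty; there `p` is recorded inside the first set, as its least element.
open Classical in
theorem complexity_atom_le_of_notMem (h : IsRegularLeftIdeal A L) (hn : complexity A L = n)
    {S : Set (Language α)} (hS : S ⊆ quotients A L) (hne : S.Nonempty) (hLS : L ∉ S) :
    complexity A (atomicIntersection A L S) ≤
      (1 + ∑ x ∈ Finset.Icc 1 S.ncard, ∑ y ∈ Finset.Icc 1 (n - S.ncard),
        (n - 1).choose x * (n - x - 1).choose (y - 1) : ℕ) := by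
  have hfin : (quotients A L).Finite := Set.finite_of_encard_eq_coe hn
  have hQ : (quotients A L).ncard = n := by
    rw [Set.ncard, ← complexity, hn]
    simp
  set P : Finset (Language α) := hfin.toFinset.erase L with hPdef
  have memP : ∀ K, K ∈ P ↔ K ≠ L ∧ K ∈ quotients A L := by simp [hPdef]
  have hP : P.card = n - 1 := by
    rw [hPdef, Finset.card_erase_of_mem (by simpa using self_mem_quotients),
      ← Set.ncard_eq_toFinset_card _ hfin, hQ]
  set S₁ : Finset (Language α) := (hfin.subset hS).toFinset with hS₁
  have hS₁c : S₁.card = S.ncard := (Set.ncard_eq_toFinset_card _ _).symm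
  set S₂ : Finset (Language α) := (hfin.subset (Set.sdiff_subset (t := S))).toFinset with hS₂
  have hS₂c : S₂.card = n - S.ncard := by
    rw [hS₂, ← Set.ncard_eq_toFinset_card _ (hfin.subset Set.sdiff_subset),
      Set.ncard_sdiff hS (hfin.subset hS), hQ]
  have hLS₂ : L ∈ S₂ := by simpa [hS₂] using ⟨self_mem_quotients, hLS⟩
  have htpos : 1 ≤ n - S.ncard := by
    rw [← hS₂c]
    exact Finset.card_pos.2 ⟨L, hLS₂⟩
  -- the value of the code `(X, Z)`
  set G : Finset (Language α) → Finset (Language α) → Language α := fun X Z =>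
    if hX : n - S.ncard = 1 ∧ ∃ p ∈ X, (∀ q ∈ X, p ≤ q) ∧ ∃ q ∈ X, q ≠ p then
      cell A (X.erase hX.2.choose) {hX.2.choose} else cell A X (insert L Z) with hG
  refine complexity_atom_le_of_codes P _ _ hP G fun w hw => ?_
  set X := S₁.image (fun K => K.leftQuotient w) with hX
  set Y := S₂.image (fun K => K.leftQuotient w) with hY
  have hcell : (atomicIntersection A L S).leftQuotient w = cell A X Y := by
    rw [atomicIntersection_leftQuotient _ hw, hX, hY, hS₁, hS₂]
    simp
  have hXc : X.card ≤ S.ncard := Finset.card_image_le.trans hS₁c.le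
  have hYc : Y.card ≤ n - S.ncard := Finset.card_image_le.trans hS₂c.le
  set p := L.leftQuotient w with hp
  have hpY : p ∈ Y := Finset.mem_image.2 ⟨L, hLS₂, rfl⟩
  have hXQ : ∀ q ∈ X, q ∈ quotients A L ∧ p ≤ q := by
    intro q hq
    obtain ⟨K, hK, rfl⟩ := Finset.mem_image.1 hq
    have hK : K ∈ quotients A L := hS (by simpa [hS₁] using hK)
    exact ⟨leftQuotient_mem_quotients hK hw, leftQuotient_mono (h.le_of_mem_quotients hK) w⟩
  have hYQ : ∀ q ∈ Y, q ∈ quotients A L ∧ p ≤ q := by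
    intro q hq
    obtain ⟨K, hK, rfl⟩ := Finset.mem_image.1 hq
    have hK : K ∈ quotients A L := ((by simpa [hS₂] using hK : _ ∧ _)).1
    exact ⟨leftQuotient_mem_quotients hK hw, leftQuotient_mono (h.le_of_mem_quotients hK) w⟩
  have hXne : X.Nonempty := by
    obtain ⟨K, hK⟩ := hne
    exact ⟨_, Finset.mem_image.2 ⟨K, by simpa [hS₁] using hK, rfl⟩⟩
  have hLp : L ≤ p := h.le_leftQuotient hw
  rw [hcell]
  by_cases hLX : L ∈ X
  · left
    ext x
    simp only [mem_cell, Language.notMem_zero, iff_false]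
    exact fun hx => hx.2.2 p hpY (hLp (hx.2.1 L hLX))
  by_cases hXY : ∃ q ∈ X, q ∈ Y
  · left
    obtain ⟨q, h1, h2⟩ := hXY
    ext x
    simp only [mem_cell, Language.notMem_zero, iff_false]
    exact fun hx => hx.2.2 q h2 (hx.2.1 q h1)
  right
  push Not at hXY
  have hXP : X ⊆ P := fun q hq => (memP q).2 ⟨fun hqL => hLX (hqL ▸ hq), (hXQ q hq).1⟩
  by_cases ht : n - S.ncard = 1
  · have hYp : Y = {p} := by
      refine Finset.eq_singleton_iff_unique_mem.2 ⟨hpY, fun q hq => ?_⟩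
      exact Finset.card_le_one.1 (ht ▸ hYc) q hq p hpY
    have hcardP : ∀ U ⊆ P, U.card ≤ S.ncard := fun U hU => by
      have := Finset.card_le_card hU
      omega
    have G_eq : ∀ U : Finset (Language α), ∀ q ∈ U, (∀ r ∈ U, q ≤ r) → (∃ r ∈ U, r ≠ q) →
        G U ∅ = cell A (U.erase q) {q} := by
      intro U q hq h1 h2
      have hU : n - S.ncard = 1 ∧ ∃ p ∈ U, (∀ q ∈ U, p ≤ q) ∧ ∃ q ∈ U, q ≠ p :=
        ⟨ht, q, hq, h1, h2⟩
      have : hU.2.choose = q :=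
        le_antisymm (hU.2.choose_spec.2.1 q hq) (h1 _ hU.2.choose_spec.1)
      simp only [hG]
      rw [dif_pos hU, this]
    have G_eq' : ∀ U : Finset (Language α),
        (¬ ∃ p ∈ U, (∀ q ∈ U, p ≤ q) ∧ ∃ q ∈ U, q ≠ p) → G U ∅ = cell A U {L} := by
      intro U hU
      simp only [hG]
      rw [dif_neg (fun h' => hU h'.2)]
      simp
    by_cases hpL : p = L
    -- When `p = L`, a set `X` with a least element `q` and further members has the same cell as
    -- `{q}`. Sets of this shape are thereby left free to encode the case `p ≠ L`.
    · by_cases hmin : ∃ p ∈ X, (∀ q ∈ X, p ≤ q) ∧ ∃ q ∈ X, q ≠ p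
      · obtain ⟨q, hq, h1, -⟩ := hmin
        refine ⟨{q}, ∅, Finset.singleton_nonempty q, hcardP _ (by simpa using hXP hq),
          by simpa using hXP hq, by simp, by simpa using htpos, ?_⟩
        rw [G_eq' {q} (by simp), hYp, hpL]
        ext x
        simp only [mem_cell, Finset.coe_singleton, Set.mem_singleton_iff, forall_eq]
        refine and_congr_right fun _ => and_congr_left fun _ => ?_
        exact ⟨fun h' => h' q hq, fun hx r hr => h1 r hr hx⟩
      · refine ⟨X, ∅, hXne, hXc, hXP, by simp, by simpa using htpos, ?_⟩
        rw [G_eq' X hmin, hYp, hpL, Finset.coe_singleton]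
    · have hpX : p ∉ X := fun h' => hXY p h' hpY
      have hsub : insert p X ⊆ P := by
        intro q hq
        rcases Finset.mem_insert.1 hq with rfl | hq
        · exact (memP _).2 ⟨hpL, (hYQ _ hpY).1⟩
        · exact hXP hq
      -- `p` lies below all of `X` and outside it, so it is recovered as the least element of a set
      -- with at least two members.
      refine ⟨insert p X, ∅, Finset.insert_nonempty p X, hcardP _ hsub, hsub, by simp,
        by simpa using htpos, ?_⟩
      rw [G_eq (insert p X) p (Finset.mem_insert_self p X), Finset.erase_insert hpX, hYp,
        Finset.coe_singleton]
      · intro r hr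
        rcases Finset.mem_insert.1 hr with rfl | hr
        · exact le_rfl
        · exact (hXQ r hr).2
      · obtain ⟨q, hq⟩ := hXne
        exact ⟨q, Finset.mem_insert_of_mem hq, fun h' => hpX (h' ▸ hq)⟩
  · have hval : ∀ U Z, G U Z = cell A U (insert L Z) := by
      intro U Z
      simp only [hG]
      rw [dif_neg (fun h' => ht h'.1)]
    suffices H : ∃ Z ⊆ Y, L ∉ Z ∧ Z.card + 1 ≤ n - S.ncard ∧
        ∀ x : List α, (∀ K ∈ Y, x ∉ K) ↔ x ∉ L ∧ ∀ K ∈ Z, x ∉ K by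
      obtain ⟨Z, hZ, hLZ, hZc, hx⟩ := H
      refine ⟨X, Z, hXne, hXc, hXP, fun q hq => ?_, hZc, ?_⟩
      · refine Finset.mem_sdiff.2 ⟨(memP q).2 ⟨fun h' => hLZ (h' ▸ hq), (hYQ q (hZ hq)).1⟩,
          fun h' => hXY q h' (hZ hq)⟩
      · rw [hval]
        ext x
        simp only [mem_cell]
        refine and_congr_right fun _ => and_congr_right fun _ => ?_
        simpa using hx x
    -- If `Y` has a second element, avoiding it entails avoiding `p`, so `p` is erased. If `Y =
    -- {p}`, then `Z` has at most one element, which is allowed because here `n - S.ncard ≥ 2`.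
    by_cases hYp : ∃ q ∈ Y, q ≠ p
    · obtain ⟨q, hq, hqp⟩ := hYp
      refine ⟨(Y.erase p).erase L, (Finset.erase_subset _ _).trans (Finset.erase_subset _ _),
        by simp, ?_, fun x => ⟨fun h' => ⟨fun hx => h' p hpY (hLp hx), fun K hK =>
          h' K (Finset.mem_of_mem_erase (Finset.mem_of_mem_erase hK))⟩, ?_⟩⟩
      · have h1 := Finset.card_erase_of_mem hpY
        have h2 := Finset.card_erase_le (s := Y.erase p) (a := L)
        have h3 := Finset.card_pos.2 ⟨p, hpY⟩
        omega
      · rintro ⟨h1, h2⟩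
        have key : ∀ K ∈ Y, K ≠ p → x ∉ K := by
          intro K hK hKp
          by_cases hKL : K = L
          · rwa [hKL]
          · exact h2 K (Finset.mem_erase.2 ⟨hKL, Finset.mem_erase.2 ⟨hKp, hK⟩⟩)
        intro K hK
        by_cases hKp : K = p
        · subst hKp
          exact fun hx => key q hq hqp ((hYQ q hq).2 hx)
        · exact key K hK hKp
    · push Not at hYp
      refine ⟨({p} : Finset _).erase L, fun q hq => ?_, by simp, ?_, fun x =>
        ⟨fun h' => ⟨fun hx => h' p hpY (hLp hx), fun K hK => h' K ?_⟩, ?_⟩⟩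
      · rw [Finset.mem_singleton.1 (Finset.mem_of_mem_erase hq)]
        exact hpY
      · have h2 := Finset.card_erase_le (s := {p}) (a := L)
        rw [Finset.card_singleton] at h2
        omega
      · rw [Finset.mem_singleton.1 (Finset.mem_of_mem_erase hK)]
        exact hpY
      · rintro ⟨h1, h2⟩ K hK
        by_cases hKL : K = L
        · rwa [hKL]
        · exact h2 K (Finset.mem_erase.2 ⟨hKL, Finset.mem_singleton.2 (hYp K hK)⟩)

theorem complexity_atom_le (h : IsRegularLeftIdeal A L) (hn : complexity A L = n)
    {S : Set (Language α)} (hS : IndexesAtom A L S) :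
    complexity A (atomicIntersection A L S) ≤ atomBound n S.ncard := by
  have hfin : (quotients A L).Finite := Set.finite_of_encard_eq_coe hn
  have hQ : (quotients A L).ncard = n := by
    rw [Set.ncard, ← complexity, hn]
    simp
  have hpos : 0 < n := hQ ▸ (Set.ncard_pos hfin).2 ⟨L, self_mem_quotients⟩
  by_cases hLS : L ∈ S
  · rw [h.eq_quotients_of_self_mem hS hLS, hQ, atomBound, if_pos rfl]
    exact complexity_atom_quotients_le h hn
  · have hne : S.ncard ≠ n := fun h' => hLS (by
      rw [Set.eq_of_subset_of_ncard_le hS.1 (by rw [h', hQ]) hfin]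
      exact self_mem_quotients)
    rw [atomBound, if_neg hne]
    rcases S.eq_empty_or_nonempty with rfl | hSne
    · rw [Set.ncard_empty, if_pos rfl]
      exact complexity_atom_empty_le h hn
    · rw [if_neg ((Set.ncard_pos (hfin.subset hS.1)).2 hSne).ne']
      exact complexity_atom_le_of_notMem h hn hS.1 hSne hLS

end Atoms

/-! ### Counting monotone self-maps of a finite poset with bottom -/

section Monotone

/-- The order relation and its converse meet only in the diagonal, so their sizes add up to at most
`|X|² + |X|`. -/
theorem two_mul_card_le_pairs (X : Type*) [Fintype X] [PartialOrder X] :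
    2 * Nat.card {p : X × X // p.1 ≤ p.2} ≤ Fintype.card X * (Fintype.card X + 1) := by
  classical
  set s : Finset (X × X) := {p | p.1 ≤ p.2} with hs
  set t : Finset (X × X) := {p | p.2 ≤ p.1} with ht
  have h1 : Nat.card {p : X × X // p.1 ≤ p.2} = s.card := by
    rw [Nat.card_eq_fintype_card, Fintype.card_subtype]
  have h2 : s.card = t.card := by
    refine Finset.card_bij (fun p _ => p.swap) ?_ ?_ ?_
    · simp [hs, ht]
    · simp
    · rintro ⟨a, b⟩ h
      exact ⟨(b, a), by simpa [hs, ht] using h⟩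
  have h3 : (s ∩ t).card ≤ Fintype.card X := by
    rw [← Finset.card_univ, ← Finset.card_image_of_injective (f := fun x : X => (x, x))
      Finset.univ (fun a b h => (Prod.ext_iff.1 h).1)]
    refine Finset.card_le_card ?_
    rintro ⟨a, b⟩ h
    simp only [hs, ht, Finset.mem_inter, Finset.mem_filter, Finset.mem_univ, true_and] at h
    simp [le_antisymm h.1 h.2]
  have h4 : (s ∪ t).card ≤ Fintype.card X * Fintype.card X := by
    rw [← Fintype.card_prod]
    exact Finset.card_le_univ _
  have := Finset.card_union_add_card_inter s t
  rw [h1, mul_add]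
  omega

/-- These are the first three terms of the binomial expansion, doubled to clear the denominator. -/
theorem two_mul_succ_pow_ge (x i : ℕ) :
    x ^ i * (2 * x ^ 2 + 2 * (i + 2) * x + (i + 2) * (i + 1)) ≤ 2 * (x + 1) ^ (i + 2) := by
  induction i with
  | zero => simp; ring_nf; omega
  | succ i ih =>
    calc _ ≤ x ^ i * (2 * x ^ 2 + 2 * (i + 2) * x + (i + 2) * (i + 1)) * (x + 1) := by
          rw [pow_succ, mul_assoc (x ^ i) x, mul_assoc (x ^ i) _ (x + 1)]
          refine Nat.mul_le_mul_left _ ?_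
          nlinarith [Nat.zero_le ((i + 2) * (i + 1))]
      _ ≤ 2 * (x + 1) ^ (i + 2) * (x + 1) := Nat.mul_le_mul_right _ ih
      _ = _ := by ring

/-- Three binomial terms suffice. The extreme case `j = m + 1` amounts to `m² ≥ 3m + 2`, which is
where `4 ≤ m` enters. -/
theorem two_mul_pow_le_succ_pow {j m : ℕ} (hm : 4 ≤ m) (hj : j ≤ m + 1) :
    2 * j ^ m ≤ (j + 1) ^ m := by
  obtain ⟨i, rfl⟩ : ∃ i, m = i + 2 := ⟨m - 2, by omega⟩
  have h := two_mul_succ_pow_ge j i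
  have h2 : 4 * j ^ 2 ≤ 2 * j ^ 2 + 2 * (i + 2) * j + (i + 2) * (i + 1) := by
    rcases Nat.lt_or_ge j (i + 3) with h' | h'
    · nlinarith
    · obtain rfl : j = i + 3 := by omega
      nlinarith
  have := (Nat.mul_le_mul_left (j ^ i) h2).trans h
  have e : j ^ i * (4 * j ^ 2) = 2 * (2 * j ^ (i + 2)) := by ring
  omega

/-- The induction step is `j ^ m * (j - 1) + j ^ m * (j + 1) = 2 * j ^ m * j ≤ (j + 1) ^ m * j`. -/
theorem sum_pow_mul_succ_le {m : ℕ} (hm : 4 ≤ m) {j : ℕ} (hj : j ≤ m + 2) :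
    ∑ k ∈ Finset.range j, k ^ m * (k + 1) ≤ j ^ m * (j - 1) := by
  induction j with
  | zero => simp
  | succ j ih =>
    rw [Finset.sum_range_succ]
    have h1 := ih (by omega)
    have h2 := Nat.mul_le_mul_right j (two_mul_pow_le_succ_pow hm (j := j) (by omega))
    rcases j with _ | j
    · simp; omega
    · simp only [Nat.add_sub_cancel] at h1 ⊢
      nlinarith

/-- The top term `n ^ (n - 2) * (n + 1)` and the bound `n ^ (n - 2) * (n - 1)` for the other terms
add up to `2 * n ^ (n - 1)`. The latter bound needs exponent at least `4`, so `n = 4` and `n = 5`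
are computed. -/
theorem sum_succ_pow_lt {n : ℕ} (hn : 4 ≤ n) :
    ∑ k ∈ Finset.range n, (k + 1) ^ (n - 2) * (k + 1 + 1) < 2 * (n ^ (n - 1) + n - 1) := by
  rcases Nat.lt_or_ge n 6 with h | h
  · interval_cases n <;> simp [Finset.sum_range_succ]
  · obtain ⟨m, rfl⟩ : ∃ m, n = m + 2 := ⟨n - 2, by omega⟩
    have h1 := sum_pow_mul_succ_le (m := m) (by omega) (j := m + 2) le_rfl
    have h2 := Finset.sum_range_succ' (fun k => k ^ m * (k + 1)) (m + 2)
    rw [Finset.sum_range_succ] at h2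
    simp only [Nat.add_sub_cancel, show m + 2 - 1 = m + 1 by omega] at *
    have h3 : (m + 2) ^ m * (m + 1) + (m + 2) ^ m * (m + 2 + 1) = 2 * (m + 2) ^ (m + 1) := by ring
    rw [Nat.zero_pow (by omega)] at h2
    omega

variable {Q : Type*} [Fintype Q] [PartialOrder Q]

/-- In a linear extension, the up-set of the element at position `i` (counted from `0`) lies among
the `N - i` elements from that position on. -/
theorem sum_card_Ici_le (g : ℕ → ℕ) (hg : Monotone g) :
    ∑ p : Q, g (Nat.card (Set.Ici p)) ≤ ∑ k ∈ Finset.range (Fintype.card Q), g (k + 1) := by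
  classical
  let : Fintype (LinearExtension Q) := ‹Fintype Q›
  set N := Fintype.card Q with hN
  have hL : Fintype.card (LinearExtension Q) = N := Fintype.card_congr (Equiv.refl Q)
  have e : Fin N ≃o LinearExtension Q := Fintype.orderIsoFinOfCardEq (LinearExtension Q) hL
  have key : ∀ p : Q, Nat.card (Set.Ici p) ≤ N - e.symm (toLinearExtension p) := by
    intro p
    rw [← Fin.card_Ici, ← Fintype.card_coe, ← Nat.card_eq_fintype_card]
    refine Nat.card_le_card_of_injective (fun q => ⟨e.symm (toLinearExtension q.1), ?_⟩) ?_
    · exact Finset.mem_Ici.2 (e.symm.monotone (toLinearExtension.monotone q.2))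
    · intro a b hab
      exact Subtype.ext (e.symm.injective (Subtype.ext_iff.1 hab))
  calc _ ≤ ∑ p : Q, g (N - e.symm (toLinearExtension p)) := Finset.sum_le_sum fun p _ => hg (key p)
    _ = ∑ i : Fin N, g (N - i) :=
        Equiv.sum_comp (show Q ≃ Fin N from e.symm.toEquiv) (fun i : Fin N => g (N - i))
    _ = ∑ i : Fin N, g (i + 1) := by
        rw [← Equiv.sum_comp Fin.revPerm]
        refine Finset.sum_congr rfl fun i _ => ?_
        congr 1
        simp only [Fin.revPerm_apply, Fin.val_rev]
        omega
    _ = _ := Fin.sum_univ_eq_sum_range (fun k => g (k + 1)) N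

variable [OrderBot Q]

/-- A monotone `f` is determined by `p = f ⊥`, by the comparable pair `(f r, f s)` above `p`, and by
its `N - 3` other values above `p`. An up-set of size `k` has at most `k * (k + 1) / 2` comparable
pairs, so twice the count is at most the sum of `k ^ (N - 2) * (k + 1)` over all `p`. -/
theorem card_orderHom_lt (hn : 4 ≤ Fintype.card Q) {r s : Q} (hr : r ≠ ⊥) (hrs : r < s) :
    Nat.card (Q →o Q) < Fintype.card Q ^ (Fintype.card Q - 1) + Fintype.card Q - 1 := by
  classical
  set N := Fintype.card Q with hN
  have hs : s ≠ ⊥ := (bot_le.trans_lt hrs).ne'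
  let R : Type _ := {x : Q // x ∉ ({⊥, r, s} : Finset Q)}
  have hR : Nat.card R = N - 3 := by
    rw [Nat.card_eq_fintype_card, Fintype.card_subtype, ← Finset.compl_filter,
      Finset.card_compl]
    congr 1
    rw [Finset.filter_mem_eq_inter, Finset.univ_inter, Finset.card_eq_three]
    exact ⟨⊥, r, s, hr.symm, hs.symm, hrs.ne, rfl⟩
  let F : (Q →o Q) → Σ p : Q, {z : Set.Ici p × Set.Ici p // z.1 ≤ z.2} × (R → Set.Ici p) :=
    fun f => ⟨f ⊥, ⟨(⟨f r, f.monotone bot_le⟩, ⟨f s, f.monotone bot_le⟩), f.monotone hrs.le⟩,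
      fun x => ⟨f x.1, f.monotone bot_le⟩⟩
  let E : (Σ p : Q, {z : Set.Ici p × Set.Ici p // z.1 ≤ z.2} × (R → Set.Ici p)) → Q → Q :=
    fun c x => if h : x ∉ ({⊥, r, s} : Finset Q) then (c.2.2 ⟨x, h⟩).1 else
      if x = ⊥ then c.1 else if x = r then c.2.1.1.1.1 else c.2.1.1.2.1
  have hF : Function.Injective F := by
    have hE : ∀ f x, E (F f) x = f x := by
      intro f x
      by_cases h : x ∉ ({⊥, r, s} : Finset Q)
      · simp only [E, dif_pos h, F]
      · simp only [E, dif_neg h, F]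
        split_ifs with h1 h2
        · rw [h1]
        · rw [h2]
        · have : x = s := by simpa [h1, h2] using h
          rw [this]
    intro f g hfg
    ext x
    rw [← hE f, ← hE g, hfg]
  have h1 := Nat.card_le_card_of_injective F hF
  rw [Nat.card_sigma] at h1
  have h2 : 2 * ∑ p : Q, Nat.card ({z : Set.Ici p × Set.Ici p // z.1 ≤ z.2} × (R → Set.Ici p)) ≤
      ∑ p : Q, Nat.card (Set.Ici p) ^ (N - 2) * (Nat.card (Set.Ici p) + 1) := by
    rw [Finset.mul_sum]
    refine Finset.sum_le_sum fun p _ => ?_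
    rw [Nat.card_prod, Nat.card_fun, hR, ← mul_assoc]
    refine (Nat.mul_le_mul_right _ (two_mul_card_le_pairs (Set.Ici p))).trans (le_of_eq ?_)
    rw [← Nat.card_eq_fintype_card, show N - 2 = N - 3 + 1 by omega, pow_succ]
    ring
  have h3 := sum_card_Ici_le (Q := Q) (fun k => k ^ (N - 2) * (k + 1))
    (fun a b hab => Nat.mul_le_mul (Nat.pow_le_pow_left hab _) (by omega))
  have h4 := sum_succ_pow_lt hn
  simp only [← hN] at h3
  omega

/-- If `f ⊥ ≠ ⊥`, nothing lies strictly above `f ⊥` and `f` is constant; if `f ⊥ = ⊥`, there are at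
most `N ^ (N - 1)` choices for the other values. -/
theorem card_orderHom_le_of_antichain (h : ∀ r s : Q, r < s → r = ⊥) :
    Nat.card (Q →o Q) ≤ Fintype.card Q ^ (Fintype.card Q - 1) + Fintype.card Q - 1 := by
  classical
  set N := Fintype.card Q with hN
  let R : Type _ := {x : Q // x ≠ ⊥}
  have hR : Nat.card R = N - 1 := by
    rw [Nat.card_eq_fintype_card, Fintype.card_subtype_compl, Fintype.card_subtype_eq]
  let F : (Q →o Q) → Σ p : Q, (R → Set.Ici p) :=
    fun f => ⟨f ⊥, fun x => ⟨f x.1, f.monotone bot_le⟩⟩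
  let E : (Σ p : Q, (R → Set.Ici p)) → Q → Q :=
    fun c x => if h : x ≠ ⊥ then (c.2 ⟨x, h⟩).1 else c.1
  have hF : Function.Injective F := by
    have hE : ∀ f x, E (F f) x = f x := by
      intro f x
      by_cases h : x ≠ ⊥
      · simp only [E, dif_pos h, F]
      · simp only [E, dif_neg h, F]
        rw [not_not.1 h]
    intro f g hfg
    ext x
    rw [← hE f, ← hE g, hfg]
  refine (Nat.card_le_card_of_injective F hF).trans ?_
  rw [Nat.card_sigma, ← Finset.add_sum_erase _ _ (Finset.mem_univ (⊥ : Q)),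
    Finset.sum_congr rfl (g := fun _ => 1)]
  · rw [Finset.sum_const, Finset.card_erase_of_mem (Finset.mem_univ _), Finset.card_univ,
      Nat.card_fun, hR, Set.Ici_bot, Nat.card_univ, Nat.card_eq_fintype_card]
    have : 0 < N := Fintype.card_pos_iff.2 ⟨⊥⟩
    simp only [smul_eq_mul, mul_one, ← hN]
    omega
  · intro p hp
    have : Set.Ici p = {p} := by
      ext x
      refine ⟨fun hx => ?_, fun hx => hx ▸ le_rfl⟩
      rcases eq_or_lt_of_le (show p ≤ x from hx) with h' | h'
      · exact h'.symm
      · exact absurd (h p x h') (Finset.ne_of_mem_erase hp)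
    rw [Nat.card_fun, this]
    simp

theorem card_orderHom_le (hn : 4 ≤ Fintype.card Q) :
    Nat.card (Q →o Q) ≤ Fintype.card Q ^ (Fintype.card Q - 1) + Fintype.card Q - 1 := by
  by_cases h : ∀ r s : Q, r < s → r = ⊥
  · exact card_orderHom_le_of_antichain h
  · push Not at h
    obtain ⟨r, s, hrs, hr⟩ := h
    exact (card_orderHom_lt hn hr hrs).le

end Monotone

/-! ### Five generators are necessary -/

section Generators

variable {α Q : Type*} (δ : Q → α → Q) {z : Q} {w : List α}

theorem exists_first_not_injective (h : ¬ Function.Injective fun q => w.foldl δ q) :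
    ∃ u x v, w = u ++ x :: v ∧ Function.Injective (fun q => u.foldl δ q) ∧
      ¬ Function.Injective fun q => δ q x := by
  induction w with
  | nil => exact absurd Function.injective_id h
  | cons y w ih =>
    by_cases hy : Function.Injective fun q => δ q y
    · obtain ⟨u, x, v, rfl, hu, hx⟩ := ih fun h' => h (h'.comp hy)
      exact ⟨y :: u, x, v, rfl, hu.comp hy, hx⟩
    · exact ⟨[], y, w, rfl, Function.injective_id, hy⟩

/-- A constant letter would make the whole word constant. -/
theorem letters_fix_of_not_constant (hδ : ∀ x ∈ w, δ z x = z ∨ ∀ p q, δ p x = δ q x)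
    (h : ∃ p q, w.foldl δ p ≠ w.foldl δ q) : ∀ x ∈ w, δ z x = z := by
  induction w with
  | nil => simp
  | cons y w ih =>
    obtain ⟨p, q, hpq⟩ := h
    intro x hx
    rcases List.mem_cons.1 hx with rfl | hx
    · refine (hδ x (by simp)).resolve_right fun h' => hpq ?_
      simp only [List.foldl_cons, h' p q]
    · exact ih (fun x hx => hδ x (by simp [hx])) ⟨_, _, hpq⟩ x hx

theorem foldl_eq_self_of_letters_fix (h : ∀ x ∈ w, δ z x = z) : w.foldl δ z = z := by
  induction w with
  | nil => rfl
  | cons y w ih =>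
    rw [List.foldl_cons, h y (by simp)]
    exact ih fun x hx => h x (by simp [hx])

theorem letters_injective_of_injective [Finite Q] (h : Function.Injective fun q => w.foldl δ q) :
    ∀ x ∈ w, Function.Injective fun q => δ q x := by
  induction w with
  | nil => simp
  | cons y w ih =>
    have hy : Function.Injective fun q => δ q y :=
      Function.Injective.of_comp (f := fun q => w.foldl δ q) h
    intro x hx
    rcases List.mem_cons.1 hx with rfl | hx
    · exact hy
    · refine ih ?_ x hx
      exact (Function.Injective.of_comp_iff' (fun q => w.foldl δ q)
        (Finite.injective_iff_bijective.1 hy)).1 h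

/-- A set of transformations that generates all the transformations that fix `z`, and a constant
map to another state, where each generator fixes `z` or is constant, has at least five elements. -/
theorem five_le_encard_of_generates [Fintype Q] (hQ : 4 ≤ Fintype.card Q) (A : Set α)
    (hδ : ∀ x ∈ A, δ z x = z ∨ ∀ p q, δ p x = δ q x)
    (hgen : ∀ f : Q → Q, f z = z → ∃ w : List α, (∀ x ∈ w, x ∈ A) ∧ ∀ q, w.foldl δ q = f q)
    (hmove : ∃ w : List α, (∀ x ∈ w, x ∈ A) ∧ w.foldl δ z ≠ z) : 5 ≤ A.encard := by
  classical
  obtain ⟨r, s, t, hr, hs, ht, hrs, hrt, hst⟩ : ∃ r s t : Q, r ≠ z ∧ s ≠ z ∧ t ≠ z ∧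
      r ≠ s ∧ r ≠ t ∧ s ≠ t := by
    have : 2 < (Finset.univ.erase z).card := by
      rw [Finset.card_erase_of_mem (Finset.mem_univ _), Finset.card_univ]
      omega
    obtain ⟨r, s, t, h1, h2, h3, h4⟩ := Finset.two_lt_card_iff.1 this
    exact ⟨r, s, t, Finset.ne_of_mem_erase h1, Finset.ne_of_mem_erase h2,
      Finset.ne_of_mem_erase h3, h4⟩
  obtain ⟨x₀, hx₀A, hx₀⟩ : ∃ x ∈ A, δ z x ≠ z := by
    obtain ⟨w, hw, h⟩ := hmove
    by_contra! h'
    exact h (foldl_eq_self_of_letters_fix δ fun x hx => h' x (hw x hx))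
  -- two permutations
  obtain ⟨x₁, hx₁A, x₂, hx₂A, hx₁, hx₂, hx₁₂⟩ : ∃ x ∈ A, ∃ y ∈ A,
      (Function.Injective fun q => δ q x) ∧ (Function.Injective fun q => δ q y) ∧ x ≠ y := by
    obtain ⟨u, hu, hu'⟩ := hgen (Equiv.swap r s) (Equiv.swap_apply_of_ne_of_ne hr.symm hs.symm)
    obtain ⟨v, hv, hv'⟩ := hgen (Equiv.swap s t) (Equiv.swap_apply_of_ne_of_ne hs.symm ht.symm)
    have hui : Function.Injective fun q => u.foldl δ q := by
      simp only [hu']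
      exact (Equiv.swap r s).injective
    have hvi : Function.Injective fun q => v.foldl δ q := by
      simp only [hv']
      exact (Equiv.swap s t).injective
    by_contra! h
    obtain ⟨x, hx⟩ : ∃ x, x ∈ u := by
      by_contra! hnil
      rw [List.eq_nil_iff_forall_not_mem.2 hnil] at hu'
      have := hu' r
      rw [Equiv.swap_apply_left] at this
      exact hrs this
    have hxi := letters_injective_of_injective δ hui x hx
    have h1 : u = List.replicate u.length x := List.eq_replicate_iff.2 ⟨rfl, fun y hy =>
      (h x (hu x hx) y (hu y hy) hxi (letters_injective_of_injective δ hui y hy)).symm⟩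
    have h2 : v = List.replicate v.length x := List.eq_replicate_iff.2 ⟨rfl, fun y hy =>
      (h x (hu x hx) y (hv y hy) hxi (letters_injective_of_injective δ hvi y hy)).symm⟩
    -- Powers of a single letter commute, whereas the two overlapping transpositions do not.
    have h3 : u ++ v = v ++ u := by
      rw [h1, h2, List.replicate_append_replicate, List.replicate_append_replicate, add_comm]
    have h4 := congrArg (fun w => w.foldl δ r) h3
    simp only [List.foldl_append, hu', hv'] at h4
    rw [Equiv.swap_apply_left, Equiv.swap_apply_left, Equiv.swap_apply_of_ne_of_ne hrs hrt,
      Equiv.swap_apply_left] at h4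
    exact hst h4.symm
  have fix : ∀ x ∈ A, (Function.Injective fun q => δ q x) → δ z x = z := fun x hx hi =>
    (hδ x hx).resolve_right fun h => hr (hi (h r z))
  -- Cutting a word for `f` at its first singular letter `x` gives `f = h ∘ x ∘ g` with `g` a
  -- permutation fixing `z`. So the states sent to `z` by `x`, and the pairs identified by it, are
  -- seen in `f` through `g`.
  have factor : ∀ f : Q → Q, f z = z → ¬ Function.Injective f → (∃ p q, f p ≠ f q) →
      ∃ x ∈ A, δ z x = z ∧ (¬ Function.Injective fun q => δ q x) ∧ ∃ g h : Q → Q,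
        Function.Bijective g ∧ g z = z ∧ h z = z ∧ ∀ q, f q = h (δ (g q) x) := by
    intro f hfz hf hnc
    obtain ⟨w, hw, hwf⟩ := hgen f hfz
    have hwf' : (fun q => w.foldl δ q) = f := funext hwf
    obtain ⟨u, x, v, rfl, hu, hx⟩ := exists_first_not_injective δ (w := w) (by rwa [hwf'])
    have hfix := letters_fix_of_not_constant δ (z := z) (fun x hx => hδ x (hw x hx))
      (by simpa only [hwf] using hnc)
    refine ⟨x, hw x (by simp), hfix x (by simp), hx, fun q => u.foldl δ q, fun q => v.foldl δ q,
      Finite.injective_iff_bijective.1 hu,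
      foldl_eq_self_of_letters_fix δ fun x hx => hfix x (by simp [hx]),
      foldl_eq_self_of_letters_fix δ fun x hx => hfix x (by simp [hx]), fun q => ?_⟩
    rw [← hwf, List.foldl_append, List.foldl_cons]
  -- a singular map under which only `z` goes to `z`
  obtain ⟨x₃, hx₃A, hx₃z, hx₃i, hx₃⟩ : ∃ x ∈ A, δ z x = z ∧
      (¬ Function.Injective fun q => δ q x) ∧ ∀ q, δ q x = z → q = z := by
    obtain ⟨x, hx, hxz, hxi, g, h, hg, hgz, hhz, hf⟩ := factor (Function.update id r s)
      (by simp [hr.symm])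
      (fun h => hrs (h (by simp [Function.update_of_ne hrs.symm])))
      ⟨z, r, by simp [hr.symm, hs.symm]⟩
    refine ⟨x, hx, hxz, hxi, fun q hq => ?_⟩
    obtain ⟨p, rfl⟩ := hg.2 q
    have := hf p
    rw [hq, hhz] at this
    have hp : p = z := by
      by_cases hpr : p = r
      · subst hpr
        simp only [Function.update_self] at this
        exact absurd this hs
      · simpa [Function.update_of_ne hpr] using this
    rw [hp, hgz]
  -- a singular map under which another state goes to `z`
  obtain ⟨x₄, hx₄A, hx₄z, hx₄i, q₄, hq₄, hx₄⟩ : ∃ x ∈ A, δ z x = z ∧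
      (¬ Function.Injective fun q => δ q x) ∧ ∃ q, q ≠ z ∧ δ q x = z := by
    obtain ⟨x, hx, hxz, hxi, g, h, hg, hgz, hhz, hf⟩ := factor (Function.update id r z)
      (by simp [hr.symm])
      (fun h => hr (h (by simp [hr.symm])))
      ⟨z, s, by simp [hr.symm, hrs.symm, hs.symm]⟩
    refine ⟨x, hx, hxz, hxi, ?_⟩
    by_contra! h'
    -- `Function.update id r z` is injective on the states other than `z`, hence so is `x`; if
    -- moreover only `z` went to `z`, then `x` would be injective.
    refine hxi fun p q hpq => ?_
    by_cases hp : p = z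
    · subst hp
      by_contra hq
      exact h' q (Ne.symm hq) (hpq.symm.trans hxz)
    by_cases hq : q = z
    · subst hq
      exact absurd (hpq.trans hxz) (h' p hp)
    obtain ⟨p, rfl⟩ := hg.2 p
    obtain ⟨q, rfl⟩ := hg.2 q
    have e : Function.update id r z p = Function.update id r z q := by
      rw [hf, hf]
      exact congrArg h hpq
    have hpz : p ≠ z := fun h => hp (h ▸ hgz)
    have hqz : q ≠ z := fun h => hq (h ▸ hgz)
    by_cases hpr : p = r
    · by_cases hqr : q = r
      · rw [hpr, hqr]
      · simp [hpr, Function.update_of_ne hqr] at e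
        exact absurd e.symm hqz
    · by_cases hqr : q = r
      · simp [hqr, Function.update_of_ne hpr] at e
        exact absurd e hpz
      · simp [Function.update_of_ne hpr, Function.update_of_ne hqr] at e
        rw [e]
  have hsub : (({x₀, x₁, x₂, x₃, x₄} : Finset α) : Set α) ⊆ A := by
    intro x hx
    simp only [Finset.coe_insert, Finset.coe_singleton, Set.mem_insert_iff,
      Set.mem_singleton_iff] at hx
    rcases hx with rfl | rfl | rfl | rfl | rfl <;> assumption
  refine le_trans ?_ (Set.encard_le_encard hsub)
  rw [Set.encard_coe_eq_coe_finsetCard]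
  have n01 : x₀ ≠ x₁ := fun h => hx₀ (h ▸ fix x₁ hx₁A hx₁)
  have n02 : x₀ ≠ x₂ := fun h => hx₀ (h ▸ fix x₂ hx₂A hx₂)
  have n03 : x₀ ≠ x₃ := fun h => hx₀ (h ▸ hx₃z)
  have n04 : x₀ ≠ x₄ := fun h => hx₀ (h ▸ hx₄z)
  have n13 : x₁ ≠ x₃ := fun h => hx₃i (h ▸ hx₁)
  have n14 : x₁ ≠ x₄ := fun h => hx₄i (h ▸ hx₁)
  have n23 : x₂ ≠ x₃ := fun h => hx₃i (h ▸ hx₂)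
  have n24 : x₂ ≠ x₄ := fun h => hx₄i (h ▸ hx₂)
  have n34 : x₃ ≠ x₄ := fun h => hq₄ (hx₃ q₄ (h ▸ hx₄))
  rw [Finset.card_insert_of_notMem (by simp [*]), Finset.card_insert_of_notMem (by simp [*]),
    Finset.card_insert_of_notMem (by simp [*]), Finset.card_insert_of_notMem (by simp [*]),
    Finset.card_singleton]
  norm_num

end Generators

/-! ### The syntactic semigroup acting on the quotients -/

section Syntactic

variable {α : Type*} {A : Set α} {L : Language α} {n : ℕ}

/-- The action of the words over `A` on the quotients of `L`. -/
def quotientAction (A : Set α) (L : Language α) (w : NonemptyWord A) :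
    quotients A L →o quotients A L where
  toFun K := ⟨K.1.leftQuotient w.1, leftQuotient_mem_quotients K.2 w.2.1⟩
  monotone' _ _ h := leftQuotient_mono h w.1

theorem syntacticCongruence_iff (hL : L ≤ words A) (x y : NonemptyWord A) :
    (syntacticCongruence A L).r x y ↔ quotientAction A L x = quotientAction A L y := by
  constructor
  · intro h
    ext ⟨K, u, hu, rfl⟩ : 2
    refine Subtype.ext ?_
    change (L.leftQuotient u).leftQuotient x.1 = (L.leftQuotient u).leftQuotient y.1
    rw [← Language.leftQuotient_append, ← Language.leftQuotient_append]
    ext z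
    by_cases hz : z ∈ words A
    · exact h u hu z hz
    · exact ⟨fun h => absurd (append_mem_words.1 (hL h)).2 hz,
        fun h => absurd (append_mem_words.1 (hL h)).2 hz⟩
  · intro h u hu z hz
    have := congrArg (fun f => (f ⟨L.leftQuotient u, u, hu, rfl⟩).1) h
    change (L.leftQuotient u).leftQuotient x.1 = (L.leftQuotient u).leftQuotient y.1 at this
    rw [← Language.leftQuotient_append, ← Language.leftQuotient_append] at this
    change z ∈ L.leftQuotient (u ++ x.1) ↔ z ∈ L.leftQuotient (u ++ y.1)
    rw [this]

/-- The action of the syntactic semigroup on the quotients. -/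
def syntacticAction (hL : L ≤ words A) (c : Quotient (syntacticCongruence A L)) :
    quotients A L →o quotients A L :=
  Quotient.lift (quotientAction A L) (fun x y h => (syntacticCongruence_iff hL x y).1 h) c

theorem syntacticAction_injective (hL : L ≤ words A) :
    Function.Injective (syntacticAction hL) := by
  intro c d
  induction c using Quotient.ind with | _ x
  induction d using Quotient.ind with | _ y
  exact fun h => Quotient.sound ((syntacticCongruence_iff hL x y).2 h)

theorem quotientAction_eq_foldl (w : List α) (K : quotients A L)
    (hw : w ∈ words A) (δ : quotients A L → α → quotients A L)
    (hδ : ∀ K x, x ∈ A → (δ K x).1 = K.1.leftQuotient [x]) :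
    (w.foldl δ K).1 = K.1.leftQuotient w := by
  induction w generalizing K with
  | nil => rfl
  | cons x w ih =>
    obtain ⟨hx, hw⟩ := cons_mem_words.1 hw
    rw [List.foldl_cons, ih _ hw, hδ _ _ hx, ← Language.leftQuotient_append,
      List.singleton_append]

theorem finite_quotients_of_complexity (hn : complexity A L = n) : Finite (quotients A L) :=
  (Set.finite_of_encard_eq_coe hn).to_subtype

theorem natCard_quotients_of_complexity (hn : complexity A L = n) :
    Nat.card (quotients A L) = n := by
  rw [Nat.card_coe_set_eq, Set.ncard, ← complexity, hn]
  simp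

/-- The language itself is the least quotient of a left ideal. -/
abbrev IsRegularLeftIdeal.orderBot (h : IsRegularLeftIdeal A L) : OrderBot (quotients A L) where
  bot := ⟨L, self_mem_quotients⟩
  bot_le K := h.le_of_mem_quotients K.2

theorem syntacticSemigroupCard_le (h : IsRegularLeftIdeal A L) (hn : complexity A L = n)
    (hn4 : 4 ≤ n) : syntacticSemigroupCard A L ≤ (n ^ (n - 1) + n - 1 : ℕ) := by
  have := finite_quotients_of_complexity hn
  have := Fintype.ofFinite (quotients A L)
  let := h.orderBot
  have hc := natCard_quotients_of_complexity hn
  rw [Nat.card_eq_fintype_card] at hc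
  have hb := card_orderHom_le (Q := quotients A L) (by omega)
  rw [hc] at hb
  have : Finite (quotients A L →o quotients A L) := DFunLike.finite _
  refine (ENat.card_le_card_of_injective (syntacticAction_injective h.subset_words)).trans ?_
  rw [ENat.card_eq_coe_natCard]
  exact_mod_cast hb

/-- Meeting the bound rules out comparable quotients off the bottom and makes the action surjective
onto the monotone maps. Then every map fixing the bottom is monotone and hence induced by a word,
while a letter that moves the bottom sends it to a maximal quotient and is therefore constant. -/
theorem five_le_encard_alphabet (h : IsRegularLeftIdeal A L) (hn : complexity A L = n)
    (hn4 : 4 ≤ n) (hmax : syntacticSemigroupCard A L = (n ^ (n - 1) + n - 1 : ℕ)) :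
    5 ≤ A.encard := by
  classical
  have := finite_quotients_of_complexity hn
  have := Fintype.ofFinite (quotients A L)
  let := h.orderBot
  have hc := natCard_quotients_of_complexity hn
  rw [Nat.card_eq_fintype_card] at hc
  have hc4 : 4 ≤ Fintype.card (quotients A L) := by omega
  have : Finite (quotients A L →o quotients A L) := DFunLike.finite _
  have hinj := syntacticAction_injective h.subset_words
  have := Finite.of_injective _ hinj
  have hcard : Nat.card (Quotient (syntacticCongruence A L)) = n ^ (n - 1) + n - 1 := by
    rw [syntacticSemigroupCard, ENat.card_eq_coe_natCard] at hmax
    exact_mod_cast hmax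
  have hanti : ∀ r s : quotients A L, r < s → r = ⊥ := by
    by_contra! h'
    obtain ⟨r, s, hrs, hr⟩ := h'
    have h1 := card_orderHom_lt hc4 hr hrs
    have h2 := Nat.card_le_card_of_injective _ hinj
    rw [hc] at h1
    omega
  have hsurj : Function.Surjective (syntacticAction h.subset_words) := by
    refine ((Nat.bijective_iff_injective_and_card _).2 ⟨hinj, ?_⟩).2
    refine le_antisymm (Nat.card_le_card_of_injective _ hinj) ?_
    rw [hcard]
    have := card_orderHom_le hc4
    rwa [hc] at this
  have hsurj' : ∀ f : quotients A L →o quotients A L, ∃ w, quotientAction A L w = f := by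
    intro f
    obtain ⟨c, hf⟩ := hsurj f
    induction c using Quotient.ind with | _ w
    exact ⟨w, hf⟩
  have hmono : ∀ f : quotients A L → quotients A L, f ⊥ = ⊥ → Monotone f := by
    intro f hf p q hpq
    rcases eq_or_lt_of_le hpq with rfl | h'
    · exact le_rfl
    · rw [hanti p q h', hf]
      exact bot_le
  let δ : quotients A L → α → quotients A L := fun K x =>
    if hx : x ∈ A then ⟨K.1.leftQuotient [x], leftQuotient_mem_quotients K.2
      (cons_mem_words.2 ⟨hx, nil_mem_words⟩)⟩ else K
  have hδ : ∀ K x, x ∈ A → (δ K x).1 = K.1.leftQuotient [x] := by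
    intro K x hx
    simp only [δ, dif_pos hx]
  have hfold : ∀ w : NonemptyWord A, ∀ K, w.1.foldl δ K = quotientAction A L w K := fun w K =>
    Subtype.ext (quotientAction_eq_foldl w.1 K w.2.1 δ hδ)
  refine five_le_encard_of_generates δ (z := ⊥) hc4 A ?_ ?_ ?_
  · intro x hx
    by_cases hz : δ ⊥ x = ⊥
    · exact Or.inl hz
    · right
      have key : ∀ p, δ p x = δ ⊥ x := by
        intro p
        have : δ ⊥ x ≤ δ p x := by
          change (δ ⊥ x).1 ≤ (δ p x).1
          rw [hδ _ _ hx, hδ _ _ hx]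
          exact leftQuotient_mono (bot_le : ⊥ ≤ p) _
        rcases eq_or_lt_of_le this with h' | h'
        · exact h'.symm
        · exact absurd (hanti _ _ h') hz
      exact fun p q => (key p).trans (key q).symm
  · intro f hf
    obtain ⟨w, hw⟩ := hsurj' ⟨f, hmono f hf⟩
    exact ⟨w.1, w.2.1, fun q => by rw [hfold, hw]; rfl⟩
  · obtain ⟨p, hp⟩ := Fintype.exists_ne_of_one_lt_card (by omega) (⊥ : quotients A L)
    obtain ⟨w, hw⟩ := hsurj' ⟨fun _ => p, fun _ _ _ => le_rfl⟩
    exact ⟨w.1, w.2.1, by rw [hfold, hw]; exact hp⟩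

end Syntactic

/-! ### Transformations of the states induced by nonempty words -/

section Transformations

variable {n : ℕ} {hn : 4 ≤ n}

theorem val_step_a (q : Fin n) : (witnessStep n hn q Letter.a).val =
    if q.val = 0 then 0 else if q.val + 1 < n then q.val + 1 else 1 := by
  simp only [witnessStep]
  split_ifs <;> simp_all

theorem val_step_b (q : Fin n) : (witnessStep n hn q Letter.b).val =
    if q.val = 1 then 2 else if q.val = 2 then 1 else q.val := by
  simp only [witnessStep]
  split_ifs <;> simp_all

theorem val_step_c (q : Fin n) : (witnessStep n hn q Letter.c).val =
    if q.val = n - 1 then 1 else q.val := by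
  simp only [witnessStep]
  split_ifs <;> simp_all

theorem val_step_d (q : Fin n) : (witnessStep n hn q Letter.d).val =
    if q.val = n - 1 then 0 else q.val := by
  simp only [witnessStep]
  split_ifs <;> simp_all

theorem val_step_e (q : Fin n) : (witnessStep n hn q Letter.e).val = 1 := rfl

theorem step_a_injective : Function.Injective fun q => witnessStep n hn q Letter.a := by
  intro p q h
  have h := congrArg Fin.val h
  simp only [val_step_a] at h
  have := p.2
  have := q.2
  ext
  split_ifs at h <;> omega

theorem step_b_injective : Function.Injective fun q => witnessStep n hn q Letter.b := by
  intro p q h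
  have h := congrArg Fin.val h
  simp only [val_step_b] at h
  ext
  split_ifs at h <;> omega

theorem step_b_step_b (q : Fin n) :
    witnessStep n hn (witnessStep n hn q Letter.b) Letter.b = q := by
  ext
  simp only [val_step_b]
  split_ifs <;> omega

theorem iterate_step_a_zero {z : Fin n} (hz : z.val = 0) (k : ℕ) :
    (fun q => witnessStep n hn q Letter.a)^[k] z = z := by
  refine Function.iterate_fixed ?_ k
  ext
  simp [val_step_a, hz]

theorem val_iterate_step_a {q : Fin n} (hq : q.val ≠ 0) (k : ℕ) (h : q.val + k < n) :
    ((fun q => witnessStep n hn q Letter.a)^[k] q).val = q.val + k := by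
  induction k with
  | zero => rfl
  | succ k ih =>
    rw [Function.iterate_succ_apply']
    have := ih (by omega)
    simp only [val_step_a, this]
    split_ifs <;> omega

theorem exists_iterate_step_a {q r : Fin n} (hq : q.val ≠ 0) (hr : r.val ≠ 0) :
    ∃ k, (fun q => witnessStep n hn q Letter.a)^[k] q = r := by
  have h1 := val_iterate_step_a (hn := hn) hq (n - 1 - q.val) (by have := q.2; omega)
  set last := (fun q => witnessStep n hn q Letter.a)^[n - 1 - q.val] q with hlast
  have hq2 := q.2
  have h2 : (witnessStep n hn last Letter.a).val = 1 := by
    rw [val_step_a]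
    split_ifs <;> omega
  refine ⟨(r.val - 1) + (1 + (n - 1 - q.val)), ?_⟩
  rw [Function.iterate_add_apply, Function.iterate_add_apply, ← hlast]
  ext
  have hr2 := r.2
  rw [Function.iterate_one, val_iterate_step_a (by omega) _ (by omega)]
  omega

/-- A transformation of the states that is induced by a nonempty word. -/
def Realizable (hn : 4 ≤ n) (f : Fin n → Fin n) : Prop :=
  ∃ w, w ≠ [] ∧ ∀ q, (witnessDFA n hn).evalFrom q w = f q

theorem realizable_letter (x : Letter) : Realizable hn fun q => witnessStep n hn q x :=
  ⟨[x], by simp, fun _ => rfl⟩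

theorem Realizable.comp {f g : Fin n → Fin n} (hg : Realizable hn g) (hf : Realizable hn f) :
    Realizable hn (g ∘ f) := by
  obtain ⟨u, hu, hu'⟩ := hf
  obtain ⟨v, hv, hv'⟩ := hg
  exact ⟨u ++ v, by simp [hu], fun q => by rw [DFA.evalFrom_of_append, hu', hv']; rfl⟩

/-- The empty word is not allowed, but `b` is an involution, so `bb` serves. -/
theorem realizable_id : Realizable hn id := by
  have := (realizable_letter (hn := hn) Letter.b).comp (realizable_letter (hn := hn) Letter.b)
  convert this using 1
  ext q
  simp [step_b_step_b]

/-- The permutations of the states that are induced by nonempty words. -/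
def realizablePerms (hn : 4 ≤ n) : Submonoid (Equiv.Perm (Fin n)) where
  carrier := {σ | Realizable hn σ}
  mul_mem' h k := h.comp k
  one_mem' := realizable_id

theorem mem_realizablePerms {σ : Equiv.Perm (Fin n)} :
    σ ∈ realizablePerms hn ↔ Realizable hn σ := Iff.rfl

/-- In a finite group the inverse is a power. -/
theorem inv_mem_realizablePerms {σ : Equiv.Perm (Fin n)} (h : σ ∈ realizablePerms hn) :
    σ⁻¹ ∈ realizablePerms hn := by
  have : σ⁻¹ = σ ^ (orderOf σ - 1) := by
    rw [eq_comm, ← mul_eq_one_iff_eq_inv, ← pow_succ,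
      Nat.sub_add_cancel (orderOf_pos σ), pow_orderOf_eq_one]
  rw [this]
  exact pow_mem h _

/-- Conjugating the transposition `b` of `1` and `2` repeatedly by the cycle `a` produces the other
adjacent transpositions of nonzero states. -/
theorem swap_succ_mem_realizablePerms {i j : Fin n} (hi : i.val ≠ 0) (hij : j.val = i.val + 1) :
    Equiv.swap i j ∈ realizablePerms hn := by
  set a : Equiv.Perm (Fin n) := Equiv.ofBijective _
    (Finite.injective_iff_bijective.1 (step_a_injective (hn := hn))) with ha
  have hav : ∀ q, a q = witnessStep n hn q Letter.a := fun _ => rfl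
  have haM : a ∈ realizablePerms hn := realizable_letter Letter.a
  obtain ⟨k, hk⟩ : ∃ k, i.val = k + 1 := ⟨i.val - 1, by omega⟩
  induction k generalizing i j with
  | zero =>
    rw [mem_realizablePerms]
    convert realizable_letter (hn := hn) Letter.b using 1
    ext q
    rw [Equiv.swap_apply_def, val_step_b]
    simp only [Fin.ext_iff]
    split_ifs <;> omega
  | succ k ih =>
    have hj := j.2
    have h1 : a ⟨k + 1, by omega⟩ = i := by
      ext
      rw [hav, val_step_a]
      dsimp only
      rw [if_neg (by omega), if_pos (by omega), hk]
    have h2 : a ⟨k + 2, by omega⟩ = j := by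
      ext
      rw [hav, val_step_a]
      dsimp only
      rw [if_neg (by omega), if_pos (by omega), hij, hk]
    have h3 := ih (i := ⟨k + 1, by omega⟩) (j := ⟨k + 2, by omega⟩) (by simp) rfl rfl
    have h4 := mul_mem (mul_mem haM h3) (inv_mem_realizablePerms haM)
    rwa [← Equiv.swap_apply_apply, h1, h2] at h4

/-- Such an `f` permutes the nonzero states, and adjacent transpositions generate their symmetric
group. `Fin.cons 0 (Fin.succ ∘ τ)` extends a permutation of these states by the fixed point `0`. -/
theorem realizable_of_injective {f : Fin n → Fin n} (hf : Function.Injective f)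
    (h0 : ∀ q : Fin n, q.val = 0 → f q = q) : Realizable hn f := by
  obtain ⟨k, rfl⟩ : ∃ k, n = k + 2 := ⟨n - 2, by omega⟩
  have key : ∀ τ : Equiv.Perm (Fin (k + 1)),
      Realizable hn (Fin.cons 0 (Fin.succ ∘ τ) : Fin (k + 2) → Fin (k + 2)) := by
    intro τ
    have hτ : τ ∈ Submonoid.closure (Set.range fun i : Fin k => Equiv.swap i.castSucc i.succ) := by
      rw [Equiv.Perm.mclosure_swap_castSucc_succ]
      trivial
    induction hτ using Submonoid.closure_induction with
    | mem τ h =>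
      obtain ⟨i, rfl⟩ := h
      have := swap_succ_mem_realizablePerms (hn := hn) (i := i.castSucc.succ) (j := i.succ.succ)
        (by simp) (by simp)
      rw [mem_realizablePerms] at this
      convert this using 1
      ext q : 1
      induction q using Fin.cases with
      | zero => rw [Fin.cons_zero, Equiv.swap_apply_of_ne_of_ne] <;> exact (Fin.succ_ne_zero _).symm
      | succ q =>
        rw [Fin.cons_succ, Function.comp_apply]
        exact (Fin.succ_injective _).map_swap i.castSucc i.succ q
    | one =>
      convert realizable_id (hn := hn) using 1
      ext q : 1
      induction q using Fin.cases <;> simp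
    | mul σ τ _ _ hσ hτ =>
      convert hσ.comp hτ using 1
      ext q : 1
      induction q using Fin.cases <;> simp
  have h0 := h0 0 rfl
  have hne : ∀ i : Fin (k + 1), f i.succ ≠ 0 := fun i h =>
    Fin.succ_ne_zero i (hf (h.trans h0.symm))
  let g : Fin (k + 1) → Fin (k + 1) := fun i => (f i.succ).pred (hne i)
  have hg : Function.Injective g := by
    intro i j h
    have := Fin.pred_inj.1 h
    exact Fin.succ_injective _ (hf this)
  convert key (Equiv.ofBijective g (Finite.injective_iff_bijective.1 hg)) using 1
  ext q : 1
  induction q using Fin.cases with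
  | zero => simpa using h0
  | succ q => simp [g]

/-- The map is conjugate to `d` if `j` is `0` and to `c` otherwise, by a permutation fixing `0`. -/
theorem realizable_collapse {i j : Fin n} (hi : i.val ≠ 0) (hij : i ≠ j) :
    Realizable hn (Function.update id i j) := by
  have hconj : ∀ (σ : Equiv.Perm (Fin n)) (x : Letter), (∀ q : Fin n, q.val = 0 → σ q = q) →
      (∀ q, witnessStep n hn (σ q) x = σ (Function.update id i j q)) →
      Realizable hn (Function.update id i j) := by
    intro σ x h0 h
    have hσ : σ ∈ realizablePerms hn := realizable_of_injective σ.injective h0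
    have h3 := (mem_realizablePerms.1 (inv_mem_realizablePerms hσ)).comp
      ((realizable_letter (hn := hn) x).comp (mem_realizablePerms.1 hσ))
    convert h3 using 1
    ext q : 1
    simp [h]
  set last : Fin n := ⟨n - 1, by omega⟩ with hlast
  have hlastv : last.val = n - 1 := rfl
  by_cases hj : j.val = 0
  · refine hconj (Equiv.swap i last) Letter.d ?_ ?_
    · intro q hq
      refine Equiv.swap_apply_of_ne_of_ne ?_ ?_ <;> rintro rfl <;> omega
    · intro q
      by_cases hq : q = i
      · subst hq
        rw [Function.update_self, Equiv.swap_apply_left,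
          Equiv.swap_apply_of_ne_of_ne hij.symm (by rintro rfl; omega)]
        ext
        rw [val_step_d, if_pos rfl, hj]
      · rw [Function.update_of_ne hq, id_eq]
        ext
        rw [val_step_d, if_neg]
        intro h
        have : Equiv.swap i last q = last := Fin.ext h
        rw [Equiv.swap_apply_eq_iff, Equiv.swap_apply_right] at this
        exact hq this
  · set one : Fin n := ⟨1, by omega⟩ with hone
    have honev : one.val = 1 := rfl
    -- `t` is the place of `j` once `i` has been moved to the last state; a second transposition
    -- moves it to `1` and leaves the last state alone.
    set t := Equiv.swap i last j with ht
    have htl : t ≠ last := by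
      intro h
      rw [ht, Equiv.swap_apply_eq_iff, Equiv.swap_apply_right] at h
      exact hij h.symm
    have h0 : ∀ q : Fin n, q.val = 0 → Equiv.swap i last q = q := by
      intro q hq
      refine Equiv.swap_apply_of_ne_of_ne ?_ ?_ <;> rintro rfl <;> omega
    have ht0 : t.val ≠ 0 := by
      intro h
      have h1 := h0 t h
      rw [ht, Equiv.swap_apply_self, ← ht] at h1
      exact hj (h1 ▸ h)
    have hσi : (Equiv.swap t one * Equiv.swap i last) i = last := by
      rw [Equiv.Perm.mul_apply, Equiv.swap_apply_left, Equiv.swap_apply_of_ne_of_ne htl.symm]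
      intro h
      have := congrArg Fin.val h
      omega
    have hσj : (Equiv.swap t one * Equiv.swap i last) j = one := by
      rw [Equiv.Perm.mul_apply, ← ht, Equiv.swap_apply_left]
    refine hconj (Equiv.swap t one * Equiv.swap i last) Letter.c ?_ ?_
    · intro q hq
      rw [Equiv.Perm.mul_apply, h0 q hq]
      refine Equiv.swap_apply_of_ne_of_ne ?_ ?_
      · intro h
        exact ht0 (h ▸ hq)
      · rintro rfl
        omega
    · intro q
      by_cases hq : q = i
      · subst hq
        rw [Function.update_self, hσi, hσj]
        ext
        rw [val_step_c, if_pos rfl]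
      · rw [Function.update_of_ne hq, id_eq]
        ext
        rw [val_step_c, if_neg]
        intro h
        exact hq ((Equiv.swap t one * Equiv.swap i last).injective
          ((Fin.ext h : _ = last).trans hσi.symm))

/-- The words induce all the transformations that fix the initial state. -/
theorem realizable_of_fix_zero {f : Fin n → Fin n} (h0 : ∀ q : Fin n, q.val = 0 → f q = q) :
    Realizable hn f := by
  classical
  obtain ⟨d, hd⟩ : ∃ d, n - (Finset.univ.image f).card = d := ⟨_, rfl⟩
  induction d using Nat.strong_induction_on generalizing f with
  | _ d ih =>
    by_cases hf : Function.Injective f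
    · exact realizable_of_injective hf h0
    · obtain ⟨v, hv⟩ : ∃ v, ∀ q, f q ≠ v := by
        by_contra! h
        exact hf (Finite.injective_iff_surjective.2 h)
      obtain ⟨i, j, hij, hne, hi⟩ : ∃ i j, f i = f j ∧ i ≠ j ∧ i.val ≠ 0 := by
        simp only [Function.Injective] at hf
        push Not at hf
        obtain ⟨i, j, hij, hne⟩ := hf
        by_cases hi : i.val = 0
        · exact ⟨j, i, hij.symm, hne.symm, fun hj => hne (Fin.ext (hi.trans hj.symm))⟩
        · exact ⟨i, j, hij, hne, hi⟩
      -- Redirecting `i` to a missed value `v` enlarges the image, since `f i` is still attained at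
      -- `j`. Collapsing `i` to `j` beforehand recovers `f`.
      have hlt : (Finset.univ.image f).card < (Finset.univ.image (Function.update f i v)).card := by
        refine Finset.card_lt_card ⟨?_, ?_⟩
        · intro y hy
          obtain ⟨q, -, rfl⟩ := Finset.mem_image.1 hy
          by_cases hq : q = i
          · exact Finset.mem_image.2 ⟨j, Finset.mem_univ _, by
              rw [Function.update_of_ne hne.symm, hq, hij]⟩
          · exact Finset.mem_image.2 ⟨q, Finset.mem_univ _, by rw [Function.update_of_ne hq]⟩
        · intro h
          obtain ⟨q, -, hq⟩ := Finset.mem_image.1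
            (h (Finset.mem_image.2 ⟨i, Finset.mem_univ _, Function.update_self i v f⟩))
          exact hv q hq
      have hle := Finset.card_le_univ (Finset.univ.image (Function.update f i v))
      rw [Fintype.card_fin] at hle
      have h1 : Realizable hn (Function.update f i v) := by
        refine ih _ (by omega) ?_ rfl
        intro q hq
        rw [Function.update_of_ne (by rintro rfl; exact hi hq), h0 q hq]
      convert h1.comp (realizable_collapse (hn := hn) hi hne) using 1
      ext q : 1
      by_cases hq : q = i
      · subst hq
        simp [Function.update_of_ne hne.symm, hij]
      · simp [Function.update_of_ne hq]

/-- The letter `e` sends every state to `1`, which a map fixing `0` can then send anywhere. -/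
theorem realizable_const (r : Fin n) : Realizable hn fun _ => r := by
  classical
  have h : Realizable hn fun q : Fin n => if q.val = 1 then r else ⟨0, by omega⟩ := by
    refine realizable_of_fix_zero fun q hq => ?_
    rw [if_neg (by omega)]
    exact Fin.ext hq.symm
  convert h.comp (realizable_letter (hn := hn) Letter.e) using 1
  ext q : 1
  simp [val_step_e]

end Transformations

/-! ### The unary measures of the witness -/

section Witness

variable {n : ℕ} {hn : 4 ≤ n}

/-- The set of all words is the set of words over the full alphabet. -/
theorem mem_words_univ {α : Type*} (w : List α) : w ∈ words (Set.univ : Set α) :=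
  fun _ _ => Set.mem_univ _

theorem mem_witnessDFA_acceptsFrom {q : Fin n} {w : List Letter} :
    w ∈ (witnessDFA n hn).acceptsFrom q ↔ ((witnessDFA n hn).evalFrom q w).val = n - 1 := by
  rw [DFA.mem_acceptsFrom]
  exact Fin.ext_iff

theorem acceptsFrom_leftQuotient {α σ : Type*} (M : DFA α σ) (q : σ) (w : List α) :
    (M.acceptsFrom q).leftQuotient w = M.acceptsFrom (M.evalFrom q w) := by
  ext x
  rw [Language.mem_leftQuotient, DFA.mem_acceptsFrom, DFA.mem_acceptsFrom, DFA.evalFrom_of_append]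

/-- For each set `V` of states without the initial one, some word is accepted from exactly the
states in `V`. -/
theorem exists_word_accepted_iff (V : Set (Fin n)) (hV : ∀ q ∈ V, q.val ≠ 0) :
    ∃ w : List Letter, w ≠ [] ∧ ∀ q, w ∈ (witnessDFA n hn).acceptsFrom q ↔ q ∈ V := by
  classical
  obtain ⟨w, hw, h⟩ := realizable_of_fix_zero (hn := hn)
    (f := fun q => if q ∈ V then ⟨n - 1, by omega⟩ else ⟨0, by omega⟩) (fun q hq => by
      rw [if_neg fun h => hV q h hq]
      exact Fin.ext hq.symm)
  refine ⟨w, hw, fun q => ?_⟩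
  rw [mem_witnessDFA_acceptsFrom, h]
  dsimp only
  split_ifs with hq
  · simpa using hq
  · simp only [hq, iff_false]
    omega

theorem acceptsFrom_injective : Function.Injective (witnessDFA n hn).acceptsFrom := by
  intro p q h
  by_contra hpq
  wlog hq : q.val ≠ 0 generalizing p q
  · exact this h.symm (Ne.symm hpq) fun hp => hpq (Fin.ext (hp.trans (not_not.1 hq).symm))
  obtain ⟨w, -, hw⟩ := exists_word_accepted_iff (hn := hn) {q} (by simpa using hq)
  have h1 := (hw q).2 rfl
  rw [← h] at h1
  exact hpq ((hw p).1 h1)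

theorem isMinimalDFA_witnessDFA : IsMinimalDFA (witnessDFA n hn) := by
  refine ⟨fun q => ?_, fun p q h => acceptsFrom_injective h⟩
  obtain ⟨w, -, hw⟩ := realizable_const (hn := hn) q
  exact ⟨w, hw _⟩

theorem quotients_acceptsFrom (p : Fin n) :
    quotients Set.univ ((witnessDFA n hn).acceptsFrom p) =
      Set.range (witnessDFA n hn).acceptsFrom := by
  ext K
  constructor
  · rintro ⟨w, -, rfl⟩
    exact ⟨_, (acceptsFrom_leftQuotient _ _ _).symm⟩
  · rintro ⟨q, rfl⟩
    obtain ⟨w, -, hw⟩ := realizable_const (hn := hn) q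
    exact ⟨w, mem_words_univ w, by rw [acceptsFrom_leftQuotient, hw]⟩

theorem quotients_witness :
    quotients Set.univ (witness n hn) = Set.range (witnessDFA n hn).acceptsFrom :=
  quotients_acceptsFrom _

theorem complexity_acceptsFrom (p : Fin n) :
    complexity Set.univ ((witnessDFA n hn).acceptsFrom p) = n := by
  rw [complexity, quotients_acceptsFrom, ← Set.image_univ, acceptsFrom_injective.encard_image,
    Set.encard_univ]
  simp

theorem complexity_witness : complexity Set.univ (witness n hn) = n :=
  complexity_acceptsFrom _

theorem complexity_of_mem_quotients_witness {K : Language Letter}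
    (hK : K ∈ quotients Set.univ (witness n hn)) : complexity Set.univ K = n := by
  rw [quotients_witness] at hK
  obtain ⟨p, rfl⟩ := hK
  exact complexity_acceptsFrom p

/-- Every letter fixes `0` or is constant, so a word that moves `0` acts as a constant. A word
accepted from `0` is thus accepted from every state, which makes `L_n` a left ideal. -/
theorem evalFrom_eq_of_eval_ne_zero {w : List Letter}
    (h : ((witnessDFA n hn).eval w).val ≠ 0) (q : Fin n) :
    (witnessDFA n hn).evalFrom q w = (witnessDFA n hn).eval w := by
  have hδ : ∀ x ∈ w, (witnessDFA n hn).step (witnessDFA n hn).start x = (witnessDFA n hn).start ∨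
      ∀ p q, (witnessDFA n hn).step p x = (witnessDFA n hn).step q x := by
    intro x _
    cases x with
    | e => exact Or.inr fun _ _ => rfl
    | _ =>
      left
      ext
      simp [witnessDFA, val_step_a, val_step_b, val_step_c, val_step_d]
      try omega
  by_contra hne
  have h1 := letters_fix_of_not_constant (witnessDFA n hn).step hδ ⟨q, _, hne⟩
  exact h (congrArg Fin.val (foldl_eq_self_of_letters_fix (witnessDFA n hn).step h1))

theorem append_mem_witness {u v : List Letter} (hv : v ∈ witness n hn) :
    u ++ v ∈ witness n hn := by
  have hv' : ((witnessDFA n hn).eval v).val = n - 1 := mem_witnessDFA_acceptsFrom.1 hv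
  refine mem_witnessDFA_acceptsFrom.2 ?_
  rw [DFA.evalFrom_of_append, evalFrom_eq_of_eval_ne_zero (by omega), hv']

theorem isRegularLeftIdeal_of_append_mem {α : Type*} {A : Set α} {L : Language α} (hA : A.Finite)
    (hL : L ≤ words A) (hreg : L.IsRegular)
    (h : ∀ u ∈ words A, ∀ v ∈ L, u ++ v ∈ L) : IsRegularLeftIdeal A L := by
  refine ⟨hA, hL, hreg, le_antisymm (fun x hx => ⟨[], nil_mem_words, x, hx, rfl⟩) ?_⟩
  rintro _ ⟨u, hu, v, hv, rfl⟩
  exact h u hu v hv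

theorem finite_set_letter (A : Set Letter) : A.Finite := by
  have : (Set.univ : Set Letter).Finite := by
    refine Set.Finite.subset (Set.toFinite ({Letter.a, Letter.b, Letter.c, Letter.d, Letter.e} :
      Set Letter)) fun x _ => ?_
    cases x <;> simp
  exact this.subset (Set.subset_univ A)

theorem isRegularLeftIdeal_witness : IsRegularLeftIdeal Set.univ (witness n hn) :=
  isRegularLeftIdeal_of_append_mem (finite_set_letter _) (fun w _ => mem_words_univ w)
    ⟨Fin n, inferInstance, witnessDFA n hn, rfl⟩ (fun _ _ _ hv => append_mem_witness hv)

theorem syntacticSemigroupCard_witness :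
    syntacticSemigroupCard Set.univ (witness n hn) = (n ^ (n - 1) + n - 1 : ℕ) := by
  classical
  refine le_antisymm
    (syntacticSemigroupCard_le isRegularLeftIdeal_witness complexity_witness hn) ?_
  let z : Fin n := ⟨0, by omega⟩
  let R : Type := {q : Fin n // q ≠ z}
  have hR : Nat.card R = n - 1 := by
    rw [Nat.card_eq_fintype_card, Fintype.card_subtype_compl, Fintype.card_subtype_eq,
      Fintype.card_fin]
  -- The `n ^ (n - 1)` maps fixing `0` and the `n - 1` constants with nonzero value.
  let F : (R → Fin n) ⊕ R → Fin n → Fin n :=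
    Sum.elim (fun g q => if h : q ≠ z then g ⟨q, h⟩ else z) (fun r _ => r.1)
  have hF : ∀ i, Realizable hn (F i) := by
    rintro (g | r)
    · refine realizable_of_fix_zero fun q hq => ?_
      have : q = z := Fin.ext hq
      simp [F, this]
    · exact realizable_const r.1
  have hFinj : Function.Injective F := by
    rintro (g | r) (g' | r') h
    · congr 1
      ext1 q
      have := congrFun h q.1
      simpa [F, q.2] using this
    · have := congrFun h z
      exact absurd (by simpa [F] using this.symm) r'.2
    · have := congrFun h z
      exact absurd (by simpa [F] using this) r.2
    · congr 1
      exact Subtype.ext (congrFun h z)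
  choose w hw hwF using hF
  let G : (R → Fin n) ⊕ R → Quotient (syntacticCongruence Set.univ (witness n hn)) := fun i =>
    Quotient.mk _ ⟨w i, mem_words_univ _, hw i⟩
  have hG : Function.Injective G := by
    intro i j h
    refine hFinj (funext fun q => acceptsFrom_injective (hn := hn) ?_)
    obtain ⟨u, -, hu⟩ := realizable_const (hn := hn) q
    have h := Quotient.exact h
    have hu := hu (witnessDFA n hn).start
    rw [← hwF, ← hwF]
    dsimp only at hu
    rw [← hu, ← DFA.evalFrom_of_append,
      ← DFA.evalFrom_of_append, ← acceptsFrom_leftQuotient, ← acceptsFrom_leftQuotient]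
    ext x
    exact h u (mem_words_univ u) x (mem_words_univ x)
  refine le_trans (le_of_eq ?_) (ENat.card_le_card_of_injective hG)
  rw [ENat.card_eq_coe_natCard, Nat.card_sum, Nat.card_fun, hR, Nat.card_eq_fintype_card,
    Fintype.card_fin, Nat.add_sub_assoc (by omega)]

theorem mem_quotients_iff_of_indexesAtom {S : Set (Language Letter)}
    (hS : IndexesAtom Set.univ (witness n hn) S) :
    ∃ U : Set (Fin n), S = (witnessDFA n hn).acceptsFrom '' U ∧
      ((∀ q ∈ U, q.val ≠ 0) ∨ U = Set.univ) := by
  refine ⟨{q | (witnessDFA n hn).acceptsFrom q ∈ S}, ?_, ?_⟩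
  · ext K
    constructor
    · intro hK
      obtain ⟨q, rfl⟩ := (quotients_witness (hn := hn) ▸ hS.1 hK : K ∈ Set.range _)
      exact ⟨q, hK, rfl⟩
    · rintro ⟨q, hq, rfl⟩
      exact hq
  · by_cases h : witness n hn ∈ S
    · right
      have := isRegularLeftIdeal_witness.eq_quotients_of_self_mem hS h
      ext q
      simp [this, quotients_witness]
    · left
      intro q hq hq0
      have : q = (witnessDFA n hn).start := Fin.ext hq0
      rw [this] at hq
      exact h hq

theorem natCard_set (R : Type*) [Finite R] : Nat.card (Set R) = 2 ^ Nat.card R := by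
  rw [show Nat.card (Set R) = Nat.card (R → Prop) from rfl, Nat.card_fun,
    Nat.card_eq_fintype_card (α := Prop), Fintype.card_prop]

theorem encard_indexesAtom_witness :
    {S | IndexesAtom Set.univ (witness n hn) S}.encard = (2 ^ (n - 1) + 1 : ℕ) := by
  refine le_antisymm (encard_indexesAtom_le isRegularLeftIdeal_witness complexity_witness) ?_
  let R : Type := {q : Fin n // q.val ≠ 0}
  have hR : Nat.card R = n - 1 := by
    have : R = {q : Fin n // ¬ q = ⟨0, by omega⟩} := by simp [R, Fin.ext_iff]
    rw [this, Nat.card_eq_fintype_card, Fintype.card_subtype_compl, Fintype.card_subtype_eq,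
      Fintype.card_fin]
  -- `none` stands for the set of all states, the only index containing the initial one.
  let F : Option (Set R) → Set (Language Letter) := fun o =>
    (witnessDFA n hn).acceptsFrom '' (o.elim Set.univ fun U => Subtype.val '' U)
  have hF : Function.Injective F := by
    intro o o' h
    have h := Set.image_injective.2 acceptsFrom_injective h
    have hz : ∀ U : Set R, (⟨0, by omega⟩ : Fin n) ∉ Subtype.val '' U := by
      rintro U ⟨r, -, hr⟩
      exact r.2 (congrArg Fin.val hr)
    rcases o with _ | U <;> rcases o' with _ | U'
    · rfl
    · exact absurd ((Set.ext_iff.1 h _).1 (Set.mem_univ _)) (hz U')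
    · exact absurd ((Set.ext_iff.1 h _).2 (Set.mem_univ _)) (hz U)
    · exact congrArg some (Set.image_injective.2 Subtype.val_injective h)
  have hS : ∀ o, IndexesAtom Set.univ (witness n hn) (F o) := by
    intro o
    suffices H : ∃ w : List Letter, ∀ q, w ∈ (witnessDFA n hn).acceptsFrom q ↔
        q ∈ (o.elim Set.univ fun U => Subtype.val '' U : Set (Fin n)) by
      obtain ⟨w, hw⟩ := H
      refine indexesAtom_iff.2 ⟨w, mem_words_univ w, ?_⟩
      ext K
      rw [quotientsContaining, quotients_witness]
      constructor
      · rintro ⟨q, hq, rfl⟩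
        exact ⟨⟨q, rfl⟩, (hw q).2 hq⟩
      · rintro ⟨⟨q, rfl⟩, hq⟩
        exact ⟨q, (hw q).1 hq, rfl⟩
    rcases o with _ | U
    · obtain ⟨w, -, hw⟩ := realizable_const (hn := hn) ⟨n - 1, by omega⟩
      exact ⟨w, fun q => by simp [mem_witnessDFA_acceptsFrom, hw]⟩
    · obtain ⟨w, -, hw⟩ := exists_word_accepted_iff (hn := hn) (Subtype.val '' U)
        (by rintro _ ⟨r, -, rfl⟩; exact r.2)
      exact ⟨w, hw⟩
  have : (Nat.card (Option (Set R)) : ℕ∞) ≤ {S | IndexesAtom Set.univ (witness n hn) S}.encard := by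
    rw [← ENat.card_eq_coe_natCard, ← Set.encard_univ, ← hF.encard_image]
    refine Set.encard_le_encard ?_
    rintro _ ⟨o, -, rfl⟩
    exact hS o
  rwa [Finite.card_option, natCard_set, hR] at this

theorem complexity_kstar_witness :
    complexity Set.univ (KStar.kstar (witness n hn)) = (n + 1 : ℕ) := by
  refine le_antisymm (complexity_kstar_le isRegularLeftIdeal_witness complexity_witness) ?_
  let F : Option (Fin n) → Language Letter := fun o =>
    o.elim (KStar.kstar (witness n hn)) (witnessDFA n hn).acceptsFrom
  have hne : ∀ q, KStar.kstar (witness n hn) ≠ (witnessDFA n hn).acceptsFrom q := by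
    intro q h
    have h1 : [] ∈ (witnessDFA n hn).acceptsFrom q := h ▸ Language.nil_mem_kstar _
    rw [mem_witnessDFA_acceptsFrom, DFA.evalFrom_nil] at h1
    -- A nonempty word acting as the identity would be accepted from `q` together with the empty
    -- word, yet it lies neither in `L_n` nor in `1`.
    obtain ⟨w, hw, hw'⟩ := realizable_id (hn := hn)
    have h2 : w ∈ (witnessDFA n hn).acceptsFrom q := by
      rw [mem_witnessDFA_acceptsFrom, hw']
      exact h1
    rw [← h, kstar_eq isRegularLeftIdeal_witness] at h2
    rcases h2 with h2 | h2
    · have h2 := mem_witnessDFA_acceptsFrom.1 h2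
      rw [hw'] at h2
      simp only [witnessDFA, id_eq] at h2
      omega
    · exact hw h2
  have hF : Function.Injective F := by
    rintro (_ | p) (_ | q) h
    · rfl
    · exact absurd h (hne q)
    · exact absurd h.symm (hne p)
    · exact congrArg some (acceptsFrom_injective h)
  have := natCard_le_complexity (A := Set.univ) (L := KStar.kstar (witness n hn)) hF ?_
  · rwa [Finite.card_option, Nat.card_eq_fintype_card, Fintype.card_fin] at this
  · rintro (_ | q)
    · exact self_mem_quotients
    · obtain ⟨w, hw, hw'⟩ := realizable_const (hn := hn) q
      refine ⟨w, mem_words_univ w, ?_⟩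
      rw [kstar_leftQuotient isRegularLeftIdeal_witness hw]
      change _ = ((witnessDFA n hn).acceptsFrom _).leftQuotient w
      rw [acceptsFrom_leftQuotient, hw']
      rfl

/-- The words that are accepted from all the states in `X` and from none in `Y`. -/
def stateCell (hn : 4 ≤ n) (X Y : Set (Fin n)) : Language Letter :=
  {w | (∀ q ∈ X, w ∈ (witnessDFA n hn).acceptsFrom q) ∧
    ∀ q ∈ Y, w ∉ (witnessDFA n hn).acceptsFrom q}

theorem atomicIntersection_witness_leftQuotient {f : Fin n → Fin n} {w : List Letter}
    (hw : ∀ q, (witnessDFA n hn).evalFrom q w = f q) (U : Set (Fin n)) :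
    (atomicIntersection Set.univ (witness n hn)
      ((witnessDFA n hn).acceptsFrom '' U)).leftQuotient w = stateCell hn (f '' U) (f '' Uᶜ) := by
  have hx : ∀ x q, w ++ x ∈ (witnessDFA n hn).acceptsFrom q ↔
      x ∈ (witnessDFA n hn).acceptsFrom (f q) := by
    intro x q
    rw [← hw, ← acceptsFrom_leftQuotient, Language.mem_leftQuotient]
  ext x
  change (w ++ x ∈ words _ ∧ _ ∧ _) ↔ (_ ∧ _)
  simp only [mem_words_univ, true_and, Set.forall_mem_image, hx]
  refine and_congr_right fun _ => ⟨fun h q hq => ?_, fun h K hK => ?_⟩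
  · rw [← hx]
    refine h _ ⟨?_, fun h' => ?_⟩
    · rw [quotients_witness]
      exact ⟨q, rfl⟩
    · obtain ⟨p, hp, hpq⟩ := h'
      exact hq (acceptsFrom_injective hpq ▸ hp)
  · obtain ⟨q, rfl⟩ := (quotients_witness (hn := hn) ▸ hK.1 : K ∈ Set.range _)
    rw [hx]
    exact h fun hq => hK.2 ⟨q, hq, rfl⟩

/-- The cell contains a word accepted exactly from `X` and one accepted exactly from the complement
of `Y`, and these recover both sets. Such words exist because `0 ∈ Y` keeps `0` out of `X` and out
of that complement. -/
theorem stateCell_ext {X Y X' Y' : Set (Fin n)} (h : stateCell hn X Y = stateCell hn X' Y')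
    (hXY : Disjoint X Y) (hXY' : Disjoint X' Y') (h0 : ∀ q : Fin n, q.val = 0 → q ∈ Y ∧ q ∈ Y') :
    X = X' ∧ Y = Y' := by
  have key : ∀ X Y X' Y' : Set (Fin n), stateCell hn X Y = stateCell hn X' Y' →
      Disjoint X Y → (∀ q : Fin n, q.val = 0 → q ∈ Y) → X' ⊆ X ∧ Y' ⊆ Y := by
    intro X Y X' Y' h hXY h0
    have hXY := Set.disjoint_left.1 hXY
    constructor
    · obtain ⟨w, -, hw⟩ := exists_word_accepted_iff (hn := hn) X
        fun q hq hq0 => hXY hq (h0 q hq0)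
      have h1 : w ∈ stateCell hn X Y :=
        ⟨fun q hq => (hw q).2 hq, fun q hq hq' => hXY ((hw q).1 hq') hq⟩
      rw [h] at h1
      exact fun q hq => (hw q).1 (h1.1 q hq)
    · obtain ⟨w, -, hw⟩ := exists_word_accepted_iff (hn := hn) Yᶜ
        fun q hq hq0 => hq (h0 q hq0)
      have h1 : w ∈ stateCell hn X Y :=
        ⟨fun q hq => (hw q).2 (hXY hq), fun q hq hq' => (hw q).1 hq' hq⟩
      rw [h] at h1
      exact fun q hq => by_contra fun hq' => h1.2 q hq ((hw q).2 hq')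
  obtain ⟨h1, h2⟩ := key X Y X' Y' h hXY fun q hq => (h0 q hq).1
  obtain ⟨h3, h4⟩ := key X' Y' X Y h.symm hXY' fun q hq => (h0 q hq).2
  exact ⟨h3.antisymm h1, h4.antisymm h2⟩

/-- An embedding of `X` into `U` is inverted on its range; everything else goes to `d`. -/
theorem exists_surjOn_of_card_le {β : Type*} {X U : Finset β} (h : X.card ≤ U.card) (d : β) :
    ∃ f : β → β, (∀ q, f q = d ∨ f q ∈ X) ∧ ∀ x ∈ X, ∃ q ∈ U, f q = x := by
  classical
  obtain ⟨g⟩ := Function.Embedding.nonempty_of_card_le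
    (α := X) (β := U) (by simpa using h)
  refine ⟨fun q => if hq : ∃ x, (g x).1 = q then hq.choose.1 else d, fun q => ?_, fun x hx => ?_⟩
  · by_cases hq : ∃ x, (g x).1 = q
    · simp only [dif_pos hq]
      exact Or.inr hq.choose.2
    · simp only [dif_neg hq]
      exact Or.inl trivial
  · have hq : ∃ y, (g y).1 = (g ⟨x, hx⟩).1 := ⟨_, rfl⟩
    refine ⟨(g ⟨x, hx⟩).1, (g ⟨x, hx⟩).2, ?_⟩
    simp only [dif_pos hq]
    exact congrArg Subtype.val (g.injective (Subtype.ext hq.choose_spec))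

theorem complexity_atom_witness {S : Set (Language Letter)}
    (hS : IndexesAtom Set.univ (witness n hn) S) :
    complexity Set.univ (atomicIntersection Set.univ (witness n hn) S) =
      atomBound n S.ncard := by
  classical
  refine le_antisymm (complexity_atom_le isRegularLeftIdeal_witness complexity_witness hS) ?_
  obtain ⟨U, rfl, hU⟩ := mem_quotients_iff_of_indexesAtom hS
  rw [Set.ncard_image_of_injective _ acceptsFrom_injective]
  let z : Fin n := ⟨0, by omega⟩
  have mem_quot : ∀ {f : Fin n → Fin n}, Realizable hn f → stateCell hn (f '' U) (f '' Uᶜ) ∈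
      quotients Set.univ (atomicIntersection Set.univ (witness n hn)
        ((witnessDFA n hn).acceptsFrom '' U)) := by
    rintro f ⟨w, -, hw⟩
    exact ⟨w, mem_words_univ w, (atomicIntersection_witness_leftQuotient hw U).symm⟩
  rcases hU with hU | rfl
  swap
  · rw [Set.ncard_univ, Nat.card_eq_fintype_card, Fintype.card_fin, atomBound, if_pos rfl]
    have := natCard_le_complexity (A := Set.univ) (L := atomicIntersection Set.univ (witness n hn)
        ((witnessDFA n hn).acceptsFrom '' Set.univ)) (acceptsFrom_injective (hn := hn)) ?_
    · rwa [Nat.card_eq_fintype_card, Fintype.card_fin] at this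
    · intro q
      convert mem_quot (realizable_const q) using 1
      ext w
      change _ ↔ (_ ∧ _)
      simp only [Set.image_univ, Set.compl_univ, Set.image_empty, Set.mem_empty_iff_false,
        false_imp_iff, implies_true, and_true]
      exact ⟨fun h p ⟨_, hp⟩ => hp ▸ h, fun h => h q ⟨q, rfl⟩⟩
  have hzU : z ∉ U := fun h => hU z h rfl
  have hne : U.ncard ≠ n := by
    intro h
    have : U = Set.univ := Set.eq_of_subset_of_ncard_le (Set.subset_univ U) (by
      rw [h, Set.ncard_univ, Nat.card_eq_fintype_card, Fintype.card_fin])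
    exact hzU (this ▸ Set.mem_univ z)
  rw [atomBound, if_neg hne]
  have hz : ∀ q : Fin n, q.val = 0 → q = z := fun q hq => Fin.ext hq
  rcases U.eq_empty_or_nonempty with rfl | hUne
  · rw [Set.ncard_empty, if_pos rfl]
    let R : Type := {q : Fin n // q ≠ z}
    have hR : Nat.card R = n - 1 := by
      rw [Nat.card_eq_fintype_card, Fintype.card_subtype_compl, Fintype.card_subtype_eq,
        Fintype.card_fin]
    let F : Set R → Language Letter := fun V => stateCell hn ∅ (insert z (Subtype.val '' V))
    have hF : Function.Injective F := by
      intro V V' h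
      have h1 := (stateCell_ext h (Set.empty_disjoint _) (Set.empty_disjoint _)
        fun q hq => ⟨Or.inl (hz q hq), Or.inl (hz q hq)⟩).2
      have hzV : ∀ V : Set R, z ∉ Subtype.val '' V := by
        rintro V ⟨r, -, hr⟩
        exact r.2 hr
      have h2 : Subtype.val '' V = Subtype.val '' V' := by
        rw [← Set.insert_sdiff_self_of_notMem (hzV V), h1, Set.insert_sdiff_self_of_notMem (hzV V')]
      exact Set.image_injective.2 Subtype.val_injective h2
    have := natCard_le_complexity (A := Set.univ) (L := atomicIntersection Set.univ (witness n hn)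
        ((witnessDFA n hn).acceptsFrom '' ∅)) hF ?_
    · rwa [natCard_set, hR] at this
    · intro V
      have := mem_quot (f := fun q => if q ∈ Subtype.val '' V then q else z)
        (realizable_of_fix_zero fun q hq => by rw [hz q hq]; simp)
      convert this using 1
      simp only [F]
      congr 1
      · rw [Set.image_empty]
      · ext q
        rw [Set.compl_empty, Set.image_univ]
        constructor
        · rintro (rfl | hq)
          · exact ⟨z, by simp⟩
          · exact ⟨q, if_pos hq⟩
        · rintro ⟨p, rfl⟩
          dsimp only
          split_ifs with hp
          · exact Or.inr hp
          · exact Or.inl rfl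
  · have hUpos := (Set.ncard_pos (Set.toFinite U)).2 hUne
    rw [if_neg hUpos.ne']
    set s := U.ncard with hs
    set P : Finset (Fin n) := Finset.univ.erase z with hP
    have hPc : P.card = n - 1 := by
      rw [hP, Finset.card_erase_of_mem (Finset.mem_univ _), Finset.card_univ, Fintype.card_fin]
    have hcard := card_splitPairs P s (n - s)
    rw [hPc] at hcard
    simp only [Nat.sub_right_comm n _ 1]
    rw [← hcard]
    have hzP : ∀ Z ⊆ P, z ∉ Z := fun Z hZ h => by simpa [hP] using hZ h
    let F : Option (splitPairs P s (n - s)) → Language Letter := fun o =>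
      o.elim 0 fun c => stateCell hn (c.1.2.1 : Set (Fin n)) (insert z (c.1.2.2.2 : Set (Fin n)))
    -- the atoms given by codes are nonempty
    have hdisj : ∀ {x y X Z}, (⟨x, X, y, Z⟩ : Σ _ : ℕ, Σ _ : Finset (Fin n), Σ _ : ℕ,
        Finset (Fin n)) ∈ splitPairs P s (n - s) →
        Disjoint (X : Set (Fin n)) (insert z (Z : Set (Fin n))) := by
      intro x y X Z h
      obtain ⟨⟨-, -, h1, h2, -⟩, -, -⟩ := mem_splitPairs.1 h
      rw [Set.disjoint_left]
      rintro q hq (rfl | hq')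
      · exact hzP X h1 hq
      · exact (Finset.mem_sdiff.1 (h2 hq')).2 hq
    have hnonempty : ∀ c, F (some c) ≠ 0 := by
      rintro ⟨⟨x, X, y, Z⟩, hc⟩ h
      obtain ⟨⟨-, -, h1, -, -⟩, -, -⟩ := mem_splitPairs.1 hc
      have hd := Set.disjoint_left.1 (hdisj hc)
      obtain ⟨w, -, hw⟩ := exists_word_accepted_iff (hn := hn) (X : Set (Fin n))
        fun q hq hq0 => hzP X h1 (hz q hq0 ▸ hq)
      have : w ∈ F (some ⟨⟨x, X, y, Z⟩, hc⟩) :=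
        ⟨fun q hq => (hw q).2 hq, fun q hq hq' => hd ((hw q).1 hq') hq⟩
      rw [h] at this
      exact this
    have hF : Function.Injective F := by
      rintro (_ | ⟨⟨x, X, y, Z⟩, hc⟩) (_ | ⟨⟨x', X', y', Z'⟩, hc'⟩) h
      · rfl
      · exact absurd h.symm (hnonempty _)
      · exact absurd h (hnonempty _)
      · obtain ⟨h1, h2⟩ := stateCell_ext h (hdisj hc) (hdisj hc')
          fun q hq => ⟨Or.inl (hz q hq), Or.inl (hz q hq)⟩
        obtain ⟨⟨-, -, -, h3, -⟩, rfl, rfl⟩ := mem_splitPairs.1 hc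
        obtain ⟨⟨-, -, -, h4, -⟩, rfl, rfl⟩ := mem_splitPairs.1 hc'
        have h1 := Finset.coe_injective h1
        dsimp only at h1
        subst h1
        have h5 : Z = Z' := by
          have e1 := hzP Z (h3.trans Finset.sdiff_subset)
          have e2 := hzP Z' (h4.trans Finset.sdiff_subset)
          refine Finset.coe_injective ?_
          rw [← Set.insert_sdiff_self_of_notMem (Finset.mem_coe.not.2 e1)]
          dsimp only at h2
          rw [h2, Set.insert_sdiff_self_of_notMem (Finset.mem_coe.not.2 e2)]
        subst h5
        rfl
    have := natCard_le_complexity (A := Set.univ) (L := atomicIntersection Set.univ (witness n hn)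
        ((witnessDFA n hn).acceptsFrom '' U)) hF ?_
    · rwa [Finite.card_option, Nat.card_eq_fintype_card, Fintype.card_coe, add_comm] at this
    · rintro (_ | ⟨⟨x, X, y, Z⟩, hc⟩)
      -- A constant map sends `U` and its complement to the same state, so the cell is empty.
      · convert mem_quot (realizable_const z) using 1
        ext w
        change False ↔ (_ ∧ _)
        rw [false_iff]
        rintro ⟨h1, h2⟩
        obtain ⟨u, hu⟩ := hUne
        exact h2 z ⟨z, hzU, rfl⟩ (h1 z ⟨u, hu, rfl⟩)
      · obtain ⟨⟨h1, h2, h3, h4, h5⟩, rfl, rfl⟩ := mem_splitPairs.1 hc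
        obtain ⟨d, hd⟩ := Finset.card_pos.1 h1
        have hUc : U.toFinset.card = s := by rw [hs, Set.ncard_eq_toFinset_card']
        obtain ⟨f₁, hf₁, hf₁'⟩ := exists_surjOn_of_card_le (X := X) (U := U.toFinset)
          (by rw [hUc]; exact h2) d
        have hUc' : ((Finset.univ \ U.toFinset).erase z).card = n - s - 1 := by
          rw [Finset.card_erase_of_mem (by simpa using hzU), Finset.card_sdiff_of_subset
            (Finset.subset_univ _), hUc, Finset.card_univ, Fintype.card_fin]
        obtain ⟨f₂, hf₂, hf₂'⟩ := exists_surjOn_of_card_le (X := Z)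
          (U := (Finset.univ \ U.toFinset).erase z) (by rw [hUc']; omega) z
        -- This map takes `U` onto `X`, padded with `d ∈ X`, and the complement of `U` onto `insert
        -- z Z`. As `z` itself is fixed, `n - s - 1` states remain to cover `Z`.
        have := mem_quot (f := fun q => if q ∈ U then f₁ q else if q = z then z else f₂ q)
          (realizable_of_fix_zero fun q hq => by rw [hz q hq]; simp [hzU])
        convert this using 1
        simp only [F, Option.elim]
        congr 1
        · ext q
          constructor
          · intro hq
            obtain ⟨p, hp, rfl⟩ := hf₁' q hq
            have hp : p ∈ U := by simpa using hp
            exact ⟨p, hp, if_pos hp⟩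
          · rintro ⟨p, hp, rfl⟩
            simp only [if_pos hp]
            rcases hf₁ p with h | h
            · rw [h]
              exact hd
            · exact h
        · ext q
          constructor
          · rintro (rfl | hq)
            · exact ⟨z, hzU, by simp [hzU]⟩
            · obtain ⟨p, hp, rfl⟩ := hf₂' q hq
              have hp : p ≠ z ∧ p ∉ U := by simpa using hp
              exact ⟨p, hp.2, by simp [hp.1, hp.2]⟩
          · rintro ⟨p, hp, rfl⟩
            simp only [if_neg hp]
            split_ifs with hpz
            · exact Or.inl rfl
            · exact hf₂ p

end Witness

/-! ### The restricted product of witnesses -/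

section RestrictedProduct

/-- If `K * L = L`, every word of `L` has a strictly shorter suffix in `L`, an infinite descent in
length. -/
theorem ne_of_nil_notMem_mul {α : Type*} {K L : Language α} (h : [] ∉ K) (hL : L ≠ 0) :
    K * L ≠ L := by
  intro hKL
  have key : ∀ k, ∀ v ∈ L, v.length = k → False := by
    intro k
    induction k using Nat.strong_induction_on with
    | _ k ih =>
      intro v hv hk
      rw [← hKL] at hv
      obtain ⟨u, hu, v', hv', rfl⟩ := hv
      have hu0 : u ≠ [] := fun h' => h (h' ▸ hu)
      have := List.length_pos_iff.2 hu0
      refine ih v'.length ?_ v' hv' rfl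
      simp only [List.length_append] at hk
      omega
  refine hL (Language.ext fun x => ?_)
  simp only [Language.notMem_zero, iff_false]
  exact fun hx => key _ x hx rfl

variable {m n : ℕ} {hm : 4 ≤ m} {hn : 4 ≤ n}

theorem witness_ne_zero : witness n hn ≠ 0 :=
  ne_zero_of_complexity complexity_witness (by omega)

theorem nil_mem_acceptsFrom {q : Fin n} : [] ∈ (witnessDFA n hn).acceptsFrom q ↔ q.val = n - 1 := by
  rw [mem_witnessDFA_acceptsFrom, DFA.evalFrom_nil]

theorem acceptsFrom_mul_leftQuotient_singleton {p : Fin m} (hp : p.val ≠ m - 1)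
    (L : Language Letter) (x : Letter) :
    ((witnessDFA m hm).acceptsFrom p * L).leftQuotient [x] =
      (witnessDFA m hm).acceptsFrom (witnessStep m hm p x) * L := by
  have : (witnessDFA m hm).acceptsFrom (witnessStep m hm p x) =
      ((witnessDFA m hm).acceptsFrom p).leftQuotient [x] :=
    (acceptsFrom_leftQuotient (witnessDFA m hm) p [x]).symm
  rw [this]
  ext v
  rw [mem_mul_leftQuotient_singleton, nil_mem_acceptsFrom]
  simp [hp]

theorem acceptsFrom_last_mul {p : Fin m} (hp : p.val = m - 1) :
    (witnessDFA m hm).acceptsFrom p * witness n hn = witness n hn :=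
  le_antisymm (isRegularLeftIdeal_witness.mul_le fun w _ => mem_words_univ w)
    fun x hx => ⟨[], nil_mem_acceptsFrom.2 hp, x, hx, rfl⟩

theorem acceptsFrom_mul_ne {p : Fin m} (hp : p.val ≠ m - 1) (q : Fin n) :
    (witnessDFA m hm).acceptsFrom p * witness n hn ≠ (witnessDFA n hn).acceptsFrom q := by
  intro h
  refine ne_of_nil_notMem_mul (K := (witnessDFA m hm).acceptsFrom p)
    (fun h' => hp (nil_mem_acceptsFrom.1 h')) (witness_ne_zero (hn := hn)) ?_
  refine le_antisymm (isRegularLeftIdeal_witness.mul_le fun w _ => mem_words_univ w) ?_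
  rw [h]
  refine isRegularLeftIdeal_witness.le_of_mem_quotients ?_
  rw [quotients_witness]
  exact ⟨q, rfl⟩

/-- Reading `a` keeps `p` ahead of `q` until `p` reaches the last state. There its product collapses
to the second factor, whereas that of `q`, whose language still lacks the empty word, does not. -/
theorem acceptsFrom_mul_injective {p q : Fin m} (hqp : q < p) (hp : p.val ≠ m - 1) :
    (witnessDFA m hm).acceptsFrom q * witness n hn ≠
      (witnessDFA m hm).acceptsFrom p * witness n hn := by
  obtain ⟨k, hk⟩ : ∃ k, p.val + k + 2 = m := ⟨m - 2 - p.val, by have := p.2; omega⟩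
  intro h
  have hqp' : q.val < p.val := hqp
  have h1 := congrArg (fun L => L.leftQuotient [Letter.a]) h
  rw [acceptsFrom_mul_leftQuotient_singleton (by omega),
    acceptsFrom_mul_leftQuotient_singleton hp] at h1
  induction k generalizing p q with
  | zero =>
    rw [acceptsFrom_last_mul (p := witnessStep m hm p Letter.a)
      (by rw [val_step_a]; split_ifs <;> omega)] at h1
    exact acceptsFrom_mul_ne (by rw [val_step_a]; split_ifs <;> omega) _ h1
  | succ k ih =>
    have e1 : (witnessStep m hm p Letter.a).val = p.val + 1 := by
      rw [val_step_a]; split_ifs <;> omega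
    have e2 : (witnessStep m hm q Letter.a).val < p.val + 1 := by
      rw [val_step_a]; split_ifs <;> omega
    have h2 := congrArg (fun L => L.leftQuotient [Letter.a]) h1
    rw [acceptsFrom_mul_leftQuotient_singleton (by omega),
      acceptsFrom_mul_leftQuotient_singleton (by omega)] at h2
    exact ih (p := witnessStep m hm p Letter.a) (q := witnessStep m hm q Letter.a)
      (Fin.lt_def.2 (by omega)) (by omega) (by omega) h1 (by omega) h2

theorem acceptsFrom_mul_mem_quotients (p : Fin m) :
    (witnessDFA m hm).acceptsFrom p * witness n hn ∈
      quotients Set.univ (witness m hm * witness n hn) := by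
  obtain ⟨k, hk⟩ : ∃ k, p.val = k := ⟨_, rfl⟩
  induction k generalizing p with
  | zero =>
    have : p = (witnessDFA m hm).start := Fin.ext hk
    rw [this]
    exact self_mem_quotients
  | succ k ih =>
    have hp := p.2
    have h1 := leftQuotient_mem_quotients (ih ⟨k, by omega⟩ rfl)
      (mem_words_univ [if k = 0 then Letter.e else Letter.a])
    rw [acceptsFrom_mul_leftQuotient_singleton (by simp only; omega)] at h1
    convert h1
    ext
    split_ifs with hk0
    · rw [val_step_e, hk, hk0]
    · rw [val_step_a, if_neg hk0, if_pos (by simp only; omega), hk]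

theorem complexity_witness_mul_witness :
    complexity Set.univ (witness m hm * witness n hn) = (m + n - 1 : ℕ) := by
  refine le_antisymm (complexity_mul_le isRegularLeftIdeal_witness isRegularLeftIdeal_witness
    complexity_witness complexity_witness (by omega)) ?_
  let F : {p : Fin m // p ≠ ⟨m - 1, by omega⟩} ⊕ Fin n → Language Letter :=
    Sum.elim (fun p => (witnessDFA m hm).acceptsFrom p.1 * witness n hn)
      (witnessDFA n hn).acceptsFrom
  have hlast : ∀ p : {p : Fin m // p ≠ ⟨m - 1, by omega⟩}, p.1.val ≠ m - 1 := fun p h =>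
    p.2 (Fin.ext h)
  have hF : Function.Injective F := by
    rintro (p | p) (q | q) h
    · rcases lt_trichotomy p.1 q.1 with h' | h' | h'
      · exact absurd h (acceptsFrom_mul_injective h' (hlast q))
      · exact congrArg Sum.inl (Subtype.ext h')
      · exact absurd h.symm (acceptsFrom_mul_injective h' (hlast p))
    · exact absurd h (acceptsFrom_mul_ne (hlast p) q)
    · exact absurd h.symm (acceptsFrom_mul_ne (hlast q) p)
    · exact congrArg Sum.inr (acceptsFrom_injective h)
  have := natCard_le_complexity (A := Set.univ) (L := witness m hm * witness n hn) hF ?_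
  · rw [Nat.card_sum, Nat.card_eq_fintype_card, Nat.card_eq_fintype_card,
      Fintype.card_subtype_compl, Fintype.card_subtype_eq, Fintype.card_fin,
      Fintype.card_fin] at this
    rwa [show m + n - 1 = m - 1 + n by omega]
  · rintro (p | q)
    · exact acceptsFrom_mul_mem_quotients p.1
    · have h1 := acceptsFrom_mul_mem_quotients (hm := hm) (hn := hn) ⟨m - 1, by omega⟩
      rw [acceptsFrom_last_mul rfl] at h1
      refine quotients_subset_of_mem h1 ?_
      rw [quotients_witness]
      exact ⟨q, rfl⟩

end RestrictedProduct

/-! ### Automata for dialects -/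

section Dialect

/-- The automaton that acts by the letter `τ y` of the witness on reading `y`, and by moving to the
sink `none` if `τ y` is undefined. -/
def partialDFA (n : ℕ) (hn : 4 ≤ n) (τ : Letter → Option Letter) : DFA Letter (Option (Fin n)) where
  step o y := o.bind fun q => (τ y).map (witnessStep n hn q)
  start := some ⟨0, by omega⟩
  accept := {some ⟨n - 1, by omega⟩}

variable {n : ℕ} {hn : 4 ≤ n} {π τ : Letter → Option Letter}

theorem partialDFA_step_none (y : Letter) : (partialDFA n hn τ).step none y = none := rfl

theorem partialDFA_step_some {y x : Letter} (h : τ y = some x) (q : Fin n) :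
    (partialDFA n hn τ).step (some q) y = some (witnessStep n hn q x) := by
  simp [partialDFA, h]

theorem partialDFA_step_of_eq_none {y : Letter} (h : τ y = none) (o : Option (Fin n)) :
    (partialDFA n hn τ).step o y = none := by
  cases o <;> simp [partialDFA, h]

theorem partialDFA_evalFrom_none (w : List Letter) :
    (partialDFA n hn τ).evalFrom none w = none := by
  induction w with
  | nil => rfl
  | cons y w ih => rwa [DFA.evalFrom_cons, partialDFA_step_none]

theorem mem_partialDFA_acceptsFrom {o : Option (Fin n)} {w : List Letter} :
    w ∈ (partialDFA n hn τ).acceptsFrom o ↔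
      (partialDFA n hn τ).evalFrom o w = some ⟨n - 1, by omega⟩ := Iff.rfl

theorem partialDFA_acceptsFrom_none : (partialDFA n hn τ).acceptsFrom none = 0 := by
  ext w
  simp [mem_partialDFA_acceptsFrom, partialDFA_evalFrom_none, Language.notMem_zero]

theorem partialDFA_evalFrom_replicate {y x : Letter} (h : τ y = some x) (q : Fin n) (k : ℕ) :
    (partialDFA n hn τ).evalFrom (some q) (List.replicate k y) =
      some ((fun q => witnessStep n hn q x)^[k] q) := by
  induction k generalizing q with
  | zero => rfl
  | succ k ih =>
    rw [List.replicate_succ, DFA.evalFrom_cons, partialDFA_step_some h, ih,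
      Function.iterate_succ_apply]

theorem mem_words_dialectAlphabet {v : List Letter} :
    v ∈ words (dialectAlphabet π) ↔ ∃ w : List Letter, w.map π = v.map some := by
  induction v with
  | nil => exact ⟨fun _ => ⟨[], rfl⟩, fun _ => nil_mem_words⟩
  | cons y v ih =>
    rw [cons_mem_words, ih]
    constructor
    · rintro ⟨⟨x, hx⟩, w, hw⟩
      exact ⟨x :: w, by simp [hx, hw]⟩
    · rintro ⟨w, hw⟩
      rcases w with _ | ⟨x, w⟩
      · simp at hw
      · simp only [List.map_cons, List.cons.injEq] at hw
        exact ⟨⟨x, hw.1⟩, w, hw.2⟩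

theorem partialDFA_evalFrom_of_map_eq (hπ : ∀ x y, π x = some y ↔ τ y = some x)
    {v w : List Letter} (h : w.map π = v.map some) (q : Fin n) :
    (partialDFA n hn τ).evalFrom (some q) v = some ((witnessDFA n hn).evalFrom q w) := by
  induction v generalizing w q with
  | nil =>
    obtain rfl : w = [] := by simpa using h
    rfl
  | cons y v ih =>
    rcases w with _ | ⟨x, w⟩
    · simp at h
    · simp only [List.map_cons, List.cons.injEq] at h
      rw [DFA.evalFrom_cons, partialDFA_step_some ((hπ x y).1 h.1), ih h.2]
      rfl

theorem partialDFA_evalFrom_of_notMem_words (hπ : ∀ x y, π x = some y ↔ τ y = some x)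
    {v : List Letter} (h : v ∉ words (dialectAlphabet π)) (o : Option (Fin n)) :
    (partialDFA n hn τ).evalFrom o v = none := by
  induction v generalizing o with
  | nil => exact absurd nil_mem_words h
  | cons y v ih =>
    rw [DFA.evalFrom_cons]
    by_cases hy : y ∈ dialectAlphabet π
    · exact ih (fun hv => h (cons_mem_words.2 ⟨hy, hv⟩)) _
    · have : τ y = none := by
        rw [Option.eq_none_iff_forall_not_mem]
        exact fun x hx => hy ⟨x, (hπ x y).2 hx⟩
      rw [partialDFA_step_of_eq_none this, partialDFA_evalFrom_none]

/-- The hypothesis makes `τ` the partial inverse of `π`, so each letter of the dialect comes from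
exactly one original letter and the run of `D_n` can be simulated. -/
theorem dialect_witness_eq (hπ : ∀ x y, π x = some y ↔ τ y = some x) :
    dialect π (witness n hn) = (partialDFA n hn τ).accepts := by
  ext v
  constructor
  · rintro ⟨w, hw, h⟩
    change (partialDFA n hn τ).evalFrom (some ⟨0, by omega⟩) v = _
    rw [partialDFA_evalFrom_of_map_eq hπ h]
    exact congrArg some (Fin.ext (mem_witnessDFA_acceptsFrom.1 hw))
  · intro hv
    have hv : (partialDFA n hn τ).evalFrom (some ⟨0, by omega⟩) v = some ⟨n - 1, by omega⟩ := hv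
    by_cases hw : v ∈ words (dialectAlphabet π)
    · obtain ⟨w, h⟩ := mem_words_dialectAlphabet.1 hw
      rw [partialDFA_evalFrom_of_map_eq hπ h, Option.some_inj] at hv
      exact ⟨w, hv, h⟩
    · rw [partialDFA_evalFrom_of_notMem_words hπ hw] at hv
      cases hv

theorem dialect_subset_words (L : Language Letter) :
    dialect π L ≤ words (dialectAlphabet π) := by
  rintro v ⟨w, -, h⟩
  exact mem_words_dialectAlphabet.2 ⟨w, h⟩

theorem isRegularLeftIdeal_dialect (hπ : ∀ x y, π x = some y ↔ τ y = some x) :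
    IsRegularLeftIdeal (dialectAlphabet π) (dialect π (witness n hn)) := by
  refine isRegularLeftIdeal_of_append_mem (finite_set_letter _) (dialect_subset_words _)
    ⟨_, inferInstance, partialDFA n hn τ, (dialect_witness_eq hπ).symm⟩ ?_
  rintro u hu v ⟨w, hw, h⟩
  obtain ⟨u', hu'⟩ := mem_words_dialectAlphabet.1 hu
  exact ⟨u' ++ w, append_mem_witness hw, by simp [h, hu']⟩

/-- The letter `a` acts as a permutation, so a power of it taking `q` to the last state takes no
other state there. -/
theorem partialDFA_last_of_evalFrom_a {y : Letter} (hy : τ y = some Letter.a) {q : Fin n}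
    {o : Option (Fin n)} (hq : q.val ≠ 0) (ho : o ≠ some q) :
    ∃ k, (partialDFA n hn τ).evalFrom (some q) (List.replicate k y) = some ⟨n - 1, by omega⟩ ∧
      (partialDFA n hn τ).evalFrom o (List.replicate k y) ≠ some ⟨n - 1, by omega⟩ := by
  obtain ⟨k, hk⟩ := exists_iterate_step_a (hn := hn) (r := ⟨n - 1, by omega⟩) hq (by simp only; omega)
  refine ⟨k, by rw [partialDFA_evalFrom_replicate hy, hk], ?_⟩
  rcases o with _ | q'
  · simp [partialDFA_evalFrom_none]
  · rw [partialDFA_evalFrom_replicate hy, ← hk]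
    intro h
    exact ho (congrArg some ((step_a_injective.iterate k) (Option.some_inj.1 h)))

theorem partialDFA_acceptsFrom_some_injective (ha : ∃ y, τ y = some Letter.a) {p q : Fin n}
    (h : (partialDFA n hn τ).acceptsFrom (some p) = (partialDFA n hn τ).acceptsFrom (some q)) :
    p = q := by
  obtain ⟨y, hy⟩ := ha
  by_contra hpq
  wlog hq : q.val ≠ 0 generalizing p q
  · exact this h.symm (Ne.symm hpq) fun hp => hpq (Fin.ext (hp.trans (not_not.1 hq).symm))
  obtain ⟨k, h1, h2⟩ := partialDFA_last_of_evalFrom_a (hn := hn) (o := some p) hy hq (by simpa)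
  exact h2 (mem_partialDFA_acceptsFrom.1 (h ▸ mem_partialDFA_acceptsFrom.2 h1))

theorem mem_alphabet_of_role (hπ : ∀ x y, π x = some y ↔ τ y = some x) {x y : Letter}
    (h : τ y = some x) : y ∈ dialectAlphabet π := ⟨x, (hπ x y).2 h⟩

theorem exists_word_to_state (hπ : ∀ x y, π x = some y ↔ τ y = some x)
    (ha : ∃ y, τ y = some Letter.a) (he : ∃ y, τ y = some Letter.e) (q : Fin n) :
    ∃ w ∈ words (dialectAlphabet π), (partialDFA n hn τ).eval w = some q := by
  obtain ⟨y, hy⟩ := ha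
  obtain ⟨z, hz⟩ := he
  by_cases hq : q.val = 0
  · exact ⟨[], nil_mem_words, congrArg some (Fin.ext hq.symm)⟩
  · obtain ⟨k, hk⟩ := exists_iterate_step_a (hn := hn) (q := ⟨1, by omega⟩) (by simp) hq
    refine ⟨z :: List.replicate k y, ?_, ?_⟩
    · intro t ht
      rcases List.mem_cons.1 ht with rfl | ht
      · exact mem_alphabet_of_role hπ hz
      · exact List.eq_of_mem_replicate ht ▸ mem_alphabet_of_role hπ hy
    · rw [DFA.eval, DFA.evalFrom_cons]
      change (partialDFA n hn τ).evalFrom ((partialDFA n hn τ).step (some _) z) _ = _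
      rw [partialDFA_step_some hz, partialDFA_evalFrom_replicate hy]
      exact congrArg some hk

theorem acceptsFrom_mem_quotients_dialect (hπ : ∀ x y, π x = some y ↔ τ y = some x)
    (ha : ∃ y, τ y = some Letter.a) (he : ∃ y, τ y = some Letter.e) (q : Fin n) :
    (partialDFA n hn τ).acceptsFrom (some q) ∈
      quotients (dialectAlphabet π) (dialect π (witness n hn)) := by
  obtain ⟨w, hw, h⟩ := exists_word_to_state (hn := hn) hπ ha he q
  exact ⟨w, hw, by rw [dialect_witness_eq hπ, Language.leftQuotient_accepts_apply, h]⟩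

theorem complexity_dialect (hπ : ∀ x y, π x = some y ↔ τ y = some x)
    (ha : ∃ y, τ y = some Letter.a) (he : ∃ y, τ y = some Letter.e) :
    complexity (dialectAlphabet π) (dialect π (witness n hn)) = n := by
  have hinj : Function.Injective fun q : Fin n => (partialDFA n hn τ).acceptsFrom (some q) :=
    fun p q h => partialDFA_acceptsFrom_some_injective ha h
  refine le_antisymm ?_ ?_
  · refine (complexity_le_encard
      (T := (fun q : Fin n => (partialDFA n hn τ).acceptsFrom (some q)) '' Set.univ) ?_).trans ?_
    · intro v hv
      obtain ⟨w, h⟩ := mem_words_dialectAlphabet.1 hv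
      refine ⟨(witnessDFA n hn).eval w, Set.mem_univ _, ?_⟩
      rw [dialect_witness_eq hπ, Language.leftQuotient_accepts_apply, DFA.eval]
      exact congrArg _ (partialDFA_evalFrom_of_map_eq hπ h _).symm
    · rw [hinj.encard_image, Set.encard_univ]
      simp
  · have := natCard_le_complexity hinj
      (fun q => acceptsFrom_mem_quotients_dialect (hn := hn) hπ ha he q)
    rwa [Nat.card_eq_fintype_card, Fintype.card_fin] at this

end Dialect

/-! ### Steering and separating two automata at once -/

section Boolean

variable {m n : ℕ} {hm : 4 ≤ m} {hn : 4 ≤ n} {σ τ : Letter → Option Letter} {l x y : Letter}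

/-- The letter `l` acts as `a` in both automata, while `x` and `y` act as `e` in one of them and as
`b` in the other. -/
structure ActCrosswise (σ τ : Letter → Option Letter) (l x y : Letter) : Prop where
  left_l : σ l = some Letter.a
  right_l : τ l = some Letter.a
  left_x : σ x = some Letter.e
  right_x : τ x = some Letter.b
  left_y : σ y = some Letter.b
  right_y : τ y = some Letter.e

theorem ActCrosswise.symm (h : ActCrosswise σ τ l x y) : ActCrosswise τ σ l y x :=
  ⟨h.right_l, h.left_l, h.right_y, h.left_y, h.right_x, h.left_x⟩

theorem replicate_mem_words {α : Type*} {A : Set α} {x : α} (h : x ∈ A) (k : ℕ) :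
    List.replicate k x ∈ words A :=
  fun _ ht => List.eq_of_mem_replicate ht ▸ h

theorem val_step_b_ne_zero {q : Fin n} (hq : q.val ≠ 0) :
    (witnessStep n hn q Letter.b).val ≠ 0 := by
  rw [val_step_b]
  split_ifs <;> omega

theorem step_b_zero {z : Fin n} (hz : z.val = 0) : witnessStep n hn z Letter.b = z := by
  ext
  simp [val_step_b, hz]

theorem exists_preimage_iterate_step_a {r : Fin n} (hr : r.val ≠ 0) (k : ℕ) :
    ∃ q : Fin n, q.val ≠ 0 ∧ (fun q => witnessStep n hn q Letter.a)^[k] q = r := by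
  obtain ⟨q, hq⟩ := (Finite.injective_iff_surjective.1 ((step_a_injective (hn := hn)).iterate k)) r
  exact ⟨q, fun h => hr (by rw [← hq, iterate_step_a_zero h, h]), hq⟩

/-- The letter `x` puts the first automaton into state `1`, and `l` rotates it to `p`; the second
automaton sees only `b` and `a`, which fix `0`. -/
theorem ActCrosswise.exists_word_to_left (h : ActCrosswise σ τ l x y) {p : Fin m}
    (hp : p.val ≠ 0) : ∃ w ∈ words {l, x, y},
      (partialDFA m hm σ).eval w = some p ∧
      (partialDFA n hn τ).eval w = some ⟨0, by omega⟩ := by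
  obtain ⟨k, hk⟩ := exists_iterate_step_a (hn := hm) (q := ⟨1, by omega⟩) (by simp) hp
  refine ⟨x :: List.replicate k l, cons_mem_words.2 ⟨by simp, replicate_mem_words (by simp) k⟩,
    ?_, ?_⟩
  · change (partialDFA m hm σ).evalFrom ((partialDFA m hm σ).step (some _) x) _ = _
    rw [partialDFA_step_some h.left_x, partialDFA_evalFrom_replicate h.left_l]
    exact congrArg some hk
  · change (partialDFA n hn τ).evalFrom ((partialDFA n hn τ).step (some _) x) _ = _
    rw [partialDFA_step_some h.right_x, partialDFA_evalFrom_replicate h.right_l,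
      step_b_zero rfl, iterate_step_a_zero rfl]

theorem ActCrosswise.exists_word_to_pair (h : ActCrosswise σ τ l x y) (p : Fin m) (q : Fin n) :
    ∃ w ∈ words {l, x, y},
      (partialDFA m hm σ).eval w = some p ∧ (partialDFA n hn τ).eval w = some q := by
  by_cases hq : q.val = 0
  · by_cases hp : p.val = 0
    · exact ⟨[], nil_mem_words, congrArg some (Fin.ext hp.symm), congrArg some (Fin.ext hq.symm)⟩
    · obtain ⟨w, hw, h1, h2⟩ := h.exists_word_to_left (hm := hm) (hn := hn) hp
      exact ⟨w, hw, h1, h2.trans (congrArg some (Fin.ext hq.symm))⟩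
  · by_cases hp : p.val = 0
    · obtain ⟨w, hw, h1, h2⟩ := h.symm.exists_word_to_left (hm := hn) (hn := hm) hq
      refine ⟨w, ?_, h2.trans (congrArg some (Fin.ext hp.symm)), h1⟩
      rwa [Set.pair_comm x y]
    -- The letter `y` puts the second automaton into `1`, from where `q - 1` rotations reach `q`.
    -- These rotate `p₀` into `p`, and since `y` acts as the involution `b` on the left, the first
    -- automaton has to be in `b p₀` beforehand.
    · obtain ⟨p₀, hp₀, hp₀'⟩ := exists_preimage_iterate_step_a (hn := hm) hp (q.val - 1)
      obtain ⟨w, hw, h1, h2⟩ := h.exists_word_to_left (hm := hm) (hn := hn)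
        (p := witnessStep m hm p₀ Letter.b) (val_step_b_ne_zero hp₀)
      refine ⟨w ++ y :: List.replicate (q.val - 1) l, append_mem_words.2 ⟨hw,
        cons_mem_words.2 ⟨by simp, replicate_mem_words (by simp) _⟩⟩, ?_, ?_⟩
      · rw [DFA.eval, DFA.evalFrom_of_append, ← DFA.eval, h1, DFA.evalFrom_cons,
          partialDFA_step_some h.left_y, partialDFA_evalFrom_replicate h.left_l, step_b_step_b,
          hp₀']
      · rw [DFA.eval, DFA.evalFrom_of_append, ← DFA.eval, h2, DFA.evalFrom_cons,
          partialDFA_step_some h.right_y, partialDFA_evalFrom_replicate h.right_l]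
        congr 1
        have := q.2
        ext
        rw [val_iterate_step_a (by rw [val_step_e]; simp) _ (by rw [val_step_e]; omega),
          val_step_e]
        omega

/-- The word is `l ^ i y l ^ j`. As `y` resets the second automaton, acceptance there depends only
on `j`. On the first automaton the word acts as a permutation, so `i` can be chosen to bring `p`,
and no other state, to the last one. -/
theorem ActCrosswise.exists_separating_word_of_ne_zero (h : ActCrosswise σ τ l x y) {p : Fin m}
    {o : Option (Fin m)} (hp : p.val ≠ 0) (ho : o ≠ some p) (b : Bool) :
    ∃ w ∈ words {l, x, y}, w ∈ (partialDFA m hm σ).acceptsFrom (some p) ∧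
      w ∉ (partialDFA m hm σ).acceptsFrom o ∧
      ∀ q, w ∈ (partialDFA n hn τ).acceptsFrom (some q) ↔ b = true := by
  -- From `1`, the choice `j = 1` leads to `2`, which is not final as `4 ≤ n`, and `j = n - 2` leads
  -- to the final state.
  obtain ⟨j, hj, hjb⟩ : ∃ j, 1 + j < n ∧ (1 + j = n - 1 ↔ b = true) := by
    cases b
    · exact ⟨1, by omega, by simp; omega⟩
    · exact ⟨n - 2, by omega, by simp; omega⟩
  obtain ⟨p₂, hp₂, hp₂'⟩ := exists_preimage_iterate_step_a (hn := hm)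
    (r := ⟨m - 1, by omega⟩) (by simp only; omega) j
  obtain ⟨i, hi⟩ := exists_iterate_step_a (hn := hm) hp (val_step_b_ne_zero (hn := hm) hp₂)
  refine ⟨List.replicate i l ++ y :: List.replicate j l, append_mem_words.2
    ⟨replicate_mem_words (by simp) _, cons_mem_words.2 ⟨by simp, replicate_mem_words (by simp) _⟩⟩,
    ?_, ?_, ?_⟩
  · rw [mem_partialDFA_acceptsFrom, DFA.evalFrom_of_append,
      partialDFA_evalFrom_replicate h.left_l, DFA.evalFrom_cons, partialDFA_step_some h.left_y,
      partialDFA_evalFrom_replicate h.left_l, hi, step_b_step_b, hp₂']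
  · rcases o with _ | p'
    · simp [partialDFA_acceptsFrom_none, Language.notMem_zero]
    · rw [mem_partialDFA_acceptsFrom, DFA.evalFrom_of_append,
        partialDFA_evalFrom_replicate h.left_l, DFA.evalFrom_cons, partialDFA_step_some h.left_y,
        partialDFA_evalFrom_replicate h.left_l, ← hp₂', Option.some_inj]
      intro h'
      have h1 := (step_a_injective (hn := hm)).iterate j h'
      rw [← step_b_step_b (hn := hm) p₂, ← hi] at h1
      have h2 := (step_a_injective (hn := hm)).iterate i (step_b_injective (hn := hm) h1)
      exact ho (congrArg some h2)
  · intro q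
    rw [mem_partialDFA_acceptsFrom, DFA.evalFrom_of_append,
      partialDFA_evalFrom_replicate h.right_l, DFA.evalFrom_cons, partialDFA_step_some h.right_y,
      partialDFA_evalFrom_replicate h.right_l, Option.some_inj, ← hjb, Fin.ext_iff,
      val_iterate_step_a (by rw [val_step_e]; simp) _ (by rw [val_step_e]; omega), val_step_e]

/-- Two states of the first automaton are separated by a word whose acceptance by the second
automaton may be prescribed. -/
theorem ActCrosswise.exists_separating_word (h : ActCrosswise σ τ l x y) {o o' : Option (Fin m)}
    (hne : o ≠ o') (b : Bool) :
    ∃ w ∈ words {l, x, y}, (w ∈ (partialDFA m hm σ).acceptsFrom o ↔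
      w ∉ (partialDFA m hm σ).acceptsFrom o') ∧
      ∀ q, w ∈ (partialDFA n hn τ).acceptsFrom (some q) ↔ b = true := by
  wlog ho : o ≠ none generalizing o o'
  · obtain ⟨w, hw, h1, h2⟩ := this hne.symm fun h' => hne (h'.trans (not_not.1 ho).symm).symm
    exact ⟨w, hw, by tauto, h2⟩
  obtain ⟨p, rfl⟩ := Option.ne_none_iff_exists'.1 ho
  by_cases hp : p.val = 0
  · rcases o' with _ | p'
    -- To separate `0` from the sink, `x` is read first: it moves `0` to the nonzero state `1`.
    · obtain ⟨w, hw, h1, h2, h3⟩ := h.exists_separating_word_of_ne_zero (hm := hm) (hn := hn)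
        (p := witnessStep m hm p Letter.e) (o := none) (by rw [val_step_e]; simp) (by simp) b
      refine ⟨x :: w, cons_mem_words.2 ⟨by simp, hw⟩, ?_, fun q => ?_⟩
      · rw [mem_partialDFA_acceptsFrom, mem_partialDFA_acceptsFrom, DFA.evalFrom_cons,
          DFA.evalFrom_cons, partialDFA_step_some h.left_x, partialDFA_step_none]
        exact ⟨fun _ => h2, fun _ => h1⟩
      · rw [mem_partialDFA_acceptsFrom, DFA.evalFrom_cons, partialDFA_step_some h.right_x]
        exact h3 _
    · have hp' : p'.val ≠ 0 := fun h' => hne (congrArg some (Fin.ext (hp.trans h'.symm)))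
      obtain ⟨w, hw, h1, h2, h3⟩ := h.exists_separating_word_of_ne_zero (hm := hm) (hn := hn)
        hp' hne b
      exact ⟨w, hw, by tauto, h3⟩
  · obtain ⟨w, hw, h1, h2, h3⟩ := h.exists_separating_word_of_ne_zero (hm := hm) (hn := hn)
      hp hne.symm b
    exact ⟨w, hw, by tauto, h3⟩

theorem notMem_acceptsFrom_none (w : List Letter) :
    w ∉ (partialDFA n hn τ).acceptsFrom none := by
  rw [partialDFA_acceptsFrom_none]
  exact Language.notMem_zero w

theorem ActCrosswise.exists_separating_word_rejected (h : ActCrosswise σ τ l x y)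
    {o o' : Option (Fin m)} (hne : o ≠ o') :
    ∃ w ∈ words {l, x, y}, (w ∈ (partialDFA m hm σ).acceptsFrom o ↔
      w ∉ (partialDFA m hm σ).acceptsFrom o') ∧ ∀ q, w ∉ (partialDFA n hn τ).acceptsFrom q := by
  obtain ⟨w, hw, h1, h2⟩ := h.exists_separating_word (hm := hm) (hn := hn) hne false
  refine ⟨w, hw, h1, fun q => ?_⟩
  rcases q with _ | q
  · exact notMem_acceptsFrom_none w
  · simpa using h2 q

/-- Differing components are separated by a word whose acceptance by the other automaton has a truth
value at which `f` depends on the component in question. -/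
theorem ActCrosswise.boolOp_injective (h : ActCrosswise σ τ l x y) {A : Set Letter}
    (hA : {l, x, y} ⊆ A) {f : Bool → Bool → Bool} (hf : IsProper f) :
    Function.Injective fun s : Fin m × Fin n =>
      boolOp f A ((partialDFA m hm σ).acceptsFrom (some s.1))
        ((partialDFA n hn τ).acceptsFrom (some s.2)) := by
  classical
  have mem : ∀ {w}, w ∈ words A → ∀ K L : Language Letter,
      (w ∈ boolOp f A K L ↔ f (decide (w ∈ K)) (decide (w ∈ L)) = true) := by
    intro w hw K L
    change (_ ∧ _) ↔ _
    rw [and_iff_right hw]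
  rintro ⟨p, q⟩ ⟨p', q'⟩ hpq
  by_contra hne
  by_cases hp : p = p'
  · have hq : q ≠ q' := fun hq => hne (Prod.ext hp hq)
    obtain ⟨b, hb⟩ := hf.2
    obtain ⟨w, hw, h1, h2⟩ := h.symm.exists_separating_word (hm := hn) (hn := hm)
      (o := some q) (o' := some q') (by simpa using hq) b
    rw [Set.pair_comm y x] at hw
    have hw := words_mono hA hw
    have h3 := (mem hw _ _).symm.trans ((Set.ext_iff.1 hpq w).trans (mem hw _ _))
    simp only [h2, Bool.decide_eq_true] at h3
    by_cases hwq : w ∈ (partialDFA n hn τ).acceptsFrom (some q)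
    · simp only [hwq, h1.1 hwq, decide_true, decide_false] at h3
      exact hb (Bool.eq_iff_iff.2 h3.symm)
    · have := not_not.1 (mt h1.2 hwq)
      simp only [hwq, this, decide_true, decide_false] at h3
      exact hb (Bool.eq_iff_iff.2 h3)
  · obtain ⟨b, hb⟩ := hf.1
    obtain ⟨w, hw, h1, h2⟩ := h.exists_separating_word (hm := hm) (hn := hn)
      (o := some p) (o' := some p') (by simpa using hp) b
    have hw := words_mono hA hw
    have h3 := (mem hw _ _).symm.trans ((Set.ext_iff.1 hpq w).trans (mem hw _ _))
    simp only [h2, Bool.decide_eq_true] at h3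
    by_cases hwq : w ∈ (partialDFA m hm σ).acceptsFrom (some p)
    · simp only [hwq, h1.1 hwq, decide_true, decide_false] at h3
      exact hb (Bool.eq_iff_iff.2 h3.symm)
    · have := not_not.1 (mt h1.2 hwq)
      simp only [hwq, this, decide_true, decide_false] at h3
      exact hb (Bool.eq_iff_iff.2 h3)

theorem ActCrosswise.sup_injective (h : ActCrosswise σ τ l x y) :
    Function.Injective fun s : Option (Fin m) × Option (Fin n) =>
      (partialDFA m hm σ).acceptsFrom s.1 ⊔ (partialDFA n hn τ).acceptsFrom s.2 := by
  rintro ⟨p, q⟩ ⟨p', q'⟩ hpq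
  have mem : ∀ w, w ∈ (partialDFA m hm σ).acceptsFrom p ∨ w ∈ (partialDFA n hn τ).acceptsFrom q ↔
      w ∈ (partialDFA m hm σ).acceptsFrom p' ∨ w ∈ (partialDFA n hn τ).acceptsFrom q' :=
    fun w => Set.ext_iff.1 hpq w
  refine Prod.ext (by_contra fun hp => ?_) (by_contra fun hq => ?_)
  · obtain ⟨w, -, h1, h2⟩ := h.exists_separating_word_rejected (hm := hm) (hn := hn) hp
    have := mem w
    simp only [h2, or_false] at this
    tauto
  · obtain ⟨w, -, h1, h2⟩ := h.symm.exists_separating_word_rejected (hm := hn) (hn := hm) hq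
    have := mem w
    simp only [h2, false_or] at this
    tauto

theorem ActCrosswise.symmDiff_injective (h : ActCrosswise σ τ l x y) :
    Function.Injective fun s : Option (Fin m) × Option (Fin n) =>
      symmDiff ((partialDFA m hm σ).acceptsFrom s.1) ((partialDFA n hn τ).acceptsFrom s.2) := by
  rintro ⟨p, q⟩ ⟨p', q'⟩ hpq
  have mem : ∀ w, (w ∈ (partialDFA m hm σ).acceptsFrom p ∧ w ∉ (partialDFA n hn τ).acceptsFrom q ∨
      w ∈ (partialDFA n hn τ).acceptsFrom q ∧ w ∉ (partialDFA m hm σ).acceptsFrom p) ↔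
      (w ∈ (partialDFA m hm σ).acceptsFrom p' ∧ w ∉ (partialDFA n hn τ).acceptsFrom q' ∨
      w ∈ (partialDFA n hn τ).acceptsFrom q' ∧ w ∉ (partialDFA m hm σ).acceptsFrom p') :=
    fun w => Set.ext_iff.1 hpq w
  refine Prod.ext (by_contra fun hp => ?_) (by_contra fun hq => ?_)
  · obtain ⟨w, -, h1, h2⟩ := h.exists_separating_word_rejected (hm := hm) (hn := hn) hp
    have := mem w
    simp only [h2] at this
    tauto
  · obtain ⟨w, -, h1, h2⟩ := h.symm.exists_separating_word_rejected (hm := hn) (hn := hm) hq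
    have := mem w
    simp only [h2] at this
    tauto

theorem ActCrosswise.sdiff_injective (h : ActCrosswise σ τ l x y) :
    Function.Injective fun s : Fin m × Option (Fin n) =>
      (partialDFA m hm σ).acceptsFrom (some s.1) \ (partialDFA n hn τ).acceptsFrom s.2 := by
  rintro ⟨p, q⟩ ⟨p', q'⟩ hpq
  have mem : ∀ w, (w ∈ (partialDFA m hm σ).acceptsFrom (some p) ∧
      w ∉ (partialDFA n hn τ).acceptsFrom q) ↔
      (w ∈ (partialDFA m hm σ).acceptsFrom (some p') ∧
      w ∉ (partialDFA n hn τ).acceptsFrom q') :=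
    fun w => Set.ext_iff.1 hpq w
  refine Prod.ext (by_contra fun hp => ?_) (by_contra fun hq => ?_)
  · obtain ⟨w, -, h1, h2⟩ := h.exists_separating_word_rejected (hm := hm) (hn := hn)
      (o := some p) (o' := some p') (by simpa using hp)
    have := mem w
    simp only [h2] at this
    tauto
  -- Only words of the first operand reveal the second; they are available because the first
  -- component is never the sink.
  · obtain ⟨w, -, h1, h2⟩ := h.symm.exists_separating_word (hm := hn) (hn := hm) hq true
    have := mem w
    simp only [h2] at this
    tauto

theorem ActCrosswise.inf_injective (h : ActCrosswise σ τ l x y) :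
    Function.Injective fun s : Fin m × Fin n =>
      (partialDFA m hm σ).acceptsFrom (some s.1) ⊓ (partialDFA n hn τ).acceptsFrom (some s.2) := by
  rintro ⟨p, q⟩ ⟨p', q'⟩ hpq
  have mem : ∀ w, (w ∈ (partialDFA m hm σ).acceptsFrom (some p) ∧
      w ∈ (partialDFA n hn τ).acceptsFrom (some q)) ↔
      (w ∈ (partialDFA m hm σ).acceptsFrom (some p') ∧
      w ∈ (partialDFA n hn τ).acceptsFrom (some q')) :=
    fun w => Set.ext_iff.1 hpq w
  refine Prod.ext (by_contra fun hp => ?_) (by_contra fun hq => ?_)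
  · obtain ⟨w, -, h1, h2⟩ := h.exists_separating_word (hm := hm) (hn := hn)
      (o := some p) (o' := some p') (by simpa using hp) true
    have := mem w
    simp only [h2] at this
    tauto
  · obtain ⟨w, -, h1, h2⟩ := h.symm.exists_separating_word (hm := hn) (hn := hm)
      (o := some q) (o' := some q') (by simpa using hq) true
    have := mem w
    simp only [h2] at this
    tauto

end Boolean

/-! ### Lower bounds for boolean operations on dialects -/

theorem step_c_zero {n : ℕ} (hn : 4 ≤ n) :
    witnessStep n hn ⟨0, by omega⟩ Letter.c = ⟨0, by omega⟩ := by
  ext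
  rw [val_step_c, if_neg (by simp only; omega)]

section BooleanWitness

variable {m n : ℕ} {hm : 4 ≤ m} {hn : 4 ≤ n} {π ρ σ τ : Letter → Option Letter}
  {l x y z t : Letter}

theorem dialect_leftQuotient (hπ : ∀ x y, π x = some y ↔ σ y = some x) (w : List Letter) :
    (dialect π (witness m hm)).leftQuotient w =
      (partialDFA m hm σ).acceptsFrom ((partialDFA m hm σ).eval w) := by
  rw [dialect_witness_eq hπ, Language.leftQuotient_accepts_apply]

/-- Reading `z` first sends the second automaton to its sink and, acting as `c`, leaves the first
one in `0`, from where it can still be steered to `p`. -/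
theorem ActCrosswise.exists_word_to_option (h : ActCrosswise σ τ l x y)
    (hz : σ z = some Letter.c) (hz' : τ z = none) (p : Fin m) (o : Option (Fin n)) :
    ∃ w ∈ words {l, x, y, z},
      (partialDFA m hm σ).eval w = some p ∧ (partialDFA n hn τ).eval w = o := by
  have hsub : ({l, x, y} : Set Letter) ⊆ {l, x, y, z} := by
    intro u hu
    simp only [Set.mem_insert_iff, Set.mem_singleton_iff] at hu ⊢
    tauto
  rcases o with _ | q
  · obtain ⟨w, hw, h1, -⟩ := h.exists_word_to_pair (hm := hm) (hn := hn) p ⟨0, by omega⟩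
    refine ⟨z :: w, cons_mem_words.2 ⟨by simp, words_mono hsub hw⟩, ?_, ?_⟩
    · rw [← h1]
      change (partialDFA m hm σ).evalFrom
        ((partialDFA m hm σ).step (some ⟨0, by omega⟩) z) w = _
      rw [partialDFA_step_some hz, step_c_zero hm]
      rfl
    · rw [DFA.eval, DFA.evalFrom_cons, partialDFA_step_of_eq_none hz', partialDFA_evalFrom_none]
  · obtain ⟨w, hw, h1⟩ := h.exists_word_to_pair (hm := hm) (hn := hn) p q
    exact ⟨w, words_mono hsub hw, h1⟩

theorem ActCrosswise.exists_word_to_options (h : ActCrosswise σ τ l x y)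
    (hz : σ z = some Letter.c) (hz' : τ z = none) (ht : τ t = some Letter.c) (ht' : σ t = none)
    (o : Option (Fin m)) (o' : Option (Fin n)) :
    ∃ w, (partialDFA m hm σ).eval w = o ∧ (partialDFA n hn τ).eval w = o' := by
  rcases o with _ | p
  · rcases o' with _ | q
    · refine ⟨[z, t], ?_, ?_⟩
      · rw [DFA.eval, DFA.evalFrom_cons, DFA.evalFrom_cons, partialDFA_step_of_eq_none ht']
        rfl
      · rw [DFA.eval, DFA.evalFrom_cons, partialDFA_step_of_eq_none hz', partialDFA_evalFrom_none]
    · obtain ⟨w, -, h1, h2⟩ := h.symm.exists_word_to_option (hm := hn) (hn := hm) ht ht' q none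
      exact ⟨w, h2, h1⟩
  · obtain ⟨w, -, h1⟩ := h.exists_word_to_option (hm := hm) (hn := hn) hz hz' p o'
    exact ⟨w, h1⟩

theorem ActCrosswise.complexity_boolOp (h : ActCrosswise σ τ l x y)
    (hπ : ∀ x y, π x = some y ↔ σ y = some x) (hρ : ∀ x y, ρ x = some y ↔ τ y = some x)
    {A : Set Letter} (hA : {l, x, y} ⊆ A) {f : Bool → Bool → Bool} (hf : IsProper f) :
    (m * n : ℕ) ≤
      complexity A (boolOp f A (dialect π (witness m hm)) (dialect ρ (witness n hn))) := by
  have := natCard_le_complexity (A := A)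
    (L := boolOp f A (dialect π (witness m hm)) (dialect ρ (witness n hn)))
    (h.boolOp_injective (hm := hm) (hn := hn) hA hf) ?_
  · rwa [Nat.card_eq_fintype_card, Fintype.card_prod, Fintype.card_fin, Fintype.card_fin] at this
  · rintro ⟨p, q⟩
    obtain ⟨w, hw, h1, h2⟩ := h.exists_word_to_pair (hm := hm) (hn := hn) p q
    have hw := words_mono hA hw
    refine ⟨w, hw, ?_⟩
    rw [boolOp_leftQuotient f hw, dialect_leftQuotient hπ, dialect_leftQuotient hρ, h1, h2]

theorem ActCrosswise.complexity_inf (h : ActCrosswise σ τ l x y)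
    (hπ : ∀ x y, π x = some y ↔ σ y = some x) (hρ : ∀ x y, ρ x = some y ↔ τ y = some x)
    {A : Set Letter} (hA : {l, x, y} ⊆ A) :
    (m * n : ℕ) ≤ complexity A (dialect π (witness m hm) ⊓ dialect ρ (witness n hn)) := by
  have := natCard_le_complexity (A := A)
    (L := dialect π (witness m hm) ⊓ dialect ρ (witness n hn))
    (h.inf_injective (hm := hm) (hn := hn)) ?_
  · rwa [Nat.card_eq_fintype_card, Fintype.card_prod, Fintype.card_fin, Fintype.card_fin] at this
  · rintro ⟨p, q⟩
    obtain ⟨w, hw, h1, h2⟩ := h.exists_word_to_pair (hm := hm) (hn := hn) p q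
    refine ⟨w, words_mono hA hw, ?_⟩
    dsimp only
    rw [← h1, ← h2, ← dialect_leftQuotient hπ, ← dialect_leftQuotient hρ]
    rfl

theorem ActCrosswise.complexity_sdiff (h : ActCrosswise σ τ l x y)
    (hπ : ∀ x y, π x = some y ↔ σ y = some x) (hρ : ∀ x y, ρ x = some y ↔ τ y = some x)
    (hz : σ z = some Letter.c) (hz' : τ z = none) {A : Set Letter} (hA : {l, x, y, z} ⊆ A) :
    (m * n + m : ℕ) ≤ complexity A (dialect π (witness m hm) \ dialect ρ (witness n hn)) := by
  have := natCard_le_complexity (A := A)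
    (L := dialect π (witness m hm) \ dialect ρ (witness n hn))
    (h.sdiff_injective (hm := hm) (hn := hn)) ?_
  · rwa [Nat.card_eq_fintype_card, Fintype.card_prod, Fintype.card_option, Fintype.card_fin,
      Fintype.card_fin, mul_add, mul_one] at this
  · rintro ⟨p, o⟩
    obtain ⟨w, hw, h1, h2⟩ := h.exists_word_to_option (hm := hm) (hn := hn) hz hz' p o
    refine ⟨w, words_mono hA hw, ?_⟩
    dsimp only
    rw [← h1, ← h2, ← dialect_leftQuotient hπ, ← dialect_leftQuotient hρ]
    rfl

theorem ActCrosswise.complexity_sup (h : ActCrosswise σ τ l x y)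
    (hπ : ∀ x y, π x = some y ↔ σ y = some x) (hρ : ∀ x y, ρ x = some y ↔ τ y = some x)
    (hz : σ z = some Letter.c) (hz' : τ z = none) (ht : τ t = some Letter.c) (ht' : σ t = none) :
    ((m + 1) * (n + 1) : ℕ) ≤
      complexity Set.univ (dialect π (witness m hm) ⊔ dialect ρ (witness n hn)) := by
  have := natCard_le_complexity (A := Set.univ)
    (L := dialect π (witness m hm) ⊔ dialect ρ (witness n hn))
    (h.sup_injective (hm := hm) (hn := hn)) ?_
  · rwa [Nat.card_eq_fintype_card, Fintype.card_prod, Fintype.card_option, Fintype.card_option,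
      Fintype.card_fin, Fintype.card_fin] at this
  · rintro ⟨o, o'⟩
    obtain ⟨w, h1, h2⟩ := h.exists_word_to_options (hm := hm) (hn := hn) hz hz' ht ht' o o'
    refine ⟨w, mem_words_univ w, ?_⟩
    dsimp only
    rw [← h1, ← h2, ← dialect_leftQuotient hπ, ← dialect_leftQuotient hρ]
    rfl

theorem ActCrosswise.complexity_symmDiff (h : ActCrosswise σ τ l x y)
    (hπ : ∀ x y, π x = some y ↔ σ y = some x) (hρ : ∀ x y, ρ x = some y ↔ τ y = some x)
    (hz : σ z = some Letter.c) (hz' : τ z = none) (ht : τ t = some Letter.c) (ht' : σ t = none) :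
    ((m + 1) * (n + 1) : ℕ) ≤
      complexity Set.univ (symmDiff (dialect π (witness m hm)) (dialect ρ (witness n hn))) := by
  have := natCard_le_complexity (A := Set.univ)
    (L := symmDiff (dialect π (witness m hm)) (dialect ρ (witness n hn)))
    (h.symmDiff_injective (hm := hm) (hn := hn)) ?_
  · rwa [Nat.card_eq_fintype_card, Fintype.card_prod, Fintype.card_option, Fintype.card_option,
      Fintype.card_fin, Fintype.card_fin] at this
  · rintro ⟨o, o'⟩
    obtain ⟨w, h1, h2⟩ := h.exists_word_to_options (hm := hm) (hn := hn) hz hz' ht ht' o o'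
    refine ⟨w, mem_words_univ w, ?_⟩
    dsimp only
    rw [← h1, ← h2, ← dialect_leftQuotient hπ, ← dialect_leftQuotient hρ]
    rfl

end BooleanWitness

/-! ### Upper bounds for boolean operations -/

section BooleanBounds

variable {α : Type*} {A B : Set α} {K L : Language α} {m n : ℕ}

theorem complexity_boolOp_le (hm : complexity A K = m) (hn : complexity A L = n)
    (f : Bool → Bool → Bool) : complexity A (boolOp f A K L) ≤ (m * n : ℕ) :=
  complexity_le_mul (boolOp f A) (fun _ hw => boolOp_leftQuotient f hw) subset_rfl subset_rfl hm hn

theorem complexity_op_le_of_union (hK : IsRegularLeftIdeal A K) (hL : IsRegularLeftIdeal B L)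
    (hm : complexity A K = m) (hn : complexity B L = n) (hm4 : 2 ≤ m) (hn4 : 2 ≤ n)
    (op : Language α → Language α → Language α)
    (hop : ∀ w, (op K L).leftQuotient w = op (K.leftQuotient w) (L.leftQuotient w)) :
    complexity (A ∪ B) (op K L) ≤ ((m + 1) * (n + 1) : ℕ) :=
  complexity_le_mul op (fun w _ => hop w) (quotients_subset_insert_zero hK.subset_words)
    (quotients_subset_insert_zero hL.subset_words) (encard_insert_zero_quotients hK hm hm4)
    (encard_insert_zero_quotients hL hn hn4)

theorem complexity_sdiff_le (hL : IsRegularLeftIdeal B L)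
    (hm : complexity A K = m) (hn : complexity B L = n) (hn4 : 2 ≤ n) :
    complexity A (K \ L) ≤ (m * n + m : ℕ) := by
  rw [← Nat.mul_succ]
  exact complexity_le_mul (fun X Y => X \ Y) (fun _ _ => rfl) subset_rfl
    (quotients_subset_insert_zero hL.subset_words) hm (encard_insert_zero_quotients hL hn hn4)

theorem complexity_inf_le (hm : complexity A K = m) (hn : complexity B L = n) :
    complexity (A ∩ B) (K ⊓ L) ≤ (m * n : ℕ) :=
  complexity_le_mul (fun X Y => X ⊓ Y) (fun _ _ => rfl)
    (quotients_subset_of_subset Set.inter_subset_left)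
    (quotients_subset_of_subset Set.inter_subset_right) hm hn

end BooleanBounds

/-! ### The unrestricted product of two dialects -/

section ProductWitness

/-- The roles of the letters in the first factor; the same map gives the dialect. -/
def productRoleLeft : Letter → Option Letter
  | Letter.c => none
  | x => some x

/-- The roles of the letters in the second factor. -/
def productRoleRight : Letter → Option Letter
  | Letter.a => some Letter.b
  | Letter.b => none
  | Letter.c => some Letter.c
  | Letter.d => some Letter.a
  | Letter.e => some Letter.e

/-- The dialect of the second factor, inverse to `productRoleRight`. -/
def productDialectRight : Letter → Option Letter
  | Letter.a => some Letter.d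
  | Letter.b => some Letter.a
  | Letter.c => some Letter.c
  | Letter.d => none
  | Letter.e => some Letter.e

theorem productRoleLeft_inverse (x y : Letter) :
    productRoleLeft x = some y ↔ productRoleLeft y = some x := by
  cases x <;> cases y <;> simp [productRoleLeft]

theorem productDialectRight_inverse (x y : Letter) :
    productDialectRight x = some y ↔ productRoleRight y = some x := by
  cases x <;> cases y <;> simp [productRoleRight, productDialectRight]

theorem dialect_eq_acceptsFrom_start {n : ℕ} {hn : 4 ≤ n} : dialect productDialectRight (witness n hn) =
    (partialDFA n hn productRoleRight).acceptsFrom (some ⟨0, by omega⟩) :=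
  dialect_witness_eq productDialectRight_inverse

variable {m n : ℕ} (hm : 4 ≤ m) (hn : 4 ≤ n)

/-- Entering the state `(m - 1, none)` starts the second automaton. -/
def enter (s : Option (Fin m) × Option (Fin n)) : Option (Fin m) × Option (Fin n) :=
  if s.1 = some ⟨m - 1, by omega⟩ ∧ s.2 = none then (s.1, some ⟨0, by omega⟩) else s

/-- The automaton of the product: the second automaton is run on the longest possible suffix. -/
def productDFA : DFA Letter (Option (Fin m) × Option (Fin n)) where
  step s x := enter hm hn ((partialDFA m hm productRoleLeft).step s.1 x,
    (partialDFA n hn productRoleRight).step s.2 x)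
  start := (some ⟨0, by omega⟩, none)
  accept := {s | s.2 = some ⟨n - 1, by omega⟩}

/-- The quotient of the product in a state of `productDFA`. -/
def productLanguage (s : Option (Fin m) × Option (Fin n)) : Language Letter :=
  (partialDFA m hm productRoleLeft).acceptsFrom s.1 *
    dialect productDialectRight (witness n hn) ⊔
    (partialDFA n hn productRoleRight).acceptsFrom s.2

/-- The states that `enter` leaves unchanged. -/
def Entered (s : Option (Fin m) × Option (Fin n)) : Prop :=
  ¬ (s.1 = some ⟨m - 1, by omega⟩ ∧ s.2 = none)

variable {hm hn}

theorem enter_of_entered {s : Option (Fin m) × Option (Fin n)} (h : Entered hm s) :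
    enter hm hn s = s := if_neg h

theorem entered_enter (s : Option (Fin m) × Option (Fin n)) : Entered hm (enter hm hn s) := by
  unfold enter
  split_ifs with h
  · simp [Entered]
  · exact h

theorem enter_some (p : Option (Fin m)) (q : Fin n) : enter hm hn (p, some q) = (p, some q) := by
  simp [enter]

theorem enter_none (q : Option (Fin n)) : enter hm hn (none, q) = (none, q) := by
  simp [enter]

theorem enter_ne {p : Fin m} (hp : p.val ≠ m - 1) (q : Option (Fin n)) :
    enter hm hn (some p, q) = (some p, q) := by
  simp [enter, Fin.ext_iff, hp]

theorem enter_last {p : Fin m} (hp : p.val = m - 1) :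
    enter hm hn (some p, none) = (some p, some ⟨0, by omega⟩) := by
  simp [enter, Fin.ext_iff, hp]

theorem productLanguage_enter (s : Option (Fin m) × Option (Fin n)) :
    productLanguage hm hn (enter hm hn s) = productLanguage hm hn s := by
  obtain ⟨p, q⟩ := s
  by_cases h : p = some ⟨m - 1, by omega⟩ ∧ q = none
  · obtain ⟨rfl, rfl⟩ := h
    rw [enter_last rfl, productLanguage, productLanguage, partialDFA_acceptsFrom_none,
      ← dialect_eq_acceptsFrom_start]
    have : dialect productDialectRight (witness n hn) ≤
        (partialDFA m hm productRoleLeft).acceptsFrom (some ⟨m - 1, by omega⟩) *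
          dialect productDialectRight (witness n hn) :=
      fun x hx => ⟨[], rfl, x, hx, rfl⟩
    exact (sup_eq_left.2 this).trans (sup_eq_left.2 (fun x hx => hx.elim)).symm
  · rw [enter_of_entered (s := (p, q)) h]

/-- If the first component is final, `Entered` ensures that the second automaton is already running
in some state `q`. Starting it afresh would add only words accepted from `0`, all of which are
accepted from `q` by the ideal property. -/
theorem productLanguage_leftQuotient_singleton {s : Option (Fin m) × Option (Fin n)}
    (hs : Entered hm s) (x : Letter) :
    (productLanguage hm hn s).leftQuotient [x] =
      productLanguage hm hn ((productDFA hm hn).step s x) := by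
  have h1 := acceptsFrom_leftQuotient (partialDFA m hm productRoleLeft) s.1 [x]
  have h2 := acceptsFrom_leftQuotient (partialDFA n hn productRoleRight) s.2 [x]
  rw [DFA.evalFrom_singleton] at h1 h2
  change _ = productLanguage hm hn (enter hm hn (_, _))
  rw [productLanguage_enter]
  simp only [productLanguage, ← h1, ← h2]
  ext v
  change v ∈ Language.leftQuotient (_ * _) [x] ∨ _ ↔ _ ∨ _
  rw [mem_mul_leftQuotient_singleton]
  have key : [] ∈ (partialDFA m hm productRoleLeft).acceptsFrom s.1 →
      v ∈ (dialect productDialectRight (witness n hn)).leftQuotient [x] →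
      v ∈ ((partialDFA n hn productRoleRight).acceptsFrom s.2).leftQuotient [x] := by
    intro h hv
    obtain ⟨q, hq⟩ := Option.ne_none_iff_exists'.1 fun h' => hs ⟨h, h'⟩
    rw [hq]
    exact (isRegularLeftIdeal_dialect productDialectRight_inverse).le_of_mem_quotients
      (acceptsFrom_mem_quotients_dialect productDialectRight_inverse ⟨Letter.d, rfl⟩
        ⟨Letter.e, rfl⟩ q) hv
  simp only [Language.mem_leftQuotient] at key ⊢
  tauto

theorem entered_step (s : Option (Fin m) × Option (Fin n)) (x : Letter) :
    Entered hm ((productDFA hm hn).step s x) := entered_enter (hn := hn) _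

theorem productLanguage_leftQuotient {s : Option (Fin m) × Option (Fin n)}
    (hs : Entered hm s) (w : List Letter) :
    (productLanguage hm hn s).leftQuotient w =
      productLanguage hm hn ((productDFA hm hn).evalFrom s w) := by
  induction w generalizing s with
  | nil => rfl
  | cons x w ih =>
    rw [← List.singleton_append, Language.leftQuotient_append,
      productLanguage_leftQuotient_singleton hs, ih (entered_step s x)]
    rfl

theorem mem_productLanguage {s : Option (Fin m) × Option (Fin n)} (hs : Entered hm s)
    (w : List Letter) : w ∈ productLanguage hm hn s ↔ w ∈ (productDFA hm hn).acceptsFrom s := by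
  rw [← List.append_nil w, ← Language.mem_leftQuotient, productLanguage_leftQuotient hs,
    List.append_nil, DFA.mem_acceptsFrom]
  change (_ ∨ _) ↔ _ = _
  constructor
  · rintro (⟨u, hu, v, hv, huv⟩ | h)
    · obtain ⟨-, rfl⟩ := List.append_eq_nil_iff.1 huv
      rw [dialect_eq_acceptsFrom_start] at hv
      have hv := Option.some_inj.1 (mem_partialDFA_acceptsFrom.1 hv)
      simp only [Fin.ext_iff] at hv
      omega
    · exact h
  · exact fun h => Or.inr h

/-! Steps of the product automaton -/

theorem step_product (p : Option (Fin m)) (q : Option (Fin n)) (x : Letter) :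
    (productDFA hm hn).step (p, q) x =
      enter hm hn ((partialDFA m hm productRoleLeft).step p x,
        (partialDFA n hn productRoleRight).step q x) := rfl

theorem val_step_d_ne (p : Fin m) : (witnessStep m hm p Letter.d).val ≠ m - 1 := by
  rw [val_step_d]
  split_ifs <;> omega

theorem step_product_d (p : Option (Fin m)) (q : Option (Fin n)) :
    (productDFA hm hn).step (p, q) Letter.d =
      (p.map fun p => witnessStep m hm p Letter.d, q.map fun q => witnessStep n hn q Letter.a) := by
  rw [step_product]
  rcases p with _ | p <;> rcases q with _ | q
  · exact enter_none _
  · exact enter_none _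
  · exact enter_ne (val_step_d_ne p) _
  · exact enter_some _ _

theorem iterate_step_product_d (p : Option (Fin m)) (q : Option (Fin n)) (k : ℕ) :
    (productDFA hm hn).evalFrom (p, q) (List.replicate k Letter.d) =
      ((fun o => o.map fun p => witnessStep m hm p Letter.d)^[k] p,
        (fun o => o.map fun q => witnessStep n hn q Letter.a)^[k] q) := by
  induction k generalizing p q with
  | zero => rfl
  | succ k ih => rw [List.replicate_succ, DFA.evalFrom_cons, step_product_d, ih]; rfl

theorem step_product_c (p : Option (Fin m)) (q : Option (Fin n)) :
    (productDFA hm hn).step (p, q) Letter.c =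
      (none, q.map fun q => witnessStep n hn q Letter.c) := by
  rw [step_product, partialDFA_step_of_eq_none (τ := productRoleLeft) rfl, enter_none]
  cases q <;> rfl

theorem step_product_e (p : Fin m) (q : Option (Fin n)) :
    (productDFA hm hn).step (some p, q) Letter.e =
      (some ⟨1, by omega⟩, q.map fun _ => ⟨1, by omega⟩) := by
  rw [step_product]
  refine (enter_ne (p := ⟨1, by omega⟩) (by simp only; omega) _).trans ?_
  cases q <;> rfl

theorem step_product_b (p : Option (Fin m)) (q : Option (Fin n)) :
    (productDFA hm hn).step (p, q) Letter.b =
      enter hm hn (p.map fun p => witnessStep m hm p Letter.b, none) := by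
  rw [step_product, partialDFA_step_of_eq_none (τ := productRoleRight) rfl]
  cases p <;> rfl

theorem step_product_a (p : Option (Fin m)) (q : Option (Fin n)) :
    (productDFA hm hn).step (p, q) Letter.a =
      enter hm hn (p.map fun p => witnessStep m hm p Letter.a,
        q.map fun q => witnessStep n hn q Letter.b) := by
  rw [step_product]
  cases p <;> cases q <;> rfl

/-! Reachability -/

/-- The states of the product automaton that are reachable from the initial state. -/
def Reached (hm : 4 ≤ m) (hn : 4 ≤ n) (s : Option (Fin m) × Option (Fin n)) : Prop :=
  ∃ w, (productDFA hm hn).eval w = s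

theorem Reached.step {s : Option (Fin m) × Option (Fin n)} (h : Reached hm hn s) (x : Letter) :
    Reached hm hn ((productDFA hm hn).step s x) := by
  obtain ⟨w, rfl⟩ := h
  exact ⟨w ++ [x], by rw [DFA.eval_append_singleton]⟩

theorem Reached.step_eq {s s' : Option (Fin m) × Option (Fin n)} (h : Reached hm hn s)
    (x : Letter) (hx : (productDFA hm hn).step s x = s') : Reached hm hn s' := hx ▸ h.step x

theorem reached_start : Reached hm hn (some ⟨0, by omega⟩, none) := ⟨[], rfl⟩

/-- The letter `a` rotates the first component and acts as `b` on the second, so a state fixed by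
`b` is kept. -/
theorem Reached.rotate_left {p p' : Fin m} {q : Fin n} (h : Reached hm hn (some p, some q))
    (hq : witnessStep n hn q Letter.b = q) (hp : p.val ≠ 0) (hp' : p'.val ≠ 0) :
    Reached hm hn (some p', some q) := by
  obtain ⟨k, rfl⟩ := exists_iterate_step_a (hn := hm) hp hp'
  clear hp'
  induction k with
  | zero => exact h
  | succ k ih =>
    rw [Function.iterate_succ_apply']
    refine ih.step_eq Letter.a ?_
    rw [step_product_a, Option.map_some, Option.map_some, enter_some, hq]

/-- The letter `d` rotates the second component and moves only the last state of the first. -/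
theorem Reached.rotate_right {p : Option (Fin m)} {q q' : Fin n} (h : Reached hm hn (p, some q))
    (hp : ∀ r ∈ p, r.val ≠ m - 1) (hq : q.val ≠ 0) (hq' : q'.val ≠ 0) :
    Reached hm hn (p, some q') := by
  obtain ⟨k, rfl⟩ := exists_iterate_step_a (hn := hn) hq hq'
  clear hq'
  induction k with
  | zero => exact h
  | succ k ih =>
    rw [Function.iterate_succ_apply']
    refine ih.step_eq Letter.d ?_
    rw [step_product_d, Option.map_some]
    congr 1
    rcases p with _ | p
    · rfl
    · rw [Option.map_some]
      congr 1
      ext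
      rw [val_step_d, if_neg (hp p rfl)]

theorem reached_left_none {p : Fin m} (hp : p.val ≠ m - 1) :
    Reached hm hn (some p, none) := by
  obtain ⟨k, hk⟩ : ∃ k, p.val = k := ⟨_, rfl⟩
  induction k generalizing p with
  | zero =>
    rw [show p = ⟨0, by omega⟩ from Fin.ext hk]
    exact reached_start
  | succ k ih =>
    rcases k with _ | k
    · refine (reached_start (hm := hm) (hn := hn)).step_eq Letter.e ?_
      rw [step_product_e]
      refine Prod.ext (congrArg some (Fin.ext hk.symm)) rfl
    · have hp2 := p.2
      refine (ih (p := ⟨k + 1, by omega⟩) (by simp only; omega) rfl).step_eq Letter.a ?_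
      have : witnessStep m hm ⟨k + 1, by omega⟩ Letter.a = p := by
        ext
        rw [val_step_a, if_neg (by simp), if_pos (by simp only; omega), hk]
      rw [step_product_a, Option.map_some, Option.map_none, this, enter_ne hp]

theorem reached_some_zero (p : Fin m) : Reached hm hn (some p, some ⟨0, by omega⟩) := by
  have h1 : Reached hm hn (some ⟨m - 1, by omega⟩, some ⟨0, by omega⟩) := by
    refine (reached_left_none (hm := hm) (hn := hn) (p := ⟨m - 2, by omega⟩)
      (by simp only; omega)).step_eq Letter.a ?_
    have : witnessStep m hm ⟨m - 2, by omega⟩ Letter.a = ⟨m - 1, by omega⟩ := by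
      ext
      rw [val_step_a, if_neg (by simp only; omega), if_pos (by simp only; omega)]
      simp only
      omega
    rw [step_product_a, Option.map_some, Option.map_none, this, enter_last rfl]
  by_cases hp : p.val = 0
  · refine h1.step_eq Letter.d ?_
    rw [step_product_d, Option.map_some, Option.map_some]
    refine Prod.ext (congrArg some (Fin.ext ?_)) (congrArg some (Fin.ext ?_))
    · rw [val_step_d, if_pos rfl, hp]
    · rw [val_step_a, if_pos rfl]
  · exact h1.rotate_left (step_b_zero rfl) (by simp only; omega) hp

theorem reached_some_some (p : Fin m) (q : Fin n) : Reached hm hn (some p, some q) := by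
  by_cases hq : q.val = 0
  · rw [show q = ⟨0, by omega⟩ from Fin.ext hq]
    exact reached_some_zero p
  have h1 : Reached hm hn (some ⟨1, by omega⟩, some ⟨1, by omega⟩) :=
    (reached_some_zero (hm := hm) (hn := hn) ⟨0, by omega⟩).step_eq Letter.e
      (step_product_e _ _)
  -- The state `3` exists because `4 ≤ n` and is fixed by `b`, so the second component can be parked
  -- there while the first is rotated.
  have h3 : ∀ p : Fin m, p.val ≠ 0 → Reached hm hn (some p, some ⟨3, by omega⟩) := by
    intro p hp
    refine Reached.rotate_left (p := ⟨1, by omega⟩) ?_ ?_ (by simp) hp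
    · refine h1.rotate_right ?_ (by simp) (by simp)
      simp only [Option.mem_def, Option.some_inj]
      rintro _ rfl
      simp only
      omega
    · ext
      simp [val_step_b]
  have h0 : Reached hm hn (some ⟨0, by omega⟩,
      some (witnessStep n hn ⟨3, by omega⟩ Letter.a)) := by
    refine (h3 ⟨m - 1, by omega⟩ (by simp only; omega)).step_eq Letter.d ?_
    rw [step_product_d, Option.map_some, Option.map_some]
    refine Prod.ext (congrArg some (Fin.ext ?_)) rfl
    rw [val_step_d, if_pos rfl]
  have h4 : ∀ (p : Fin m) (q : Fin n), p.val ≠ m - 1 → q.val ≠ 0 →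
      Reached hm hn (some p, some q) := by
    intro p q hp hq
    by_cases hp0 : p.val = 0
    · rw [show p = ⟨0, by omega⟩ from Fin.ext hp0]
      refine h0.rotate_right ?_ ?_ hq
      · simp only [Option.mem_def, Option.some_inj]
        rintro _ rfl
        simp only
        omega
      · rw [val_step_a]
        split_ifs <;> simp_all
    · refine (h3 p hp0).rotate_right ?_ (by simp) hq
      simp only [Option.mem_def, Option.some_inj]
      rintro _ rfl
      exact hp
  by_cases hp : p.val = m - 1
  -- The last state is entered from `m - 2` by `a`, whose effect `b` on the second component is
  -- cancelled in advance.
  · refine (h4 ⟨m - 2, by omega⟩ (witnessStep n hn q Letter.b) (by simp only; omega)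
      (val_step_b_ne_zero hq)).step_eq Letter.a ?_
    rw [step_product_a, Option.map_some, Option.map_some, step_b_step_b, enter_some]
    refine Prod.ext (congrArg some (Fin.ext ?_)) rfl
    rw [val_step_a, if_neg (by simp only; omega), if_pos (by simp only; omega), hp]
    simp only
    omega
  · exact h4 p q hp hq

theorem reached_of_entered {s : Option (Fin m) × Option (Fin n)} (hs : Entered hm s) :
    Reached hm hn s := by
  obtain ⟨p, q⟩ := s
  rcases p with _ | p
  · rcases q with _ | q
    · exact (reached_start (hm := hm) (hn := hn)).step_eq Letter.c (step_product_c _ _)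
    · have h : ∀ q : Fin n, q.val ≠ n - 1 → Reached hm hn (none, some q) := by
        intro q hq
        refine (reached_some_some (hm := hm) (hn := hn) ⟨0, by omega⟩ q).step_eq Letter.c ?_
        rw [step_product_c, Option.map_some]
        refine Prod.ext rfl (congrArg some (Fin.ext ?_))
        rw [val_step_c, if_neg hq]
      by_cases hq : q.val = n - 1
      · exact (h ⟨1, by omega⟩ (by simp only; omega)).rotate_right (by simp) (by simp) (by omega)
      · exact h q hq
  · rcases q with _ | q
    · exact reached_left_none fun hp => hs ⟨congrArg some (Fin.ext hp), rfl⟩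
    · exact reached_some_some p q

/-! Distinguishability -/

/-- Some word is accepted from exactly one of two states. -/
def Separable (hm : 4 ≤ m) (hn : 4 ≤ n) (s s' : Option (Fin m) × Option (Fin n)) : Prop :=
  ∃ w, ¬ (w ∈ (productDFA hm hn).acceptsFrom s ↔ w ∈ (productDFA hm hn).acceptsFrom s')

variable {s s' : Option (Fin m) × Option (Fin n)}

theorem Separable.symm (h : Separable hm hn s s') : Separable hm hn s' s := by
  obtain ⟨w, hw⟩ := h
  exact ⟨w, fun h => hw h.symm⟩

theorem Separable.of_step (x : Letter)
    (h : Separable hm hn ((productDFA hm hn).step s x) ((productDFA hm hn).step s' x)) :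
    Separable hm hn s s' := by
  obtain ⟨w, hw⟩ := h
  exact ⟨x :: w, hw⟩

theorem map_step_injective {x : Letter} (h : Function.Injective fun q => witnessStep n hn q x) :
    Function.Injective (Option.map fun q => witnessStep n hn q x) := Option.map_injective h

theorem iterate_map_some {β : Type*} (f : β → β) (k : ℕ) (q : β) :
    (Option.map f)^[k] (some q) = some (f^[k] q) := by
  induction k generalizing q with
  | zero => rfl
  | succ k ih => rw [Function.iterate_succ_apply, Option.map_some, ih, Function.iterate_succ_apply]

theorem separable_none_none {q q' : Option (Fin n)} (hq : q ≠ q') :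
    Separable hm hn (none, q) (none, q') := by
  have key : ∀ (q : Fin n) (q' : Option (Fin n)), q.val ≠ 0 → q' ≠ some q →
      Separable hm hn (none, some q) (none, q') := by
    intro q q' h0 hne
    obtain ⟨k, hk⟩ := exists_iterate_step_a (hn := hn) (r := ⟨n - 1, by omega⟩) h0
      (by simp only; omega)
    refine ⟨List.replicate k Letter.d, ?_⟩
    rw [DFA.mem_acceptsFrom, DFA.mem_acceptsFrom, iterate_step_product_d, iterate_step_product_d]
    intro h
    have h1 := h.1 (by
      change (Option.map _)^[k] _ = _
      rw [iterate_map_some, hk])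
    change (Option.map _)^[k] _ = _ at h1
    rw [← hk, ← iterate_map_some] at h1
    exact hne ((map_step_injective step_a_injective).iterate k h1)
  wlog hq0 : q ≠ none generalizing q q'
  · exact (this hq.symm fun h => hq (by rw [h, not_not.1 hq0])).symm
  obtain ⟨q, rfl⟩ := Option.ne_none_iff_exists'.1 hq0
  by_cases h0 : q.val = 0
  · rcases q' with _ | q'
    · exact Separable.of_step Letter.e (key ⟨1, by omega⟩ none (by simp) (by simp))
    · refine (key q' (some q) (fun h => hq (congrArg some (Fin.ext (h0.trans h.symm)))) hq).symm
  · exact key q q' h0 hq.symm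

/-- The letter `c` sends the first component to the sink and fixes every state of the second except
the last. -/
theorem separable_of_snd_ne_of_ne_last {p p' : Option (Fin m)} {q q' : Option (Fin n)}
    (hq : q ≠ q') (hl : ∀ r ∈ q, r.val ≠ n - 1) (hl' : ∀ r ∈ q', r.val ≠ n - 1) :
    Separable hm hn (p, q) (p', q') := by
  have key : ∀ q : Option (Fin n), (∀ r ∈ q, r.val ≠ n - 1) →
      q.map (fun q => witnessStep n hn q Letter.c) = q := by
    intro q hl
    rcases q with _ | q
    · rfl
    · refine congrArg some (Fin.ext ?_)
      rw [val_step_c, if_neg (hl q rfl)]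
  refine Separable.of_step Letter.c ?_
  rw [step_product_c, step_product_c, key q hl, key q' hl']
  exact separable_none_none hq

/-- The letter `d` acts injectively on the second component. At most two readings take both states
off the last one, since they lead it to `1` and then `2`, neither of which is last as `4 ≤ n`. -/
theorem separable_of_snd_ne {p p' : Option (Fin m)} {q q' : Option (Fin n)} (hq : q ≠ q') :
    Separable hm hn (p, q) (p', q') := by
  by_cases h : (∀ r ∈ q, r.val ≠ n - 1) ∧ ∀ r ∈ q', r.val ≠ n - 1
  · exact separable_of_snd_ne_of_ne_last hq h.1 h.2
  wlog h1 : ∃ r ∈ q, r.val = n - 1 generalizing p p' q q'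
  · refine (this hq.symm (fun h' => h h'.symm) ?_).symm
    by_contra h2
    push Not at h1 h2
    exact h ⟨h1, h2⟩
  obtain ⟨r, hr, hrn⟩ := h1
  rw [Option.mem_def] at hr
  subst hr
  have e1 : (witnessStep n hn r Letter.a).val = 1 := by
    rw [val_step_a]
    split_ifs <;> omega
  have inj := map_step_injective (n := n) (hn := hn) step_a_injective
  refine Separable.of_step Letter.d ?_
  rw [step_product_d, step_product_d]
  by_cases h2 : ∀ t ∈ q'.map fun q => witnessStep n hn q Letter.a, t.val ≠ n - 1
  · refine separable_of_snd_ne_of_ne_last (fun h' => hq (inj h')) ?_ h2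
    simp only [Option.map_some, Option.mem_def, Option.some_inj]
    rintro _ rfl
    omega
  · push Not at h2
    obtain ⟨t, ht, htn⟩ := h2
    refine Separable.of_step Letter.d ?_
    rw [step_product_d, step_product_d]
    refine separable_of_snd_ne_of_ne_last (fun h' => hq (inj (inj h'))) ?_ ?_
    · simp only [Option.map_some, Option.mem_def, Option.some_inj]
      rintro _ rfl
      rw [val_step_a, e1]
      split_ifs <;> omega
    · rw [Option.mem_def] at ht
      rw [ht]
      simp only [Option.map_some, Option.mem_def, Option.some_inj]
      rintro _ rfl
      rw [val_step_a, htn]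
      split_ifs <;> omega

/-- If exactly one of the first components is the last state, the second automaton starts on that
side only, and the second components differ. -/
theorem separable_enter_none {p p' : Option (Fin m)} (hp : p ≠ p')
    (h : Entered hm (p, (none : Option (Fin n))) → Entered hm (p', (none : Option (Fin n))) →
      Separable hm hn (p, none) (p', none)) :
    Separable hm hn (enter hm hn (p, none)) (enter hm hn (p', none)) := by
  have key : ∀ p, ¬ Entered hm (p, (none : Option (Fin n))) →
      p = some ⟨m - 1, by omega⟩ := by
    intro p h
    simpa [Entered] using h
  by_cases h1 : Entered hm (p, (none : Option (Fin n)))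
  · rw [enter_of_entered h1]
    by_cases h2 : Entered hm (p', (none : Option (Fin n)))
    · rw [enter_of_entered h2]
      exact h h1 h2
    · rw [key p' h2, enter_last rfl]
      exact separable_of_snd_ne (by simp)
  · have h2 : Entered hm (p', (none : Option (Fin n))) := by
      by_contra h2
      exact hp ((key p h1).trans (key p' h2).symm)
    rw [enter_of_entered h2, key p h1, enter_last rfl]
    exact separable_of_snd_ne (by simp)

/-- Reading `a` raises `p` until one side reaches the last state, where `enter` tells the two apart.
-/
theorem separable_left_of_ne_zero {p : Fin m} {p' : Option (Fin m)} (h0 : p.val ≠ 0)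
    (hp : some p ≠ p') (he : Entered hm (some p, (none : Option (Fin n)))) :
    Separable hm hn (some p, none) (p', none) := by
  have hlast : p.val ≠ m - 1 := fun h => he ⟨congrArg some (Fin.ext h), rfl⟩
  obtain ⟨k, hk⟩ : ∃ k, p.val + k + 1 = m := ⟨m - 1 - p.val, by have := p.2; omega⟩
  induction k generalizing p p' with
  | zero => omega
  | succ k ih =>
    refine Separable.of_step Letter.a ?_
    rw [step_product_a, step_product_a, Option.map_some, Option.map_none]
    have e1 : (witnessStep m hm p Letter.a).val = p.val + 1 := by
      rw [val_step_a]
      split_ifs <;> omega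
    refine separable_enter_none (fun h => hp (map_step_injective step_a_injective h)) fun h1 _ => ?_
    refine ih (by omega) (fun h => hp (map_step_injective step_a_injective h)) h1 ?_ (by omega)
    exact fun h => h1 ⟨congrArg some (Fin.ext h), rfl⟩

theorem separable_left {p p' : Option (Fin m)} (hp : p ≠ p')
    (h : Entered hm (p, (none : Option (Fin n)))) (h' : Entered hm (p', (none : Option (Fin n)))) :
    Separable hm hn (p, none) (p', none) := by
  wlog hp0 : p ≠ none generalizing p p'
  · exact (this hp.symm h' h fun h => hp (by rw [h, not_not.1 hp0])).symm
  obtain ⟨p, rfl⟩ := Option.ne_none_iff_exists'.1 hp0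
  by_cases h0 : p.val = 0
  · rcases p' with _ | p'
    · refine Separable.of_step Letter.e ?_
      rw [step_product_e]
      refine separable_left_of_ne_zero (p := ⟨1, by omega⟩) (by simp) (by simp [partialDFA]) ?_
      intro h
      have := congrArg Fin.val (Option.some_inj.1 h.1)
      simp only at this
      omega
    · exact (separable_left_of_ne_zero
        (fun h => hp (congrArg some (Fin.ext (h0.trans h.symm)))) hp.symm h').symm
  · exact separable_left_of_ne_zero h0 hp h

theorem separable_of_ne (hs : Entered hm s) (hs' : Entered hm s') (hne : s ≠ s') :
    Separable hm hn s s' := by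
  obtain ⟨p, q⟩ := s
  obtain ⟨p', q'⟩ := s'
  by_cases hq : q = q'
  · subst hq
    have hp : p ≠ p' := fun h => hne (by rw [h])
    rcases q with _ | q
    · exact separable_left hp hs hs'
    -- The letter `b` erases the common second component and permutes the first.
    · refine Separable.of_step Letter.b ?_
      rw [step_product_b, step_product_b]
      have hp' : p.map (fun p => witnessStep m hm p Letter.b) ≠
          p'.map (fun p => witnessStep m hm p Letter.b) :=
        fun h => hp (map_step_injective step_b_injective h)
      exact separable_enter_none hp' (separable_left hp')
  · exact separable_of_snd_ne hq

theorem complexity_product_witness : (m * n + m + n : ℕ) ≤ complexity Set.univ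
    (dialect productRoleLeft (witness m hm) * dialect productDialectRight (witness n hn)) := by
  classical
  have hstart : productLanguage hm hn (productDFA hm hn).start =
      dialect productRoleLeft (witness m hm) * dialect productDialectRight (witness n hn) := by
    change (partialDFA m hm productRoleLeft).accepts * _ ⊔
      (partialDFA n hn productRoleRight).acceptsFrom none = _
    rw [← dialect_witness_eq productRoleLeft_inverse, partialDFA_acceptsFrom_none]
    exact sup_eq_left.2 (fun x hx => hx.elim)
  have hes : Entered hm (productDFA hm hn).start := by
    intro h
    have := congrArg Fin.val (Option.some_inj.1 h.1)
    simp only at this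
    omega
  have hF : Function.Injective fun s : {s : Option (Fin m) × Option (Fin n) //
      ¬ s = (some ⟨m - 1, by omega⟩, none)} => productLanguage hm hn s.1 := by
    rintro ⟨s, hs⟩ ⟨s', hs'⟩ h
    by_contra hne
    have he : Entered hm s := fun h => hs (Prod.ext h.1 h.2)
    have he' : Entered hm s' := fun h => hs' (Prod.ext h.1 h.2)
    obtain ⟨w, hw⟩ := separable_of_ne (hn := hn) he he' fun h => hne (Subtype.ext h)
    rw [← mem_productLanguage he, ← mem_productLanguage he'] at hw
    exact hw (Set.ext_iff.1 h w)
  have := natCard_le_complexity (A := Set.univ) (L := dialect productRoleLeft (witness m hm) *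
    dialect productDialectRight (witness n hn)) hF ?_
  · rw [Nat.card_eq_fintype_card, Fintype.card_subtype_compl, Fintype.card_subtype_eq,
      Fintype.card_prod, Fintype.card_option, Fintype.card_option, Fintype.card_fin,
      Fintype.card_fin, show (m + 1) * (n + 1) - 1 = m * n + m + n by
        rw [show (m + 1) * (n + 1) = m * n + m + n + 1 by ring, Nat.add_sub_cancel]] at this
    exact this
  · rintro ⟨s, hs⟩
    obtain ⟨w, hw⟩ := reached_of_entered (hm := hm) (hn := hn) (s := s)
      fun h => hs (Prod.ext h.1 h.2)
    refine ⟨w, mem_words_univ w, ?_⟩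
    rw [← hstart, productLanguage_leftQuotient hes]
    exact congrArg _ hw.symm

end ProductWitness

/-! ### The dialects used for boolean operations -/

section BooleanDialects

/-- The dialect of the first operand of the restricted boolean operations. -/
def restrictedRoleLeft : Letter → Option Letter
  | Letter.a => some Letter.a
  | Letter.b => some Letter.b
  | Letter.e => some Letter.e
  | _ => none

/-- The dialect of the second operand of the restricted boolean operations. -/
def restrictedRoleRight : Letter → Option Letter
  | Letter.a => some Letter.a
  | Letter.b => some Letter.e
  | Letter.e => some Letter.b
  | _ => none

/-- The dialect of the first operand of the unrestricted boolean operations. -/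
def unrestrictedRoleLeft : Letter → Option Letter
  | Letter.d => none
  | x => some x

/-- The dialect of the second operand of the unrestricted boolean operations. -/
def unrestrictedDialectRight : Letter → Option Letter
  | Letter.a => some Letter.a
  | Letter.b => some Letter.e
  | Letter.c => some Letter.d
  | Letter.d => none
  | Letter.e => some Letter.b

/-- The roles of the letters in the second operand, inverse to `unrestrictedDialectRight`. -/
def unrestrictedRoleRight : Letter → Option Letter
  | Letter.a => some Letter.a
  | Letter.b => some Letter.e
  | Letter.c => none
  | Letter.d => some Letter.c
  | Letter.e => some Letter.b

theorem restrictedRoleLeft_inverse (x y : Letter) :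
    restrictedRoleLeft x = some y ↔ restrictedRoleLeft y = some x := by
  cases x <;> cases y <;> simp [restrictedRoleLeft]

theorem restrictedRoleRight_inverse (x y : Letter) :
    restrictedRoleRight x = some y ↔ restrictedRoleRight y = some x := by
  cases x <;> cases y <;> simp [restrictedRoleRight]

theorem unrestrictedRoleLeft_inverse (x y : Letter) :
    unrestrictedRoleLeft x = some y ↔ unrestrictedRoleLeft y = some x := by
  cases x <;> cases y <;> simp [unrestrictedRoleLeft]

theorem unrestrictedDialectRight_inverse (x y : Letter) :
    unrestrictedDialectRight x = some y ↔ unrestrictedRoleRight y = some x := by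
  cases x <;> cases y <;> simp [unrestrictedRoleRight, unrestrictedDialectRight]

/-- Exchanging `b` and `e` in one operand makes each reset letter act as a transposition on the
other automaton. -/
theorem actCrosswise_restricted :
    ActCrosswise restrictedRoleLeft restrictedRoleRight Letter.a Letter.e Letter.b :=
  ⟨rfl, rfl, rfl, rfl, rfl, rfl⟩

theorem actCrosswise_unrestricted :
    ActCrosswise unrestrictedRoleLeft unrestrictedRoleRight Letter.a Letter.e Letter.b :=
  ⟨rfl, rfl, rfl, rfl, rfl, rfl⟩

theorem mem_dialectAlphabet_iff {π τ : Letter → Option Letter}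
    (hπ : ∀ x y, π x = some y ↔ τ y = some x) (y : Letter) :
    y ∈ dialectAlphabet π ↔ τ y ≠ none := by
  rw [Option.ne_none_iff_exists']
  exact exists_congr fun x => hπ x y

theorem dialectAlphabet_restricted :
    dialectAlphabet restrictedRoleLeft = dialectAlphabet restrictedRoleRight := by
  ext y
  rw [mem_dialectAlphabet_iff restrictedRoleLeft_inverse,
    mem_dialectAlphabet_iff restrictedRoleRight_inverse]
  cases y <;> simp [restrictedRoleLeft, restrictedRoleRight]

theorem union_dialectAlphabet_unrestricted :
    dialectAlphabet unrestrictedRoleLeft ∪ dialectAlphabet unrestrictedDialectRight = Set.univ := by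
  ext y
  rw [Set.mem_union, mem_dialectAlphabet_iff unrestrictedRoleLeft_inverse,
    mem_dialectAlphabet_iff unrestrictedDialectRight_inverse]
  cases y <;> simp [unrestrictedRoleLeft, unrestrictedRoleRight]

theorem union_dialectAlphabet_product :
    dialectAlphabet productRoleLeft ∪ dialectAlphabet productDialectRight = Set.univ := by
  ext y
  rw [Set.mem_union, mem_dialectAlphabet_iff productRoleLeft_inverse,
    mem_dialectAlphabet_iff productDialectRight_inverse]
  cases y <;> simp [productRoleLeft, productRoleRight]

end BooleanDialects

end StateComplexity

/-! ### Assembly of the bounds -/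

open StateComplexity in
theorem theorem11 :
    -- the witness stream: minimality, left ideal, complexity, and the unary measures
    (∀ (n : ℕ) (hn : 4 ≤ n),
      IsMinimalDFA (witnessDFA n hn) ∧
      IsRegularLeftIdeal Set.univ (witness n hn) ∧
      complexity Set.univ (witness n hn) = n ∧
      syntacticSemigroupCard Set.univ (witness n hn) = (n ^ (n - 1) + n - 1 : ℕ) ∧
      (∀ K ∈ quotients Set.univ (witness n hn), complexity Set.univ K = n) ∧
      complexity Set.univ (witness n hn).reverse = (2 ^ (n - 1) + 1 : ℕ) ∧
      (atoms Set.univ (witness n hn)).encard = (2 ^ (n - 1) + 1 : ℕ) ∧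
      (∀ S, IndexesAtom Set.univ (witness n hn) S →
        complexity Set.univ (atomicIntersection Set.univ (witness n hn) S) =
          atomBound n S.ncard) ∧
      complexity Set.univ (KStar.kstar (witness n hn)) = (n + 1 : ℕ)) ∧
    -- the witness stream: restricted product
    (∀ (m n : ℕ) (hm : 4 ≤ m) (hn : 4 ≤ n),
      complexity Set.univ (witness m hm * witness n hn) = (m + n - 1 : ℕ)) ∧
    -- dialect streams: unrestricted product
    (∃ π ρ : Letter → Option Letter, ∀ (m n : ℕ) (hm : 4 ≤ m) (hn : 4 ≤ n),
      IsRegularLeftIdeal (dialectAlphabet π) (dialect π (witness m hm)) ∧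
      complexity (dialectAlphabet π) (dialect π (witness m hm)) = m ∧
      IsRegularLeftIdeal (dialectAlphabet ρ) (dialect ρ (witness n hn)) ∧
      complexity (dialectAlphabet ρ) (dialect ρ (witness n hn)) = n ∧
      complexity (dialectAlphabet π ∪ dialectAlphabet ρ)
        (dialect π (witness m hm) * dialect ρ (witness n hn)) = (m * n + m + n : ℕ)) ∧
    -- dialect streams: restricted boolean operations
    (∃ π ρ : Letter → Option Letter, dialectAlphabet π = dialectAlphabet ρ ∧
      ∀ (m n : ℕ) (hm : 4 ≤ m) (hn : 4 ≤ n),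
        IsRegularLeftIdeal (dialectAlphabet π) (dialect π (witness m hm)) ∧
        complexity (dialectAlphabet π) (dialect π (witness m hm)) = m ∧
        IsRegularLeftIdeal (dialectAlphabet ρ) (dialect ρ (witness n hn)) ∧
        complexity (dialectAlphabet ρ) (dialect ρ (witness n hn)) = n ∧
        ∀ f, IsProper f →
          complexity (dialectAlphabet π)
            (boolOp f (dialectAlphabet π) (dialect π (witness m hm))
              (dialect ρ (witness n hn))) = (m * n : ℕ)) ∧
    -- dialect streams: unrestricted boolean operations
    (∃ π ρ : Letter → Option Letter, ∀ (m n : ℕ) (hm : 4 ≤ m) (hn : 4 ≤ n),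
      IsRegularLeftIdeal (dialectAlphabet π) (dialect π (witness m hm)) ∧
      complexity (dialectAlphabet π) (dialect π (witness m hm)) = m ∧
      IsRegularLeftIdeal (dialectAlphabet ρ) (dialect ρ (witness n hn)) ∧
      complexity (dialectAlphabet ρ) (dialect ρ (witness n hn)) = n ∧
      complexity (dialectAlphabet π ∪ dialectAlphabet ρ)
        (dialect π (witness m hm) ⊔ dialect ρ (witness n hn)) = ((m + 1) * (n + 1) : ℕ) ∧
      complexity (dialectAlphabet π ∪ dialectAlphabet ρ)
        (symmDiff (dialect π (witness m hm)) (dialect ρ (witness n hn))) =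
          ((m + 1) * (n + 1) : ℕ) ∧
      complexity (dialectAlphabet π)
        (dialect π (witness m hm) \ dialect ρ (witness n hn)) = (m * n + m : ℕ) ∧
      complexity (dialectAlphabet π ∩ dialectAlphabet ρ)
        (dialect π (witness m hm) ⊓ dialect ρ (witness n hn)) = (m * n : ℕ)) ∧
    -- the bounds are upper bounds for all regular left ideals: unary measures;
    -- the bound on the semigroup size is not met with fewer than five letters
    (∀ (α : Type*) (A : Set α) (L : Language α) (n : ℕ), 4 ≤ n →
      IsRegularLeftIdeal A L → complexity A L = n →
        syntacticSemigroupCard A L ≤ (n ^ (n - 1) + n - 1 : ℕ) ∧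
        (∀ K ∈ quotients A L, complexity A K ≤ n) ∧
        complexity A L.reverse ≤ (2 ^ (n - 1) + 1 : ℕ) ∧
        (atoms A L).encard ≤ (2 ^ (n - 1) + 1 : ℕ) ∧
        (∀ S, IndexesAtom A L S →
          complexity A (atomicIntersection A L S) ≤ atomBound n S.ncard) ∧
        complexity A (KStar.kstar L) ≤ (n + 1 : ℕ) ∧
        (syntacticSemigroupCard A L = (n ^ (n - 1) + n - 1 : ℕ) → 5 ≤ A.encard)) ∧
    -- upper bounds: restricted binary operations
    (∀ (α : Type*) (A : Set α) (K L : Language α) (m n : ℕ), 4 ≤ m → 4 ≤ n →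
      IsRegularLeftIdeal A K → complexity A K = m →
      IsRegularLeftIdeal A L → complexity A L = n →
        complexity A (K * L) ≤ (m + n - 1 : ℕ) ∧
        ∀ f, IsProper f → complexity A (boolOp f A K L) ≤ (m * n : ℕ)) ∧
    -- upper bounds: unrestricted binary operations
    (∀ (α : Type*) (A B : Set α) (K L : Language α) (m n : ℕ), 4 ≤ m → 4 ≤ n →
      IsRegularLeftIdeal A K → complexity A K = m →
      IsRegularLeftIdeal B L → complexity B L = n →
        complexity (A ∪ B) (K * L) ≤ (m * n + m + n : ℕ) ∧
        complexity (A ∪ B) (K ⊔ L) ≤ ((m + 1) * (n + 1) : ℕ) ∧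
        complexity (A ∪ B) (symmDiff K L) ≤ ((m + 1) * (n + 1) : ℕ) ∧
        complexity A (K \ L) ≤ (m * n + m : ℕ) ∧
        complexity (A ∩ B) (K ⊓ L) ≤ (m * n : ℕ)) := by
  refine ⟨fun n hn => ⟨isMinimalDFA_witnessDFA, isRegularLeftIdeal_witness, complexity_witness,
      syntacticSemigroupCard_witness, fun K hK => complexity_of_mem_quotients_witness hK,
      ?_, ?_, fun S hS => complexity_atom_witness hS, complexity_kstar_witness⟩,
    fun m n hm hn => complexity_witness_mul_witness,
    ⟨productRoleLeft, productDialectRight, fun m n hm hn => ?_⟩,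
    ⟨restrictedRoleLeft, restrictedRoleRight, dialectAlphabet_restricted, fun m n hm hn => ?_⟩,
    ⟨unrestrictedRoleLeft, unrestrictedDialectRight, fun m n hm hn => ?_⟩,
    fun α A L n hn h hc => ⟨syntacticSemigroupCard_le h hc hn,
      fun K hK => (Set.encard_le_encard (quotients_subset_of_mem hK)).trans hc.le, ?_, ?_,
      fun S hS => complexity_atom_le h hc hS, complexity_kstar_le h hc,
      five_le_encard_alphabet h hc hn⟩,
    fun α A K L m n hm hn hK hKm hL hLn =>
      ⟨complexity_mul_le hK hL hKm hLn (by omega), fun f _ => complexity_boolOp_le hKm hLn f⟩,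
    fun α A B K L m n hm hn hK hKm hL hLn =>
      ⟨complexity_mul_le_of_union hK hL hKm hLn (by omega) (by omega),
        complexity_op_le_of_union hK hL hKm hLn (by omega) (by omega) (· ⊔ ·) fun _ => rfl,
        complexity_op_le_of_union hK hL hKm hLn (by omega) (by omega) symmDiff fun _ => rfl,
        complexity_sdiff_le hL hKm hLn (by omega), complexity_inf_le hKm hLn⟩⟩
  · rw [complexity_reverse_eq isRegularLeftIdeal_witness.subset_words, encard_indexesAtom_witness]
  · rw [encard_atoms_eq, encard_indexesAtom_witness]
  · have hL := isRegularLeftIdeal_dialect (n := m) (hn := hm) productRoleLeft_inverse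
    have hLc := complexity_dialect (n := m) (hn := hm) productRoleLeft_inverse
      ⟨Letter.a, rfl⟩ ⟨Letter.e, rfl⟩
    have hR := isRegularLeftIdeal_dialect (n := n) (hn := hn) productDialectRight_inverse
    have hRc := complexity_dialect (n := n) (hn := hn) productDialectRight_inverse
      ⟨Letter.d, rfl⟩ ⟨Letter.e, rfl⟩
    refine ⟨hL, hLc, hR, hRc,
      (complexity_mul_le_of_union hL hR hLc hRc (by omega) (by omega)).antisymm ?_⟩
    rw [union_dialectAlphabet_product]
    exact complexity_product_witness
  · have hL := isRegularLeftIdeal_dialect (n := m) (hn := hm) restrictedRoleLeft_inverse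
    have hLc := complexity_dialect (n := m) (hn := hm) restrictedRoleLeft_inverse
      ⟨Letter.a, rfl⟩ ⟨Letter.e, rfl⟩
    have hR := isRegularLeftIdeal_dialect (n := n) (hn := hn) restrictedRoleRight_inverse
    have hRc := complexity_dialect (n := n) (hn := hn) restrictedRoleRight_inverse
      ⟨Letter.a, rfl⟩ ⟨Letter.b, rfl⟩
    refine ⟨hL, hLc, hR, hRc, fun f hf => ?_⟩
    refine (complexity_boolOp_le hLc (dialectAlphabet_restricted ▸ hRc) f).antisymm
      (actCrosswise_restricted.complexity_boolOp restrictedRoleLeft_inverse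
        restrictedRoleRight_inverse ?_ hf)
    rintro y (rfl | rfl | rfl) <;> rw [mem_dialectAlphabet_iff restrictedRoleLeft_inverse] <;>
      exact Option.some_ne_none _
  · have hL := isRegularLeftIdeal_dialect (n := m) (hn := hm) unrestrictedRoleLeft_inverse
    have hLc := complexity_dialect (n := m) (hn := hm) unrestrictedRoleLeft_inverse
      ⟨Letter.a, rfl⟩ ⟨Letter.e, rfl⟩
    have hR := isRegularLeftIdeal_dialect (n := n) (hn := hn) unrestrictedDialectRight_inverse
    have hRc := complexity_dialect (n := n) (hn := hn) unrestrictedDialectRight_inverse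
      ⟨Letter.a, rfl⟩ ⟨Letter.b, rfl⟩
    refine ⟨hL, hLc, hR, hRc,
      (complexity_op_le_of_union hL hR hLc hRc (by omega) (by omega) (· ⊔ ·)
        fun _ => rfl).antisymm ?_,
      (complexity_op_le_of_union hL hR hLc hRc (by omega) (by omega) symmDiff
        fun _ => rfl).antisymm ?_,
      (complexity_sdiff_le hR hLc hRc (by omega)).antisymm ?_,
      (complexity_inf_le hLc hRc).antisymm ?_⟩
    · rw [union_dialectAlphabet_unrestricted]
      exact actCrosswise_unrestricted.complexity_sup (z := Letter.c) (t := Letter.d)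
        unrestrictedRoleLeft_inverse unrestrictedDialectRight_inverse rfl rfl rfl rfl
    · rw [union_dialectAlphabet_unrestricted]
      exact actCrosswise_unrestricted.complexity_symmDiff (z := Letter.c) (t := Letter.d)
        unrestrictedRoleLeft_inverse unrestrictedDialectRight_inverse rfl rfl rfl rfl
    · refine actCrosswise_unrestricted.complexity_sdiff (z := Letter.c)
        unrestrictedRoleLeft_inverse unrestrictedDialectRight_inverse rfl rfl ?_
      rintro y (rfl | rfl | rfl | rfl) <;>
        rw [mem_dialectAlphabet_iff unrestrictedRoleLeft_inverse] <;> exact Option.some_ne_none _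
    · refine actCrosswise_unrestricted.complexity_inf
        unrestrictedRoleLeft_inverse unrestrictedDialectRight_inverse ?_
      rintro y (rfl | rfl | rfl) <;>
        rw [Set.mem_inter_iff, mem_dialectAlphabet_iff unrestrictedRoleLeft_inverse,
          mem_dialectAlphabet_iff unrestrictedDialectRight_inverse] <;>
        exact ⟨Option.some_ne_none _, Option.some_ne_none _⟩
  · rw [complexity_reverse_eq h.subset_words]
    exact encard_indexesAtom_le h hc
  · rw [encard_atoms_eq]
    exact encard_indexesAtom_le h hc
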